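/- A \emph{discounted game} is given by a finite directed graph $G=(V,E)$ in which every node has at least one outgoing edge, a partition $V=V_{\mathrm{Max}}\sqcup V_{\mathrm{Min}}$, a weight function $w\colon E\to\mathbb R$ and a discount factor $\lambda\in(0,1)$. It is \emph{bipartite} if $E\subseteq (V_{\mathrm{Max}}\times V_{\mathrm{Min}})\cup(V_{\mathrm{Min}}\times V_{\mathrm{Max}})$. Its \emph{vector of values} is the unique solution $x\in\mathbb R^V$ of the optimality equations $$x_a=\max_{(a,b)\in E}\bigl(w(a,b)+\lambda x_b\bigr)\ \ (a\in V_{\mathrm{Max}}),\qquad x_a=\min_{(a,b)\in E}\bigl(w(a,b)+\lambda x_b\bigr)\ \ (a\in V_{\mathrm{Min}}).$$ \textbf{Theorem.} There is a deterministic algorithm that finds the vector of values of every bipartite discounted game on a graph with $n$ nodes in $n^{O(1)}\cdot 2^n$ time and $n^{O(1)}$ space. The algorithm can be performed even when the discount factor and the edge weights are arbitrary real numbers, assuming that basic arithmetic operations ($+,-,\cdot,/$) and comparisons with them are carried out by an oracle at unit cost. Precisely: there is one program for a random access machine with memory cells for natural numbers and for real numbers, with unit-cost arithmetic and comparisons,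 without real constants other than natural number literals and without rounding, that on every bipartite discounted game with $n$ nodes, with arbitrary real weights and discount factor, halts with the vector of values after at most $n^{O(1)}\cdot 2^n$ steps; throughout the computation it uses $n^{O(1)}$ memory cells, and the natural numbers stored have size $n^{O(1)}$. Moreover, if the discount factor and all weights are rational numbers of bit-length at most $L$, then every real number stored during the computation is a rational number of bit-length at most $(n+L)^{O(1)}$. Here $n^{O(1)}$ and $(n+L)^{O(1)}$ denote bounds by a fixed polynomial. -/

import Mathlib

/-! ### Discounted games -/

/-- A discounted game on `n` nodes: a directed graph in which every node has an outgoing edge,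
a set of Max's nodes (all other nodes are Min's), real edge weights and a discount factor
in `(0, 1)`.  Only the weights `w (a, b)` of edges `(a, b) ∈ E` are part of the game: the values
of `w` outside `E` are never used. -/
structure DiscountedGame (n : ℕ) where
  VMax : Finset (Fin n)
  E : Finset (Fin n × Fin n)
  exists_edge : ∀ a : Fin n, ∃ b : Fin n, (a, b) ∈ E
  w : Fin n × Fin n → ℝ
  disc : ℝ
  disc_pos : 0 < disc
  disc_lt_one : disc < 1

/-- Every edge goes from a node of one player to a node of the other player. -/
def DiscountedGame.Bipartite {n : ℕ} (G : DiscountedGame n) : Prop :=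
  ∀ a b : Fin n, (a, b) ∈ G.E → (a ∈ G.VMax ∧ b ∉ G.VMax) ∨ (a ∉ G.VMax ∧ b ∈ G.VMax)

/-- The set of the numbers `w (a, b) + disc * x b` over the edges `(a, b)` leaving `a`. -/
def DiscountedGame.options {n : ℕ} (G : DiscountedGame n) (x : Fin n → ℝ) (a : Fin n) : Set ℝ :=
  {r | ∃ b : Fin n, (a, b) ∈ G.E ∧ r = G.w (a, b) + G.disc * x b}

/-- `x` is the vector of values of the game: it solves the optimality equations
`x a = max (w (a, b) + disc * x b)` at Max's nodes, `x a = min (w (a, b) + disc * x b)` at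
Min's nodes, the maximum and minimum being over the edges `(a, b)` leaving `a`. -/
def DiscountedGame.IsValueVector {n : ℕ} (G : DiscountedGame n) (x : Fin n → ℝ) : Prop :=
  (∀ a ∈ G.VMax, IsGreatest (G.options x a) (x a)) ∧
    (∀ a ∉ G.VMax, IsLeast (G.options x a) (x a))

/-- `x` is a rational number which, in lowest terms, is written with at most `B` bits
(numerator and denominator together, sign not counted). -/
def RatBits (B : ℕ) (x : ℝ) : Prop :=
  ∃ q : ℚ, (q : ℝ) = x ∧ Nat.size q.num.natAbs + Nat.size q.den ≤ B

/-- The discount factor and all edge weights are rationals of bit-length at most `L`. -/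
def DiscountedGame.RationalData {n : ℕ} (G : DiscountedGame n) (L : ℕ) : Prop :=
  RatBits L G.disc ∧ ∀ e ∈ G.E, RatBits L (G.w e)

/-! ### Random access machines with real arithmetic

The memory consists of arrays of natural numbers and arrays of real numbers.  The number of an
array is a literal of the program, so a program uses a fixed finite number of arrays; the index
inside an array is computed at run time.  Scalar variables are cells with index `0`.
Programs can do the four arithmetic operations on real numbers and compare them, each at unit
cost; they have no real constants other than natural number literals, and no rounding or other
conversion from reals to natural numbers. -/

namespace RealRAM

/-- A state of the memory. -/
structure Mem where
  nat : ℕ → ℕ → ℕ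
  real : ℕ → ℕ → ℝ

def Mem.setNat (s : Mem) (arr i v : ℕ) : Mem :=
  { s with nat := Function.update s.nat arr (Function.update (s.nat arr) i v) }

noncomputable def Mem.setReal (s : Mem) (arr i : ℕ) (v : ℝ) : Mem :=
  { s with real := Function.update s.real arr (Function.update (s.real arr) i v) }

/-- Natural number expressions; `cell arr i` reads cell `i` of array number `arr`. -/
inductive NExp where
  | lit (c : ℕ)
  | cell (arr : ℕ) (i : NExp)
  | add (a b : NExp)
  | sub (a b : NExp)
  | mul (a b : NExp)

/-- Real expressions. -/
inductive RExp where
  | lit (c : ℕ)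
  | cell (arr : ℕ) (i : NExp)
  | add (a b : RExp)
  | sub (a b : RExp)
  | mul (a b : RExp)
  | div (a b : RExp)

/-- Tests. -/
inductive Test where
  | natLe (a b : NExp)
  | realLe (a b : RExp)
  | not (t : Test)
  | and (t u : Test)

/-- Programs: assignments to a cell of an array, composition, branching and while loops. -/
inductive Prog where
  | nop
  | setNat (arr : ℕ) (i e : NExp)
  | setReal (arr : ℕ) (i : NExp) (e : RExp)
  | seq (p q : Prog)
  | branch (t : Test) (p q : Prog)
  | loop (t : Test) (p : Prog)

/-- Evaluation; subtraction of natural numbers is truncated at `0`. -/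
def NExp.eval (s : Mem) : NExp → ℕ
  | .lit c => c
  | .cell arr i => s.nat arr (i.eval s)
  | .add a b => a.eval s + b.eval s
  | .sub a b => a.eval s - b.eval s
  | .mul a b => a.eval s * b.eval s

/-- Evaluation; by convention division by `0` returns `0`. -/
noncomputable def RExp.eval (s : Mem) : RExp → ℝ
  | .lit c => (c : ℝ)
  | .cell arr i => s.real arr (i.eval s)
  | .add a b => a.eval s + b.eval s
  | .sub a b => a.eval s - b.eval s
  | .mul a b => a.eval s * b.eval s
  | .div a b => a.eval s / b.eval s

def Test.holds (s : Mem) : Test → Prop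
  | .natLe a b => a.eval s ≤ b.eval s
  | .realLe a b => a.eval s ≤ b.eval s
  | .not t => ¬ t.holds s
  | .and t u => t.holds s ∧ u.holds s

/-- The time for evaluating an expression: one unit for every literal, every memory access and
every operation. -/
def NExp.cost : NExp → ℕ
  | .lit _ => 1
  | .cell _ i => i.cost + 1
  | .add a b => a.cost + b.cost + 1
  | .sub a b => a.cost + b.cost + 1
  | .mul a b => a.cost + b.cost + 1

def RExp.cost : RExp → ℕ
  | .lit _ => 1
  | .cell _ i => i.cost + 1
  | .add a b => a.cost + b.cost + 1
  | .sub a b => a.cost + b.cost + 1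
  | .mul a b => a.cost + b.cost + 1
  | .div a b => a.cost + b.cost + 1

def Test.cost : Test → ℕ
  | .natLe a b => a.cost + b.cost + 1
  | .realLe a b => a.cost + b.cost + 1
  | .not t => t.cost + 1
  | .and t u => t.cost + u.cost + 1

/-- `Exec P p s t s'`: the program `p`, started in memory `s`, halts after `t` units of time in
memory `s'`, and every state of the memory from the start to the end satisfies `P`. -/
inductive Exec (P : Mem → Prop) : Prog → Mem → ℕ → Mem → Prop
  | nop {s : Mem} : P s → Exec P .nop s 1 s
  | setNat {s : Mem} {arr : ℕ} {i e : NExp} :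
      P s → P (s.setNat arr (i.eval s) (e.eval s)) →
      Exec P (.setNat arr i e) s (i.cost + e.cost + 1) (s.setNat arr (i.eval s) (e.eval s))
  | setReal {s : Mem} {arr : ℕ} {i : NExp} {e : RExp} :
      P s → P (s.setReal arr (i.eval s) (e.eval s)) →
      Exec P (.setReal arr i e) s (i.cost + e.cost + 1) (s.setReal arr (i.eval s) (e.eval s))
  | seq {p q : Prog} {s s' s'' : Mem} {t t' : ℕ} :
      Exec P p s t s' → Exec P q s' t' s'' → Exec P (.seq p q) s (t + t') s''
  | branch_true {b : Test} {p q : Prog} {s s' : Mem} {t : ℕ} :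
      b.holds s → Exec P p s t s' → Exec P (.branch b p q) s (b.cost + t) s'
  | branch_false {b : Test} {p q : Prog} {s s' : Mem} {t : ℕ} :
      ¬ b.holds s → Exec P q s t s' → Exec P (.branch b p q) s (b.cost + t) s'
  | loop_true {b : Test} {p : Prog} {s s' s'' : Mem} {t t' : ℕ} :
      b.holds s → Exec P p s t s' → Exec P (.loop b p) s' t' s'' →
      Exec P (.loop b p) s (b.cost + t + t') s''
  | loop_false {b : Test} {p : Prog} {s : Mem} :
      ¬ b.holds s → P s → Exec P (.loop b p) s b.cost s

/-- The contents of the memory fit in space `S`: in every array only cells with index below `S`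
are in use, and the natural numbers stored are at most `S` (so they have `O(log S)` bits). -/
def Mem.FitsIn (s : Mem) (S : ℕ) : Prop :=
  (∀ arr i, s.nat arr i ≤ S) ∧ ∀ arr i, S ≤ i → s.nat arr i = 0 ∧ s.real arr i = 0

/-- All real numbers stored are rationals of bit-length at most `B`. -/
def Mem.RealBits (s : Mem) (B : ℕ) : Prop :=
  ∀ arr i, RatBits B (s.real arr i)

end RealRAM

/-- The input: natural number array `0` holds `n`, array `1` the indicator of Max's nodes and
array `2` the adjacency matrix (row by row: entry `(a, b)` is at index `b + n * a`); real array `0`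
holds the discount factor and array `1` the edge weights, arranged as the adjacency matrix.
All other cells are `0`. -/
noncomputable def DiscountedGame.input {n : ℕ} (G : DiscountedGame n) : RealRAM.Mem where
  nat arr i :=
    if arr = 0 then (if i = 0 then n else 0)
    else if arr = 1 then (if h : i < n then (if (⟨i, h⟩ : Fin n) ∈ G.VMax then 1 else 0) else 0)
    else if arr = 2 then
      (if h : i < n * n then (if finProdFinEquiv.symm ⟨i, h⟩ ∈ G.E then 1 else 0) else 0)
    else 0
  real arr i :=
    if arr = 0 then (if i = 0 then G.disc else 0)
    else if arr = 1 then
      (if h : i < n * n then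
        (if finProdFinEquiv.symm ⟨i, h⟩ ∈ G.E then G.w (finProdFinEquiv.symm ⟨i, h⟩) else 0)
        else 0)
    else 0

/-- The output: the number of node `i` is in cell `i` of real array `2`. -/
def RealRAM.Mem.output (s : RealRAM.Mem) (n : ℕ) : Fin n → ℝ :=
  fun i => s.real 2 i

/-! Why in-degrees suffice. Give missing edges weights so unattractive that they never matter; then
every node of Max is joined to every node of Min and conversely, with matrices `A` and `B`. Let `ys`
be the values at Min's nodes. An optimal strategy of Max sends each of its nodes (a source) `a` to a
target `b` that maximises `A a b + lam * ys b`, so `lam * ys` acts as a system of prices. If another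
strategy uses every target equally often, the prices contribute the same total to both. Hence a
strategy of maximal total weight among those with the in-degrees of an optimal one is itself greedy
for `lam * ys`, and therefore optimal (`Greedy.eq_of_sum_eq`, `MatrixGame.optimal_of_sum_eq`). So
only the in-degrees need to be guessed. They are coded by bit strings of length `n`: for every
target a run of ones as long as its in-degree, closed by a zero (`exists_describes`). This gives the
factor `2 ^ n`.

Finding the strategy. For fixed in-degrees the sources are added one at a time, each by an
alternating walk of maximal weight found by the Bellman–Ford recursion. Prices for the current
assignment exclude closed walks of positive weight, so the table stabilises after `m` rows
(`WalkTable.stable`); its negated last row gives prices for the enlarged assignment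
(`WalkTable.Tracing.finish`).

Evaluating it. Against a fixed strategy, Min can confine itself to lassos: a walk followed by a
closed walk repeated forever, both of at most `m` steps. Minimal lasso costs are found by dynamic
programming. For every strategy the result is at most `ys` (`MatrixGame.le_value`), and for an
optimal one it is at least `ys`. Thus the componentwise maximum over all bit strings is `ys`
(`exists_exec_rounds`), and strings that describe no in-degrees do no harm.

Resources. `Runs` is a small program logic that tracks memory, time and an abstract size of real
numbers. Its instance `DiscountedGame.Size` is a condition only when the data are rational, so one
execution serves both real and rational inputs. Every loop except the outermost makes at most `n`
rounds, which gives polynomial time per bit string. Sizes add under arithmetic, and each row of a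
table adds a fixed amount. -/

/-! ### Assignments with prescribed in-degrees -/

/-- The map `σ` on `0, …, j - 1` is a greedy choice with respect to the weights `A` and the prices
`p` of the targets `0, …, m - 1`. -/
def Greedy (A : ℕ → ℕ → ℝ) (m j : ℕ) (σ : ℕ → ℕ) (p : ℕ → ℝ) : Prop :=
  ∀ a < j, ∀ b < m, A a b + p b ≤ A a (σ a) + p (σ a)

/-- A greedy assignment has maximal weight among all assignments with the same in-degrees. Thus it
is greedy for every `p` for which some assignment with these in-degrees is. -/
theorem Greedy.eq_of_sum_eq {A : ℕ → ℕ → ℝ} {m k : ℕ} {σ σ' : ℕ → ℕ} {p p' : ℕ → ℝ}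
    (h : Greedy A m k σ p) (h' : Greedy A m k σ' p') (hσ : ∀ a < k, σ a < m)
    (hσ' : ∀ a < k, σ' a < m)
    (hsum : ∀ f : ℕ → ℝ, ∑ a ∈ Finset.range k, f (σ a) = ∑ a ∈ Finset.range k, f (σ' a)) :
    ∀ a < k, A a (σ a) + p' (σ a) = A a (σ' a) + p' (σ' a) := by
  have h1 : ∑ a ∈ Finset.range k, (A a (σ' a) + p (σ' a)) ≤
      ∑ a ∈ Finset.range k, (A a (σ a) + p (σ a)) :=
    Finset.sum_le_sum fun a ha =>
      h a (Finset.mem_range.1 ha) _ (hσ' a (Finset.mem_range.1 ha))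
  have h2 : ∀ a ∈ Finset.range k, A a (σ a) + p' (σ a) ≤ A a (σ' a) + p' (σ' a) := fun a ha =>
      h' a (Finset.mem_range.1 ha) _ (hσ a (Finset.mem_range.1 ha))
  have h3 : ∑ a ∈ Finset.range k, (A a (σ a) + p' (σ a)) =
      ∑ a ∈ Finset.range k, (A a (σ' a) + p' (σ' a)) := by
    -- Equal in-degrees make the two price sums cancel, so maximality for `p` is transferred to
    -- `p'`. Together with the termwise inequality `h2` it forces equality in every term.
    refine le_antisymm (Finset.sum_le_sum h2) ?_
    simp only [Finset.sum_add_distrib] at h1 ⊢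
    rw [hsum p] at h1
    rw [hsum p']
    linarith
  intro a ha
  exact (Finset.sum_eq_sum_iff_of_le h2).1 h3 a (Finset.mem_range.2 ha)

/-- `D l b` is the maximal weight of an alternating walk with at most `l` exchanges from the new
source `j` to `b`, and `pr (l + 1) b` is the source moved to `b` in the last exchange
(`j` if less than `l + 1` exchanges suffice). -/
structure WalkTable (A : ℕ → ℕ → ℝ) (m j : ℕ) (σ : ℕ → ℕ) (D : ℕ → ℕ → ℝ) (pr : ℕ → ℕ → ℕ) :
    Prop where
  zero : ∀ b < m, D 0 b = A j b
  relax : ∀ l < m, ∀ b < m, ∀ a < j, D l (σ a) + A a b - A a (σ a) ≤ D (l + 1) b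
  pred : ∀ l < m, ∀ b < m, (pr (l + 1) b = j ∧ D (l + 1) b = D l b) ∨
    (pr (l + 1) b < j ∧ D l b < D (l + 1) b ∧
      D (l + 1) b = D l (σ (pr (l + 1) b)) + A (pr (l + 1) b) b - A (pr (l + 1) b) (σ (pr (l + 1) b)))

/-! ### Bellman–Ford for alternating walks, and augmentation. -/

namespace WalkTable

variable {A : ℕ → ℕ → ℝ} {m j : ℕ} {σ : ℕ → ℕ} {D : ℕ → ℕ → ℝ} {pr : ℕ → ℕ → ℕ} {p : ℕ → ℝ}

theorem le_succ (h : WalkTable A m j σ D pr) {l b : ℕ} (hl : l < m) (hb : b < m) :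
    D l b ≤ D (l + 1) b := by
  rcases h.pred l hl b hb with h1 | h1
  · exact h1.2.ge
  · exact h1.2.1.le

theorem mono (h : WalkTable A m j σ D pr) {l l' b : ℕ} (hl : l ≤ l') (hl' : l' ≤ m) (hb : b < m) :
    D l b ≤ D l' b := by
  induction l', hl using Nat.le_induction with
  | base => exact le_rfl
  | succ q hq ih => exact (ih (by omega)).trans (h.le_succ (by omega) hb)

/-- A walk with `l` exchanges that is better than all shorter ones visits `l + 1` targets. -/
theorem exists_finset (h : WalkTable A m j σ D pr) (hσ : ∀ a < j, σ a < m)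
    (hg : Greedy A m j σ p) (l : ℕ) (hl : l ≤ m) :
    ∀ b < m, (∀ q, q + 1 = l → D q b < D l b) → ∃ S : Finset ℕ, S ⊆ Finset.range m ∧
      l + 1 ≤ S.card ∧ ∀ v ∈ S, D l b + p b ≤ D l v + p v := by
  induction l with
  | zero =>
    intro b hb _
    exact ⟨{b}, by simpa using hb, by simp, by simp⟩
  | succ l ih =>
    intro b hb hlt
    have hlt := hlt l rfl
    rcases h.pred l (by omega) b hb with h1 | ⟨h1, -, h2⟩
    · exact absurd h1.2 hlt.ne'
    set a := pr (l + 1) b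
    have hu := hσ a h1
    have hga := hg a h1 b hb
    -- If row `l - 1` already reached the value at `σ a`, then relaxing `a` would give the new value
    -- at `b` one row earlier. So the walk to `σ a` is also strictly better than all shorter ones.
    obtain ⟨S, hS, hc, hv⟩ := ih (by omega) (σ a) hu fun q hq => by
      subst hq
      have := h.relax q (by omega) b hb a h1
      linarith
    refine ⟨insert b S, Finset.insert_subset (Finset.mem_range.2 hb) hS, ?_, ?_⟩
    · rw [Finset.card_insert_of_notMem]
      · omega
      -- Greediness makes `D + p` nonincreasing along the walk. Were `b` among the earlier targets,
      -- its value in row `l` would be at least the new one.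
      · intro hbS
        have := hv b hbS
        linarith
    · intro v hvS
      rcases Finset.mem_insert.1 hvS with rfl | hvS
      · exact le_rfl
      · have h3 := hv v hvS
        have h4 := h.le_succ (l := l) (by omega) (Finset.mem_range.1 (hS hvS))
        linarith

/-- A strict improvement in row `m` would exhibit `m + 1` distinct targets by `exists_finset`. So
rows `m - 1` and `m` agree at `σ a`, and relaxing once more gains nothing. Read with prices `-D m`,
this says that `σ` is greedy. -/
theorem stable (h : WalkTable A m j σ D pr) (hσ : ∀ a < j, σ a < m)
    (hg : Greedy A m j σ p) {a b : ℕ} (ha : a < j) (hb : b < m) :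
    D m (σ a) + A a b - A a (σ a) ≤ D m b := by
  have hm : m - 1 + 1 = m := by omega
  have heq : D m (σ a) = D (m - 1) (σ a) := by
    by_contra hne
    have hle := h.le_succ (l := m - 1) (by omega) (hσ a ha)
    rw [hm] at hle
    obtain ⟨S, hS, hc, -⟩ := h.exists_finset hσ hg m le_rfl (σ a) (hσ a ha) fun q hq => by
      obtain rfl : q = m - 1 := by omega
      exact lt_of_le_of_ne hle (Ne.symm hne)
    have := Finset.card_le_card hS
    rw [Finset.card_range] at this
    omega
  have := h.relax (m - 1) (by omega) b hb a ha
  rw [hm] at this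
  linarith

/-- The state of an augmentation: `σ'` arises from `σ` by moving the sources on the final part of an
optimal walk to `c`, which still has to be extended by a walk to `cur` with at most `l` exchanges. -/
structure Tracing (A : ℕ → ℕ → ℝ) (m j c : ℕ) (σ : ℕ → ℕ) (D : ℕ → ℕ → ℝ) (l : ℕ) (σ' : ℕ → ℕ)
    (cur : ℕ) : Prop where
  cur_lt : cur < m
  cur_opt : D l cur = D m cur
  lt : ∀ a < j, σ' a < m
  tight : ∀ a < j, A a (σ' a) - D m (σ' a) = A a (σ a) - D m (σ a)
  moved : ∀ a < j, σ' a ≠ σ a → σ a = cur ∨ D l (σ a) < D m (σ a)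
  sum : ∀ f : ℕ → ℝ, ∑ a ∈ Finset.range j, f (σ' a) + f cur =
    ∑ a ∈ Finset.range j, f (σ a) + f c

theorem Tracing.start {c : ℕ} (hσ : ∀ a < j, σ a < m) (hc : c < m) :
    Tracing A m j c σ D m σ c :=
  ⟨hc, rfl, hσ, fun _ _ => rfl, fun _ _ hne => absurd rfl hne, fun _ => rfl⟩

/-- The stored source `j` marks an entry of row `l + 1` copied from row `l`, so one exchange fewer
is enough. -/
theorem Tracing.stay (h : WalkTable A m j σ D pr) (hσ : ∀ a < j, σ a < m) {c l cur : ℕ}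
    {σ' : ℕ → ℕ} (hl : l < m) (ht : Tracing A m j c σ D (l + 1) σ' cur)
    (hp : ¬ pr (l + 1) cur < j) : Tracing A m j c σ D l σ' cur := by
  have heq : D (l + 1) cur = D l cur := by
    rcases h.pred l hl cur ht.cur_lt with h1 | h1
    · exact h1.2
    · exact absurd h1.1 hp
  refine ⟨ht.cur_lt, heq ▸ ht.cur_opt, ht.lt, ht.tight, fun a ha hne => ?_, ht.sum⟩
  rcases ht.moved a ha hne with h1 | h1
  · exact .inl h1
  · exact .inr ((h.le_succ hl (hσ a ha)).trans_lt h1)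

/-- By stability, the last exchange of an optimal walk starts at a target reached optimally within
`l` exchanges. That target becomes the new end, and the exchange does not change the weight reduced
by the prices `-D m`. -/
theorem Tracing.move (h : WalkTable A m j σ D pr) (hσ : ∀ a < j, σ a < m)
    (hg : Greedy A m j σ p) {c l cur : ℕ}
    {σ' : ℕ → ℕ} (hl : l < m) (ht : Tracing A m j c σ D (l + 1) σ' cur)
    (hp : pr (l + 1) cur < j) :
    Tracing A m j c σ D l (Function.update σ' (pr (l + 1) cur) cur) (σ' (pr (l + 1) cur)) := by
  have hc := ht.cur_lt
  obtain ⟨-, h1, h2⟩ := (h.pred l hl cur hc).resolve_left fun h3 => hp.ne h3.1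
  set a := pr (l + 1) cur
  have hu := hσ a hp
  have hst := h.stable hσ hg hp hc
  have hmu := h.mono hl.le le_rfl hu
  have hopt := ht.cur_opt
  have hDu : D l (σ a) = D m (σ a) := by linarith
  -- No source is moved twice. If `a` had been moved, either `σ a = cur`, where row `l` is still
  -- below the optimum, or `D (l + 1) (σ a)` is below the optimum; both contradict `hDu`.
  have hne : σ' a = σ a := by
    by_contra hne
    rcases ht.moved a hp hne with h3 | h3
    · rw [h3] at hDu
      linarith
    · have := h.le_succ hl hu
      linarith
  refine ⟨ht.lt a hp, hne ▸ hDu, fun a' ha' => ?_, fun a' ha' => ?_, fun a' ha' hn => ?_,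
    fun f => ?_⟩
  · rw [Function.update_apply]
    split_ifs
    · exact hc
    · exact ht.lt a' ha'
  · rw [Function.update_apply]
    split_ifs with haa
    · subst haa
      linarith
    · exact ht.tight a' ha'
  · rw [Function.update_apply] at hn
    rw [hne]
    split_ifs at hn with haa
    · exact .inl (by rw [haa])
    · right
      -- A source that came from the old `cur` passes to the second alternative: row `l` is strictly
      -- below the optimum at `cur`, as the table improved there.
      rcases ht.moved a' ha' hn with h3 | h3
      · rw [h3]; linarith
      · exact (h.le_succ hl (hσ a' ha')).trans_lt h3
  · have hs := ht.sum f
    rw [← Finset.add_sum_erase _ _ (Finset.mem_range.2 hp)] at hs ⊢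
    rw [Function.update_self]
    have : ∑ x ∈ (Finset.range j).erase a, f (Function.update σ' a cur x) =
        ∑ x ∈ (Finset.range j).erase a, f (σ' x) :=
      Finset.sum_congr rfl fun x hx => by
        rw [Function.update_of_ne (Finset.ne_of_mem_erase hx)]
    linarith

/-- With no exchanges left, `A j cur = D m cur`, whereas `A j b ≤ D m b` for every target, so the
new source is greedy for `-D m`. For the old sources, `tight` carries the greediness given by
`stable` over to `σ'`. -/
theorem Tracing.finish (h : WalkTable A m j σ D pr) (hσ : ∀ a < j, σ a < m)
    (hg : Greedy A m j σ p) {c cur : ℕ} {σ' : ℕ → ℕ} (ht : Tracing A m j c σ D 0 σ' cur) :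
    Greedy A m (j + 1) (Function.update σ' j cur) (fun b => -D m b) ∧
    ∀ f : ℕ → ℝ, ∑ a ∈ Finset.range (j + 1), f (Function.update σ' j cur a) =
      ∑ a ∈ Finset.range j, f (σ a) + f c := by
  constructor
  · intro a ha b hb
    rcases Nat.lt_succ_iff_lt_or_eq.1 ha with ha | rfl
    · rw [Function.update_of_ne ha.ne]
      have h1 := ht.tight a ha
      have h2 := h.stable hσ hg ha hb
      linarith
    · rw [Function.update_self]
      have h1 := h.zero b hb
      have h2 := h.zero cur ht.cur_lt
      have h3 := h.mono (Nat.zero_le m) le_rfl hb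
      have h4 := ht.cur_opt
      linarith
  · intro f
    rw [Finset.sum_range_succ, Function.update_self, ← ht.sum f]
    congr 1
    exact Finset.sum_congr rfl fun a ha => by
      rw [Function.update_of_ne (Finset.mem_range.1 ha).ne]

end WalkTable

/-! ### Evaluation of a strategy -/

/-- `xs` and `ys` are the values of a bipartite discounted game with `k` nodes of Max, `m` nodes of
Min and edges in both directions between them, with weights `A i j` and `B j i`; the values are at
most `M` in absolute value. -/
structure MatrixGame (k m : ℕ) (A B : ℕ → ℕ → ℝ) (lam M : ℝ) (xs ys : ℕ → ℝ) : Prop where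
  pos : 0 < lam
  lt_one : lam < 1
  max_le : ∀ i < k, ∀ j < m, A i j + lam * ys j ≤ xs i
  max_eq : ∀ i < k, ∃ j < m, xs i = A i j + lam * ys j
  min_le : ∀ j < m, ∀ i < k, ys j ≤ B j i + lam * xs i
  min_eq : ∀ j < m, ∃ i < k, ys j = B j i + lam * xs i
  abs_max : ∀ i < k, |xs i| ≤ M
  abs_min : ∀ j < m, |ys j| ≤ M

/-- The discounted cost of `l` steps. -/
def walkCost (μ : ℝ) (c : ℕ → ℝ) (nx : ℕ → ℕ) : ℕ → ℕ → ℝ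
  | 0, _ => 0
  | l + 1, u => c u + μ * walkCost μ c nx l (nx u)

/-- The one-step inequality telescopes along the orbit. -/
theorem walkCost_add_le {μ : ℝ} (hμ : 0 ≤ μ) {c : ℕ → ℝ} {nx : ℕ → ℕ} {m : ℕ}
    (hnx : ∀ u < m, nx u < m) {ys : ℕ → ℝ} (h : ∀ u < m, c u + μ * ys (nx u) ≤ ys u) (l : ℕ) :
    ∀ u < m, walkCost μ c nx l u + μ ^ l * ys (nx^[l] u) ≤ ys u := by
  induction l with
  | zero => intro u _; simp [walkCost]
  | succ l ih =>
    intro u hu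
    have h1 := ih _ (hnx u hu)
    have h2 := mul_le_mul_of_nonneg_left h1 hμ
    have h3 := h u hu
    rw [Function.iterate_succ_apply, walkCost, pow_succ]
    linarith

/-- Pigeonhole on the first `m + 1` points of the orbit. The bounds on both the tail and the period
are what allow tables with rows `0, …, m` to contain the lasso. -/
theorem exists_iterate_eq {nx : ℕ → ℕ} {m : ℕ} (hnx : ∀ u < m, nx u < m) {u : ℕ} (hu : u < m) :
    ∃ l < m, ∃ q < m, nx^[q + 1] (nx^[l] u) = nx^[l] u := by
  have hit : ∀ l, nx^[l] u < m := by
    intro l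
    induction l with
    | zero => exact hu
    | succ l ih => rw [Function.iterate_succ_apply']; exact hnx _ ih
  obtain ⟨i, hi, j, hj, hne, heq⟩ := Finset.exists_ne_map_eq_of_card_lt_of_maps_to
    (s := Finset.range (m + 1)) (t := Finset.range m) (by simp) (f := fun l => nx^[l] u)
    (fun l _ => by simpa using hit l)
  simp only [Finset.mem_range] at hi hj
  wlog hlt : i < j generalizing i j
  · exact this j i hne.symm heq.symm hj hi (by omega)
  refine ⟨i, by omega, j - i - 1, by omega, ?_⟩
  rw [← Function.iterate_add_apply, show j - i - 1 + 1 + i = j by omega]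
  exact heq.symm

namespace MatrixGame

variable {k m : ℕ} {A B : ℕ → ℕ → ℝ} {lam M : ℝ} {xs ys : ℕ → ℝ}

/-- Against the strategy `σ` of Max, the player Min cannot get below `ys`. -/
def Optimal (k m : ℕ) (A B : ℕ → ℕ → ℝ) (lam : ℝ) (ys : ℕ → ℝ) (σ : ℕ → ℕ) : Prop :=
  ∀ u < m, ∀ a < k, ys u ≤ B u a + lam * A a (σ a) + lam * lam * ys (σ a)

theorem exists_greedy (h : MatrixGame k m A B lam M xs ys) :
    ∃ σ : ℕ → ℕ, (∀ a < k, σ a < m) ∧ (∀ a < k, xs a = A a (σ a) + lam * ys (σ a)) ∧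
      Greedy A m k σ (fun b => lam * ys b) := by
  choose! σ h1 h2 using h.max_eq
  exact ⟨σ, h1, h2, fun a ha b hb => (h.max_le a ha b hb).trans (h2 a ha).le⟩

/-- The prices `p` come from the computation and are unrelated to `ys`. Sharing in-degrees with the
greedy `σ'` is enough for `σ` to attain `xs a` at each source, and `min_le` does the rest. -/
theorem optimal_of_sum_eq (h : MatrixGame k m A B lam M xs ys) {σ σ' : ℕ → ℕ} {p : ℕ → ℝ}
    (hg : Greedy A m k σ p) (hσ : ∀ a < k, σ a < m) (hσ' : ∀ a < k, σ' a < m)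
    (hxs : ∀ a < k, xs a = A a (σ' a) + lam * ys (σ' a))
    (hg' : Greedy A m k σ' (fun b => lam * ys b))
    (hsum : ∀ f : ℕ → ℝ, ∑ a ∈ Finset.range k, f (σ a) = ∑ a ∈ Finset.range k, f (σ' a)) :
    Optimal k m A B lam ys σ := by
  intro u hu a ha
  have h1 := hg.eq_of_sum_eq hg' hσ hσ' hsum a ha
  have h2 := h.min_le u hu a ha
  rw [hxs a ha, ← h1] at h2
  linarith

/-- A reply of Min to the strategy `σ` which is at least as good as the value of the game. -/
theorem exists_reply (h : MatrixGame k m A B lam M xs ys) {σ : ℕ → ℕ} (hσ : ∀ a < k, σ a < m) :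
    ∃ τ : ℕ → ℕ, (∀ u < m, τ u < k) ∧ ∀ u < m,
      B u (τ u) + lam * A (τ u) (σ (τ u)) + lam * lam * ys (σ (τ u)) ≤ ys u := by
  choose! τ h1 h2 using h.min_eq
  refine ⟨τ, h1, fun u hu => ?_⟩
  have h3 := mul_le_mul_of_nonneg_left (h.max_le _ (h1 u hu) _ (hσ _ (h1 u hu))) h.pos.le
  have h4 := h2 u hu
  linarith

/-- If every cost of a walk followed by a repeated closed walk is at least `y u`, then so is the
value. -/
theorem le_value (h : MatrixGame k m A B lam M xs ys) {σ τ : ℕ → ℕ} (hσ : ∀ a < k, σ a < m)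
    (hτ : ∀ u < m, τ u < k)
    (hτσ : ∀ u < m, B u (τ u) + lam * A (τ u) (σ (τ u)) + lam * lam * ys (σ (τ u)) ≤ ys u)
    {u : ℕ} (hu : u < m) {z : ℝ}
    (hz : ∀ v < m, ∀ l < m, (fun x => σ (τ x))^[l] u = v → ∀ q < m,
      (fun x => σ (τ x))^[q + 1] v = v →
      z ≤ walkCost (lam * lam) (fun x => B x (τ x) + lam * A (τ x) (σ (τ x)))
          (fun x => σ (τ x)) l u +
        (lam * lam) ^ l * (walkCost (lam * lam) (fun x => B x (τ x) + lam * A (τ x) (σ (τ x)))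
          (fun x => σ (τ x)) (q + 1) v / (1 - (lam * lam) ^ (q + 1)))) : z ≤ ys u := by
  have hp := h.pos
  have hl := h.lt_one
  have hμ0 : 0 ≤ lam * lam := by positivity
  have hμ1 : lam * lam < 1 := by nlinarith
  have hnx : ∀ x < m, (fun x => σ (τ x)) x < m := fun x hx => hσ _ (hτ x hx)
  obtain ⟨l, hl, q, hq, hlq⟩ := exists_iterate_eq hnx hu
  have hv : (fun x => σ (τ x))^[l] u < m := by
    clear hl hlq
    induction l with
    | zero => exact hu
    | succ l ih => rw [Function.iterate_succ_apply']; exact hnx _ ih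
  refine (hz _ hv l hl rfl q hq hlq).trans ?_
  have h1 := walkCost_add_le hμ0 hnx hτσ l u hu
  -- Once round the cycle this reads `cost + μ ^ (q + 1) * ys v ≤ ys v`. Solving for `ys v` bounds
  -- the cost of repeating the cycle forever.
  have h2 := walkCost_add_le hμ0 hnx hτσ (q + 1) _ hv
  rw [hlq] at h2
  have h3 : (lam * lam) ^ (q + 1) < 1 := pow_lt_one₀ hμ0 hμ1 (by omega)
  refine le_trans ?_ h1
  gcongr
  rw [div_le_iff₀ (by linarith)]
  linarith

end MatrixGame

/-! ### Bit strings and in-degrees -/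

/-- The bits of `c`. -/
def bit (c i : ℕ) : ℕ := c / 2 ^ i % 2

/-- The number of ones among the lowest `i` bits. -/
def ones (β : ℕ → ℕ) (i : ℕ) : ℕ := Nat.count (fun i => β i = 1) i

/-- Every one in a bit string stands for a source that is assigned to the target whose number is
the number of zeros before. This is the sum of `f` over the targets assigned to the sources in the
first `i` bits. -/
noncomputable def tally (β : ℕ → ℕ) (f : ℕ → ℝ) (i : ℕ) : ℝ :=
  ∑ r ∈ Finset.range i, if β r = 1 then f (r - ones β r) else 0

/-- The bit string `β` describes the in-degrees of `σ`. -/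
structure Describes (k m : ℕ) (σ : ℕ → ℕ) (β : ℕ → ℕ) : Prop where
  ones : ones β (k + m) = k
  lt : ∀ i < k + m, β i = 1 → i - _root_.ones β i < m
  sum : ∀ f : ℕ → ℝ, tally β f (k + m) = ∑ a ∈ Finset.range k, f (σ a)

/-- Allows an abstract string to be replaced by the binary digits of a counter, which agree with it
only on the first `k + m` places. -/
theorem Describes.congr {k m : ℕ} {σ β β' : ℕ → ℕ} (h : Describes k m σ β)
    (hβ : ∀ i < k + m, β' i = β i) : Describes k m σ β' := by
  have h1 : ∀ i ≤ k + m, _root_.ones β' i = _root_.ones β i := by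
    intro i hi
    induction i with
    | zero => simp [_root_.ones]
    | succ i ih =>
      have := ih (by omega)
      simp only [_root_.ones] at this ⊢
      rw [Nat.count_succ, Nat.count_succ, this, hβ i (by omega)]
  refine ⟨(h1 _ le_rfl).trans h.ones, fun i hi hb => ?_, fun f => ?_⟩
  · rw [h1 i hi.le]
    exact h.lt i hi (hβ i hi ▸ hb)
  · rw [← h.sum f]
    refine Finset.sum_congr rfl fun i hi => ?_
    have hi := Finset.mem_range.1 hi
    rw [hβ i hi, h1 i hi.le]

theorem ones_mono (β : ℕ → ℕ) : Monotone (ones β) := Nat.count_monotone _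

/-- Stars and bars. Since `g b` counts the sources sent to targets below `b`, the block of target
`b` starts at position `g b + b` and its closing zero is at `g (b + 1) + b`. -/
theorem exists_describes {k m : ℕ} {σ : ℕ → ℕ} (hσ : ∀ a < k, σ a < m) :
    ∃ β : ℕ → ℕ, (∀ i, β i < 2) ∧ Describes k m σ β := by
  set g : ℕ → ℕ := fun b => ((Finset.range k).filter fun a => σ a < b).card with hg
  have hgm : Monotone g := fun b b' hbb => Finset.card_le_card fun a ha => by
    simp only [Finset.mem_filter] at ha ⊢
    exact ⟨ha.1, ha.2.trans_le hbb⟩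
  have hgm' : g m = k := by
    simp only [hg]
    rw [Finset.filter_true_of_mem fun a ha => hσ a (Finset.mem_range.1 ha), Finset.card_range]
  classical
  set β : ℕ → ℕ := fun i => if ∃ b < m, i = g (b + 1) + b then 0 else 1 with hβ
  have hsucc : ∀ i, ones β (i + 1) = ones β i + if β i = 1 then 1 else 0 := fun i =>
    Nat.count_succ _ _
  have htally : ∀ f i, tally β f (i + 1) = tally β f i +
      if β i = 1 then f (i - ones β i) else 0 := fun f i => Finset.sum_range_succ _ _
  have main : ∀ b ≤ m, ones β (g b + b) = g b ∧
      (∀ i < g b + b, β i = 1 → i - ones β i < m) ∧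
      ∀ f : ℕ → ℝ, tally β f (g b + b) =
        ∑ a ∈ (Finset.range k).filter fun a => σ a < b, f (σ a) := by
    intro b
    induction b with
    | zero => intro _; simp [hg, ones, tally]
    | succ b ih =>
      intro hb
      obtain ⟨h1, h2, h3⟩ := ih (by omega)
      have hle : g b ≤ g (b + 1) := hgm (Nat.le_succ b)
      -- By monotonicity of `g`, the zeros closing other blocks lie before or after this one.
      have hone : ∀ e, g b + e < g (b + 1) → β (g b + b + e) = 1 := by
        intro e he
        simp only [hβ]
        rw [if_neg]
        rintro ⟨b', -, hb'⟩
        rcases lt_or_ge b' b with hlt | hge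
        · have := hgm (show b' + 1 ≤ b by omega)
          omega
        · have := hgm (show b + 1 ≤ b' + 1 by omega)
          omega
      -- After `e` ones of block `b` there are `b` zeros before the current position, so each of
      -- these ones stands for a source sent to `b`.
      have inner : ∀ e, g b + e ≤ g (b + 1) → ones β (g b + b + e) = g b + e ∧
          (∀ i < g b + b + e, β i = 1 → i - ones β i < m) ∧
          ∀ f : ℕ → ℝ, tally β f (g b + b + e) =
            ∑ a ∈ (Finset.range k).filter fun a => σ a < b, f (σ a) + e * f b := by
        intro e
        induction e with
        | zero => intro _; simpa using ⟨h1, h2, h3⟩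
        | succ e ihe =>
          intro he
          obtain ⟨i1, i2, i3⟩ := ihe (by omega)
          have ho := hone e (by omega)
          refine ⟨?_, fun i hi hbi => ?_, fun f => ?_⟩
          · rw [← add_assoc, hsucc, i1, if_pos ho]; omega
          · rcases Nat.lt_succ_iff_lt_or_eq.1 (show i < (g b + b + e) + 1 by omega) with hi | rfl
            · exact i2 i hi hbi
            · rw [i1]; omega
          · rw [← add_assoc, htally, i3, if_pos ho, i1,
              show g b + b + e - (g b + e) = b by omega]
            push_cast
            ring
      obtain ⟨i1, i2, i3⟩ := inner (g (b + 1) - g b) (by omega)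
      rw [show g b + b + (g (b + 1) - g b) = g (b + 1) + b by omega] at i1 i2 i3
      have hz : β (g (b + 1) + b) ≠ 1 := by
        simp only [hβ]
        rw [if_pos ⟨b, by omega, rfl⟩]
        simp
      refine ⟨?_, fun i hi hbi => ?_, fun f => ?_⟩
      · rw [← add_assoc, hsucc, i1, if_neg hz]; omega
      · rcases Nat.lt_succ_iff_lt_or_eq.1 (show i < (g (b + 1) + b) + 1 by omega) with hi | rfl
        · exact i2 i hi hbi
        · exact absurd hbi hz
      · rw [← add_assoc, htally, i3, if_neg hz, add_zero]
        have hsplit : (Finset.range k).filter (fun a => σ a < b + 1) =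
            (Finset.range k).filter (fun a => σ a < b) ∪
              (Finset.range k).filter (fun a => σ a = b) := by
          rw [← Finset.filter_or]
          exact Finset.filter_congr fun a _ => Nat.lt_succ_iff_lt_or_eq
        have hdis : Disjoint ((Finset.range k).filter (fun a => σ a < b))
            ((Finset.range k).filter (fun a => σ a = b)) :=
          Finset.disjoint_filter.2 fun a _ hlt heq => by omega
        have hcard : g (b + 1) = g b + ((Finset.range k).filter (fun a => σ a = b)).card := by
          simp only [hg]
          rw [hsplit, Finset.card_union_of_disjoint hdis]
        rw [hsplit, Finset.sum_union hdis, hcard, Nat.add_sub_cancel_left]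
        congr 1
        rw [Finset.sum_congr rfl (g := fun _ => f b) fun a ha => by
          rw [(Finset.mem_filter.1 ha).2]]
        simp
  obtain ⟨h1, h2, h3⟩ := main m le_rfl
  rw [hgm'] at h1 h2 h3
  refine ⟨β, fun i => by simp only [hβ]; split_ifs <;> omega, h1, h2, fun f => ?_⟩
  rw [h3 f, Finset.filter_true_of_mem fun a ha => hσ a (Finset.mem_range.1 ha)]

theorem exists_bit_eq (n : ℕ) (β : ℕ → ℕ) (hβ : ∀ i, β i < 2) :
    ∃ c < 2 ^ n, ∀ i < n, bit c i = β i := by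
  induction n with
  | zero => exact ⟨0, by simp, by simp⟩
  | succ n ih =>
    obtain ⟨c, hc, h⟩ := ih
    have hb := hβ n
    refine ⟨c + 2 ^ n * β n, ?_, fun i hi => ?_⟩
    · rw [pow_succ]
      nlinarith
    · rcases Nat.lt_succ_iff_lt_or_eq.1 hi with hi | rfl
      · rw [← h i hi, bit, bit]
        obtain ⟨d, rfl⟩ : ∃ d, n = i + 1 + d := ⟨n - i - 1, by omega⟩
        rw [pow_add, pow_succ, mul_assoc, mul_assoc, Nat.add_mul_div_left _ _ (by positivity),
          Nat.add_mul_mod_self_left]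
      · rw [bit, Nat.add_mul_div_left _ _ (by positivity), Nat.div_eq_of_lt hc, zero_add,
          Nat.mod_eq_of_lt hb]

/-! ### Values of discounted games -/

theorem Finset.abs_sup'_sub_sup'_le {ι : Type*} {t : Finset ι} (ht : t.Nonempty) {f g : ι → ℝ}
    {c : ℝ} (h : ∀ i ∈ t, |f i - g i| ≤ c) : |t.sup' ht f - t.sup' ht g| ≤ c := by
  have key : ∀ f g : ι → ℝ, (∀ i ∈ t, |f i - g i| ≤ c) → t.sup' ht f - t.sup' ht g ≤ c := by
    intro f g h
    rw [sub_le_iff_le_add]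
    refine Finset.sup'_le _ _ fun i hi => ?_
    have h1 := (abs_le.1 (h i hi)).2
    have h2 := Finset.le_sup' g hi
    linarith
  exact abs_sub_le_iff.2 ⟨key f g h, key g f fun i hi => abs_sub_comm (f i) (g i) ▸ h i hi⟩

theorem Finset.abs_inf'_sub_inf'_le {ι : Type*} {t : Finset ι} (ht : t.Nonempty) {f g : ι → ℝ}
    {c : ℝ} (h : ∀ i ∈ t, |f i - g i| ≤ c) : |t.inf' ht f - t.inf' ht g| ≤ c := by
  have key : ∀ f g : ι → ℝ, (∀ i ∈ t, |f i - g i| ≤ c) → t.inf' ht f - t.inf' ht g ≤ c := by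
    intro f g h
    rw [sub_le_comm]
    refine Finset.le_inf' _ _ fun i hi => ?_
    have h1 := (abs_le.1 (h i hi)).2
    have h2 := Finset.inf'_le f hi
    linarith
  exact abs_sub_le_iff.2 ⟨key f g h, key g f fun i hi => abs_sub_comm (f i) (g i) ▸ h i hi⟩

namespace DiscountedGame

variable {n : ℕ}

/-- The right-hand sides of the optimality equations form a contraction of ratio `G.disc` in the sup
norm. Uniqueness plays no role: the output is shown to equal this fixed point. -/
theorem exists_isValueVector (G : DiscountedGame n) : ∃ x, G.IsValueVector x := by
  classical
  set out : Fin n → Finset (Fin n) := fun a => Finset.univ.filter fun b => (a, b) ∈ G.E with hout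
  have hne : ∀ a, (out a).Nonempty := fun a => by
    obtain ⟨b, hb⟩ := G.exists_edge a
    exact ⟨b, by simpa [hout] using hb⟩
  set Φ : (Fin n → ℝ) → Fin n → ℝ := fun x a =>
    if a ∈ G.VMax then (out a).sup' (hne a) fun b => G.w (a, b) + G.disc * x b
    else (out a).inf' (hne a) fun b => G.w (a, b) + G.disc * x b with hΦ
  have hcontr : ContractingWith ⟨G.disc, G.disc_pos.le⟩ Φ := by
    refine ⟨by exact_mod_cast G.disc_lt_one, LipschitzWith.of_dist_le_mul fun x y => ?_⟩
    change _ ≤ G.disc * dist x y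
    have hd : 0 ≤ G.disc * dist x y := mul_nonneg G.disc_pos.le dist_nonneg
    refine (dist_pi_le_iff hd).2 fun a => ?_
    have hb : ∀ b ∈ out a, |(G.w (a, b) + G.disc * x b) - (G.w (a, b) + G.disc * y b)| ≤
        G.disc * dist x y := fun b _ => by
      have h1 : |x b - y b| ≤ dist x y := by
        rw [← Real.dist_eq]; exact dist_le_pi_dist x y b
      rw [add_sub_add_left_eq_sub, ← mul_sub, abs_mul, abs_of_pos G.disc_pos]
      exact mul_le_mul_of_nonneg_left h1 G.disc_pos.le
    rw [Real.dist_eq]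
    simp only [hΦ]
    split_ifs
    · exact Finset.abs_sup'_sub_sup'_le _ hb
    · exact Finset.abs_inf'_sub_inf'_le _ hb
  set x := ContractingWith.fixedPoint Φ hcontr
  have hx : Φ x = x := hcontr.fixedPoint_isFixedPt
  refine ⟨x, fun a ha => ?_, fun a ha => ?_⟩
  · have hxa : x a = (out a).sup' (hne a) fun b => G.w (a, b) + G.disc * x b := by
      conv_lhs => rw [← hx]
      simp only [hΦ, if_pos ha]
    constructor
    · obtain ⟨b, hb, he⟩ := Finset.exists_mem_eq_sup' (hne a) fun b => G.w (a, b) + G.disc * x b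
      exact ⟨b, by simpa [hout] using hb, hxa.trans he⟩
    · rintro _ ⟨b, hb, rfl⟩
      rw [hxa]
      exact Finset.le_sup' (fun b => G.w (a, b) + G.disc * x b) (by simpa [hout] using hb)
  · have hxa : x a = (out a).inf' (hne a) fun b => G.w (a, b) + G.disc * x b := by
      conv_lhs => rw [← hx]
      simp only [hΦ, if_neg ha]
    constructor
    · obtain ⟨b, hb, he⟩ := Finset.exists_mem_eq_inf' (hne a) fun b => G.w (a, b) + G.disc * x b
      exact ⟨b, by simpa [hout] using hb, hxa.trans he⟩
    · rintro _ ⟨b, hb, rfl⟩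
      rw [hxa]
      exact Finset.inf'_le (fun b => G.w (a, b) + G.disc * x b) (by simpa [hout] using hb)

theorem IsValueVector.exists_eq {G : DiscountedGame n} {x : Fin n → ℝ} (hx : G.IsValueVector x)
    (a : Fin n) : ∃ b, (a, b) ∈ G.E ∧ x a = G.w (a, b) + G.disc * x b := by
  by_cases ha : a ∈ G.VMax
  · exact (hx.1 a ha).1
  · exact (hx.2 a ha).1

/-- At a node `c` where `|x c|` is largest, one step gives `|x c| ≤ R + G.disc * |x c|`. -/
theorem IsValueVector.abs_le {G : DiscountedGame n} {x : Fin n → ℝ} (hx : G.IsValueVector x)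
    {R : ℝ} (hR : ∀ e ∈ G.E, |G.w e| ≤ R) (a : Fin n) : |x a| ≤ R / (1 - G.disc) := by
  obtain ⟨c, -, hc⟩ := Finset.exists_max_image Finset.univ (fun b => |x b|) ⟨a, Finset.mem_univ a⟩
  refine (hc a (Finset.mem_univ a)).trans ?_
  obtain ⟨b, hb, he⟩ := hx.exists_eq c
  have h1 := hR _ hb
  have h2 := hc b (Finset.mem_univ b)
  have h3 : |x c| ≤ |G.w (c, b)| + G.disc * |x b| := by
    conv_lhs => rw [he]
    refine (abs_add_le _ _).trans ?_
    rw [abs_mul, abs_of_pos G.disc_pos]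
  have h4 := mul_le_mul_of_nonneg_left h2 G.disc_pos.le
  have h5 := G.disc_lt_one
  rw [le_div_iff₀ (by linarith)]
  linarith

/-! ### The game in memory and its completion by missing edges. -/

theorem input_adj (G : DiscountedGame n) (a b : Fin n) :
    G.input.nat 2 (a * n + b) = if (a, b) ∈ G.E then 1 else 0 := by
  have h := (finProdFinEquiv (a, b)).2
  have hv : (finProdFinEquiv (a, b) : ℕ) = a * n + b := by
    rw [finProdFinEquiv_apply_val]; ring
  rw [hv] at h
  have he : (⟨a * n + b, h⟩ : Fin (n * n)) = finProdFinEquiv (a, b) := Fin.ext hv.symm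
  simp only [input]
  norm_num [-finProdFinEquiv_symm_apply]
  rw [dif_pos h, he, Equiv.symm_apply_apply]

theorem input_weight (G : DiscountedGame n) (a b : Fin n) :
    G.input.real 1 (a * n + b) = if (a, b) ∈ G.E then G.w (a, b) else 0 := by
  have h := (finProdFinEquiv (a, b)).2
  have hv : (finProdFinEquiv (a, b) : ℕ) = a * n + b := by
    rw [finProdFinEquiv_apply_val]; ring
  rw [hv] at h
  have he : (⟨a * n + b, h⟩ : Fin (n * n)) = finProdFinEquiv (a, b) := Fin.ext hv.symm
  simp only [input]
  norm_num [-finProdFinEquiv_symm_apply]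
  rw [dif_pos h, he, Equiv.symm_apply_apply]

/-- The lists `mx` of length `k` and `mn` of length `m` enumerate the nodes of the players. -/
structure Listing (G : DiscountedGame n) (k m : ℕ) (mx mn : ℕ → ℕ) : Prop where
  add_eq : k + m = n
  mem_max : ∀ i < k, ∃ a : Fin n, a ∈ G.VMax ∧ mx i = a
  mem_min : ∀ j < m, ∃ a : Fin n, a ∉ G.VMax ∧ mn j = a
  exists_max : ∀ a ∈ G.VMax, ∃ i < k, mx i = a
  exists_min : ∀ a ∉ G.VMax, ∃ j < m, mn j = a

/-- The weight of the edge from `u` to `v`, or `d` if there is no such edge. -/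
noncomputable def weightOr (G : DiscountedGame n) (d : ℝ) (u v : ℕ) : ℝ :=
  if 1 ≤ G.input.nat 2 (u * n + v) then G.input.real 1 (u * n + v) else d

theorem weightOr_eq (G : DiscountedGame n) (d : ℝ) (a b : Fin n) :
    G.weightOr d a b = if (a, b) ∈ G.E then G.w (a, b) else d := by
  rw [weightOr, input_adj, input_weight]
  split_ifs <;> simp_all

/-- Reduction to games with all edges between nodes of different players. -/
theorem IsValueVector.matrixGame {G : DiscountedGame n} (hG : G.Bipartite) {x : Fin n → ℝ}
    (hx : G.IsValueVector x) {k m : ℕ} {mx mn : ℕ → ℕ} (hl : G.Listing k m mx mn) {X : ℕ → ℝ}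
    (hX : ∀ a : Fin n, X a = x a)
    {R M : ℝ} (hR0 : 0 ≤ R) (hR : ∀ e ∈ G.E, |G.w e| ≤ R) (hM : M = 2 * R / (1 - G.disc)) :
    MatrixGame k m (fun i j => G.weightOr (-M) (mx i) (mn j))
      (fun j i => G.weightOr M (mn j) (mx i)) G.disc M (fun i => X (mx i)) (fun j => X (mn j)) := by
  have hd0 := G.disc_pos
  have hd1 := G.disc_lt_one
  have hM' : M = 2 * (R / (1 - G.disc)) := by rw [hM]; ring
  have hb := hx.abs_le hR
  have hq : 0 ≤ R / (1 - G.disc) := div_nonneg hR0 (by linarith)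
  set q := R / (1 - G.disc)
  -- A missing edge offers Max at most `-M + q = -q`, which no value undercuts; dually it costs Min
  -- at least `q`. This is why `M` is twice the bound for the values.
  have hdx : ∀ a, |G.disc * x a| ≤ q := fun a => by
    rw [abs_mul, abs_of_pos hd0]
    nlinarith [hb a, abs_nonneg (x a)]
  refine ⟨hd0, hd1, fun i hi j hj => ?_, fun i hi => ?_, fun j hj i hi => ?_, fun j hj => ?_,
    fun i hi => ?_, fun j hj => ?_⟩
  · obtain ⟨a, ha, hia⟩ := hl.mem_max i hi
    obtain ⟨b, -, hjb⟩ := hl.mem_min j hj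
    simp only [hia, hjb, weightOr_eq, hX]
    split_ifs with hE
    · exact (hx.1 a ha).2 ⟨b, hE, rfl⟩
    · have h1 := _root_.abs_le.1 (hb a)
      have h2 := _root_.abs_le.1 (hdx b)
      linarith
  · obtain ⟨a, ha, hia⟩ := hl.mem_max i hi
    obtain ⟨b, hE, he⟩ := hx.exists_eq a
    -- Bipartiteness puts the end of an optimal edge among the nodes of the other player, that is,
    -- inside the matrix.
    obtain ⟨j, hj, hjb⟩ := hl.exists_min b (by
      rcases hG a b hE with h | h
      · exact h.2
      · exact absurd ha h.1)
    refine ⟨j, hj, ?_⟩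
    simp only [hia, hjb, weightOr_eq, hX, if_pos hE]
    exact he
  · obtain ⟨b, -, hib⟩ := hl.mem_max i hi
    obtain ⟨a, ha, hja⟩ := hl.mem_min j hj
    simp only [hja, hib, weightOr_eq, hX]
    split_ifs with hE
    · exact (hx.2 a ha).2 ⟨b, hE, rfl⟩
    · have h1 := _root_.abs_le.1 (hb a)
      have h2 := _root_.abs_le.1 (hdx b)
      linarith
  · obtain ⟨a, ha, hja⟩ := hl.mem_min j hj
    obtain ⟨b, hE, he⟩ := hx.exists_eq a
    obtain ⟨i, hi, hib⟩ := hl.exists_max b (by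
      rcases hG a b hE with h | h
      · exact absurd h.1 ha
      · exact h.2)
    refine ⟨i, hi, ?_⟩
    simp only [hja, hib, weightOr_eq, hX, if_pos hE]
    exact he
  · obtain ⟨a, -, hia⟩ := hl.mem_max i hi
    simp only [hia, hX]
    linarith [hb a]
  · obtain ⟨a, -, hja⟩ := hl.mem_min j hj
    simp only [hja, hX]
    linarith [hb a]

end DiscountedGame

/-! ### Reasoning about programs -/

namespace RealRAM

/-- The arrays of natural numbers to which a program may write. -/
def Prog.nmods : Prog → List ℕ
  | .nop => []
  | .setNat arr _ _ => [arr]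
  | .setReal _ _ _ => []
  | .seq p q => p.nmods ++ q.nmods
  | .branch _ p q => p.nmods ++ q.nmods
  | .loop _ p => p.nmods

/-- The arrays of real numbers to which a program may write. -/
def Prog.rmods : Prog → List ℕ
  | .nop => []
  | .setNat _ _ _ => []
  | .setReal arr _ _ => [arr]
  | .seq p q => p.rmods ++ q.rmods
  | .branch _ p q => p.rmods ++ q.rmods
  | .loop _ p => p.rmods

/-- A bound for the running time when every execution of a loop makes at most `N` rounds. -/
def Prog.time (N : ℕ) : Prog → ℕ
  | .nop => 1
  | .setNat _ i e => i.cost + e.cost + 1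
  | .setReal _ i e => i.cost + e.cost + 1
  | .seq p q => p.time N + q.time N
  | .branch b p q => b.cost + (p.time N + q.time N)
  | .loop b p => N * (b.cost + p.time N) + b.cost

/-- The states `s` and `s'` agree on all arrays to which `p` does not write. -/
structure Same (p : Prog) (s s' : Mem) : Prop where
  nat : ∀ arr, arr ∉ p.nmods → s'.nat arr = s.nat arr
  real : ∀ arr, arr ∉ p.rmods → s'.real arr = s.real arr

/-- The program is fixed, so its nesting depth is a constant. Each loop raises the degree by one;
composition adds degrees, which is wasteful but avoids maxima. -/
theorem Prog.time_poly (p : Prog) : ∃ C k : ℕ, ∀ N, p.time N ≤ C * (N + 1) ^ k := by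
  have key : ∀ (a b c C k D l N : ℕ), a ≤ C * (N + 1) ^ k → b ≤ D * (N + 1) ^ l →
      c + (a + b) ≤ (c + C + D) * (N + 1) ^ (k + l) := by
    intro a b c C k D l N ha hb
    have h1 : (N + 1) ^ k ≤ (N + 1) ^ (k + l) := Nat.pow_le_pow_right (by omega) (by omega)
    have h2 : (N + 1) ^ l ≤ (N + 1) ^ (k + l) := Nat.pow_le_pow_right (by omega) (by omega)
    have h3 : 1 ≤ (N + 1) ^ (k + l) := Nat.one_le_pow _ _ (by omega)
    nlinarith [Nat.mul_le_mul_left C h1, Nat.mul_le_mul_left D h2, Nat.mul_le_mul_left c h3]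
  induction p with
  | nop => exact ⟨1, 0, fun N => by simp [Prog.time]⟩
  | setNat arr i e => exact ⟨i.cost + e.cost + 1, 0, fun N => by simp [Prog.time]⟩
  | setReal arr i e => exact ⟨i.cost + e.cost + 1, 0, fun N => by simp [Prog.time]⟩
  | seq p q hp hq =>
    obtain ⟨C, k, h⟩ := hp
    obtain ⟨D, l, h'⟩ := hq
    exact ⟨0 + C + D, k + l, fun N => by
      simpa [Prog.time] using key _ _ 0 _ _ _ _ _ (h N) (h' N)⟩
  | branch b p q hp hq =>
    obtain ⟨C, k, h⟩ := hp
    obtain ⟨D, l, h'⟩ := hq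
    exact ⟨b.cost + C + D, k + l, fun N => key _ _ _ _ _ _ _ _ (h N) (h' N)⟩
  | loop b p hp =>
    obtain ⟨C, k, h⟩ := hp
    refine ⟨2 * b.cost + C, k + 1, fun N => ?_⟩
    have h1 : 1 ≤ (N + 1) ^ k := Nat.one_le_pow _ _ (by omega)
    have h2 := h N
    simp only [Prog.time, pow_succ]
    have h3 : N * (b.cost + p.time N) ≤ N * (b.cost + C * (N + 1) ^ k) := by gcongr
    have h4 : b.cost ≤ b.cost * (N + 1) ^ k := by nlinarith
    nlinarith [Nat.mul_le_mul_left N h4, Nat.zero_le (C * (N + 1) ^ k),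
      Nat.zero_le (N * (b.cost * (N + 1) ^ k))]

theorem Exec.final {P : Mem → Prop} {p : Prog} {s s' : Mem} {t : ℕ} (h : Exec P p s t s') : P s' := by
  induction h <;> assumption

theorem Exec.mono {P P' : Mem → Prop} (hP : ∀ s, P s → P' s) {p : Prog} {s s' : Mem} {t : ℕ}
    (h : Exec P p s t s') : Exec P' p s t s' := by
  induction h with
  | nop h => exact .nop (hP _ h)
  | setNat h h' => exact .setNat (hP _ h) (hP _ h')
  | setReal h h' => exact .setReal (hP _ h) (hP _ h')
  | seq _ _ h h' => exact .seq h h'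
  | branch_true hb _ h => exact .branch_true hb h
  | branch_false hb _ h => exact .branch_false hb h
  | loop_true hb _ _ h h' => exact .loop_true hb h h'
  | loop_false hb h => exact .loop_false hb (hP _ h)

theorem Same.refl (p : Prog) (s : Mem) : Same p s s := ⟨fun _ _ => rfl, fun _ _ => rfl⟩

theorem Same.trans {p q r : Prog} {s s' s'' : Mem} (h : Same p s s') (h' : Same q s' s'')
    (hp : p.nmods ⊆ r.nmods) (hp' : p.rmods ⊆ r.rmods)
    (hq : q.nmods ⊆ r.nmods) (hq' : q.rmods ⊆ r.rmods) : Same r s s'' :=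
  ⟨fun a ha => (h'.nat a fun k => ha (hq k)).trans (h.nat a fun k => ha (hp k)),
    fun a ha => (h'.real a fun k => ha (hq' k)).trans (h.real a fun k => ha (hp' k))⟩

/-- The frame rule. The lists of written arrays are computed from the program text, so that its side
conditions can be settled by `decide`. -/
theorem Exec.same {P : Mem → Prop} {p : Prog} {s s' : Mem} {t : ℕ} (h : Exec P p s t s') :
    Same p s s' := by
  induction h with
  | nop _ => exact .refl _ _
  | @setNat s arr i e _ _ =>
    refine ⟨fun a ha => ?_, fun a _ => rfl⟩
    simp only [Prog.nmods, List.mem_singleton] at ha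
    simp [Mem.setNat, ha]
  | @setReal s arr i e _ _ =>
    refine ⟨fun a _ => rfl, fun a ha => ?_⟩
    simp only [Prog.rmods, List.mem_singleton] at ha
    simp [Mem.setReal, ha]
  | seq _ _ h h' =>
    exact h.trans h' (List.subset_append_left _ _) (List.subset_append_left _ _)
      (List.subset_append_right _ _) (List.subset_append_right _ _)
  | branch_true _ _ h =>
    exact (Same.refl .nop _).trans h (by simp [Prog.nmods]) (by simp [Prog.rmods])
      (List.subset_append_left _ _) (List.subset_append_left _ _)
  | branch_false _ _ h =>
    exact (Same.refl .nop _).trans h (by simp [Prog.nmods]) (by simp [Prog.rmods])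
      (List.subset_append_right _ _) (List.subset_append_right _ _)
  | loop_true _ _ _ h h' => exact h.trans h' (fun _ => id) (fun _ => id) (fun _ => id) (fun _ => id)
  | loop_false _ _ => exact .refl _ _

/-- The resources available to a program: memory of size `space`, at most `rounds` rounds in every
execution of a loop, and real numbers of size `bits` with respect to a measure of size. -/
structure Res where
  space : ℕ
  rounds : ℕ
  bits : ℕ
  sz : ℕ → ℝ → Prop
  space_pos : 0 < space
  rounds_le : rounds ≤ space
  sz_mono : ∀ {a b : ℕ} {x : ℝ}, sz a x → a ≤ b → sz b x
  sz_lit : ∀ c : ℕ, c ≤ 2 → sz 1 c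
  sz_add : ∀ {a b : ℕ} {x y : ℝ}, sz a x → sz b y → sz (a + b + 1) (x + y)
  sz_sub : ∀ {a b : ℕ} {x y : ℝ}, sz a x → sz b y → sz (a + b + 1) (x - y)
  sz_mul : ∀ {a b : ℕ} {x y : ℝ}, sz a x → sz b y → sz (a + b) (x * y)
  sz_div : ∀ {a b : ℕ} {x y : ℝ}, sz a x → sz b y → sz (a + b) (x / y)

/-- The memory respects the resources. -/
def Res.Ok (ρ : Res) (s : Mem) : Prop := s.FitsIn ρ.space ∧ ∀ arr i, ρ.sz ρ.bits (s.real arr i)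

/-- The program halts in a state with property `Q`, within the resources. -/
def Runs (ρ : Res) (p : Prog) (s : Mem) (Q : Mem → Prop) : Prop :=
  ∃ t s', Exec ρ.Ok p s t s' ∧ t ≤ p.time ρ.rounds ∧ Q s'

variable {ρ : Res} {p q : Prog} {s : Mem} {Q R : Mem → Prop}

/-! ### Rules of the program logic. -/

theorem Res.Ok.setNat (h : ρ.Ok s) {arr i v : ℕ} (hi : i < ρ.space) (hv : v ≤ ρ.space) :
    ρ.Ok (s.setNat arr i v) := by
  refine ⟨⟨fun a j => ?_, fun a j hj => ⟨?_, (h.1.2 a j hj).2⟩⟩, h.2⟩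
  · have := h.1.1 a j
    simp only [Mem.setNat, Function.update_apply]
    split_ifs with h1
    · subst h1
      simp only [Function.update_apply]
      split_ifs <;> assumption
    · assumption
  · have := (h.1.2 a j hj).1
    simp only [Mem.setNat, Function.update_apply]
    split_ifs with h1
    · subst h1
      simp only [Function.update_apply]
      rw [if_neg (by omega)]
      assumption
    · assumption

theorem Res.Ok.setReal (h : ρ.Ok s) {arr i : ℕ} {v : ℝ} (hi : i < ρ.space) (hv : ρ.sz ρ.bits v) :
    ρ.Ok (s.setReal arr i v) := by
  refine ⟨⟨h.1.1, fun a j hj => ⟨(h.1.2 a j hj).1, ?_⟩⟩, fun a j => ?_⟩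
  · have := (h.1.2 a j hj).2
    simp only [Mem.setReal, Function.update_apply]
    split_ifs with h1
    · subst h1
      simp only [Function.update_apply]
      rw [if_neg (by omega)]
      assumption
    · assumption
  · have := h.2 a j
    simp only [Mem.setReal, Function.update_apply]
    split_ifs with h1
    · subst h1
      simp only [Function.update_apply]
      split_ifs <;> assumption
    · assumption

/-- Respect for the resources and the frame come for free with every run, so postconditions need
only speak about arrays that are written. -/
theorem Runs.imp (h : Runs ρ p s Q) (hQ : ∀ s', ρ.Ok s' → Same p s s' → Q s' → R s') :
    Runs ρ p s R := by
  obtain ⟨t, s', he, ht, hq⟩ := h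
  exact ⟨t, s', he, ht, hQ s' he.final he.same hq⟩

theorem Runs.nop (h : ρ.Ok s) (hQ : Q s) : Runs ρ .nop s Q := ⟨1, s, .nop h, le_rfl, hQ⟩

theorem Runs.setNat {arr : ℕ} {i e : NExp} (h : ρ.Ok s) (hi : i.eval s < ρ.space)
    (hv : e.eval s ≤ ρ.space) (hQ : Q (s.setNat arr (i.eval s) (e.eval s))) :
    Runs ρ (.setNat arr i e) s Q :=
  ⟨_, _, .setNat h (h.setNat hi hv), le_rfl, hQ⟩

theorem Runs.setReal {arr : ℕ} {i : NExp} {e : RExp} (h : ρ.Ok s) (hi : i.eval s < ρ.space)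
    (hv : ρ.sz ρ.bits (e.eval s)) (hQ : Q (s.setReal arr (i.eval s) (e.eval s))) :
    Runs ρ (.setReal arr i e) s Q :=
  ⟨_, _, .setReal h (h.setReal hi hv), le_rfl, hQ⟩

theorem Runs.seq (h : Runs ρ p s fun s' => ρ.Ok s' → Same p s s' → Runs ρ q s' Q) :
    Runs ρ (.seq p q) s Q := by
  obtain ⟨t, s', he, ht, hq⟩ := h
  obtain ⟨t', s'', he', ht', hq'⟩ := hq he.final he.same
  exact ⟨_, s'', .seq he he', Nat.add_le_add ht ht', hq'⟩

theorem Runs.branch {b : Test} (h : b.holds s → Runs ρ p s Q) (h' : ¬ b.holds s → Runs ρ q s Q) :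
    Runs ρ (.branch b p q) s Q := by
  by_cases hb : b.holds s
  · obtain ⟨t, s', he, ht, hq⟩ := h hb
    exact ⟨_, s', .branch_true hb he, by simp only [Prog.time]; omega, hq⟩
  · obtain ⟨t, s', he, ht, hq⟩ := h' hb
    exact ⟨_, s', .branch_false hb he, by simp only [Prog.time]; omega, hq⟩

/-- The number `E` of rounds is not limited by `ρ.rounds`. This matters for the outer loop, whose `2
^ n` rounds do not fit the time bound in `Runs`. -/
theorem exists_exec_loop {b : Test} (I : ℕ → Mem → Prop) (E : ℕ)
    (hb : ∀ i s, I i s → (b.holds s ↔ i < E))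
    (hstep : ∀ i < E, ∀ s, ρ.Ok s → I i s → Runs ρ p s (I (i + 1))) (h : ρ.Ok s) (hI : I 0 s) :
    ∃ t s', Exec ρ.Ok (.loop b p) s t s' ∧ t ≤ E * (b.cost + p.time ρ.rounds) + b.cost ∧
      I E s' := by
  have main : ∀ d i : ℕ, i + d = E → ∀ s, ρ.Ok s → I i s →
      ∃ t s', Exec ρ.Ok (.loop b p) s t s' ∧ t ≤ d * (b.cost + p.time ρ.rounds) + b.cost ∧
        I E s' := by
    intro d
    induction d with
    | zero =>
      intro i hi s h hI
      obtain rfl : i = E := by omega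
      exact ⟨_, s, .loop_false (fun hh => lt_irrefl _ ((hb _ s hI).1 hh)) h, by simp, hI⟩
    | succ d ih =>
      intro i hi s h hI
      obtain ⟨t, s', he, ht, hq⟩ := hstep i (by omega) s h hI
      obtain ⟨t', s'', he', ht', hq'⟩ := ih (i + 1) (by omega) s' he.final hq
      refine ⟨_, s'', .loop_true ((hb _ s hI).2 (by omega)) he he', ?_, hq'⟩
      rw [Nat.succ_mul]
      omega
  exact main E 0 (by omega) s h hI

/-- Scalar variables. -/
abbrev nv (x : ℕ) : NExp := .cell x (.lit 0)

/-- Scalar variables. -/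
abbrev rv (x : ℕ) : RExp := .cell x (.lit 0)

/-- `for x = 0, …, e - 1 do p` -/
def forLoop (x : ℕ) (e : NExp) (p : Prog) : Prog :=
  .seq (.setNat x (.lit 0) (.lit 0))
    (.loop (.not (.natLe e (nv x))) (.seq p (.setNat x (.lit 0) (.add (nv x) (.lit 1)))))

@[simp] theorem Mem.setNat_nat (s : Mem) (arr i v : ℕ) :
    (s.setNat arr i v).nat = Function.update s.nat arr (Function.update (s.nat arr) i v) := rfl

@[simp] theorem Mem.setNat_real (s : Mem) (arr i v : ℕ) : (s.setNat arr i v).real = s.real := rfl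

@[simp] theorem Mem.setReal_nat (s : Mem) (arr i : ℕ) (v : ℝ) : (s.setReal arr i v).nat = s.nat := rfl

@[simp] theorem Mem.setReal_real (s : Mem) (arr i : ℕ) (v : ℝ) :
    (s.setReal arr i v).real = Function.update s.real arr (Function.update (s.real arr) i v) := rfl

/-- The rule for `for` loops: the invariant only speaks about arrays written by the body. -/
theorem Runs.forLoop {x : ℕ} {e : NExp} (E : ℕ) (I : ℕ → Mem → Prop) (h : ρ.Ok s)
    (hx : x ∉ p.nmods) (hE : E ≤ ρ.rounds)
    (he : ∀ s', Same (forLoop x e p) s s' → e.eval s' = E)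
    (hI : ∀ i s v, I i s → I i (s.setNat x 0 v)) (h0 : I 0 s)
    (hstep : ∀ i < E, ∀ s', ρ.Ok s' → Same (RealRAM.forLoop x e p) s s' → s'.nat x 0 = i →
      I i s' → Runs ρ p s' (I (i + 1)))
    (hQ : ∀ s', ρ.Ok s' → Same (RealRAM.forLoop x e p) s s' → I E s' → Q s') :
    Runs ρ (RealRAM.forLoop x e p) s Q := by
  have hs := ρ.space_pos
  have hr := ρ.rounds_le
  have hxm : x ∈ (RealRAM.forLoop x e p).nmods := by simp [RealRAM.forLoop, Prog.nmods]
  have hset : ∀ s' v, Same (RealRAM.forLoop x e p) s s' →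
      Same (RealRAM.forLoop x e p) s (s'.setNat x 0 v) := fun s' v hss =>
    ⟨fun a ha => by
      have : a ≠ x := fun hax => ha (hax ▸ hxm)
      simpa [this] using hss.nat a ha, hss.real⟩
  suffices hh : Runs ρ (RealRAM.forLoop x e p) s (I E) from hh.imp hQ
  unfold RealRAM.forLoop
  refine Runs.seq (Runs.setNat h hs (Nat.zero_le _) fun h' _ => ?_)
  obtain ⟨t, s', hex, ht, hq⟩ := exists_exec_loop (b := .not (.natLe e (nv x)))
    (p := .seq p (.setNat x (.lit 0) (.add (nv x) (.lit 1))))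
    -- The value of the counter and the frame relative to the state before the loop are added to the
    -- invariant here, once for all loops.
    (fun i s' => I i s' ∧ s'.nat x 0 = i ∧ Same (RealRAM.forLoop x e p) s s') E
    (fun i s' hi => by
      simp only [Test.holds, he s' hi.2.2, NExp.eval, hi.2.1]
      omega)
    (fun i hi s' hok hI' => Runs.seq ((hstep i hi s' hok hI'.2.2 hI'.2.1 hI'.1).imp
      fun s'' hok' hsame hI'' _ _ => by
        have hxv : s''.nat x 0 = i := by rw [hsame.nat x hx, hI'.2.1]
        refine Runs.setNat hok' hs ?_ ⟨hI _ _ _ hI'', ?_, hset _ _ ?_⟩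
        · simp only [NExp.eval, hxv]; omega
        · simp [NExp.eval, hxv]
        · refine hI'.2.2.trans hsame (fun _ => id) (fun _ => id) ?_ ?_
          · simp [RealRAM.forLoop, Prog.nmods]
          · simp [RealRAM.forLoop, Prog.rmods]))
    h' ⟨hI _ _ _ h0, by simp [NExp.eval], hset _ _ (.refl _ _)⟩
  refine ⟨t, s', hex, ht.trans ?_, hq.1⟩
  simp only [Prog.time]
  gcongr

end RealRAM

/-! ### The program

Arrays of natural numbers: `0` number of nodes, `1` Max's nodes, `2` adjacency matrix, `3` number of
Max's nodes, `4` number of Min's nodes, `5` list of Max's nodes, `6` list of Min's nodes, `7` bit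
string, `8` strategy of Max, `9` last exchanges of optimal walks, `10` carry, `11` next source,
`12` current target, `13` end of the walk being traced, `14`, `15` auxiliary, `20`–`23` counters.

Arrays of real numbers: `0` discount factor, `1` weights, `2` output, `3` weights of Max, `4` weights
of Min, `5` weight for missing edges, `6` weights of alternating walks, `7` best values of Min's
nodes so far, `8` values of Min's nodes against the current strategy, `9` costs of walks,
`10` powers of the squared discount factor, `11` cost of repeating the best closed walk, `12` sum of
absolute values of the weights. -/

namespace RealRAM

/-- The entry in row `i` and column `j` of a matrix. -/
def ix (i j : NExp) : NExp := .add (.mul i (nv 0)) j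

@[simp] theorem ix_eval (s : Mem) (i j : NExp) :
    (ix i j).eval s = i.eval s * s.nat 0 0 + j.eval s := rfl

/-- The weight of the alternating walk to the target `21` that ends with an exchange of the
source `23`. -/
def exchangeExp : RExp :=
  .sub (.add (.cell 6 (ix (nv 22) (.cell 8 (nv 23)))) (.cell 3 (ix (nv 23) (nv 21))))
    (.cell 3 (ix (nv 23) (.cell 8 (nv 23))))

def nextEntry : NExp := ix (.add (nv 22) (.lit 1)) (nv 21)

@[simp] theorem nextEntry_eval (s : Mem) :
    nextEntry.eval s = (s.nat 22 0 + 1) * s.nat 0 0 + s.nat 21 0 := rfl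

def exchange : Prog :=
  .branch (.realLe exchangeExp (.cell 6 nextEntry)) .nop
    (.seq (.setReal 6 nextEntry exchangeExp) (.setNat 9 nextEntry (nv 23)))

def exchanges : Prog :=
  .seq (.setReal 6 nextEntry (.cell 6 (ix (nv 22) (nv 21))))
    (.seq (.setNat 9 nextEntry (nv 11)) (forLoop 23 (nv 11) exchange))

/-- Fills the table of weights of alternating walks from the source `11`. -/
def walkTable : Prog :=
  .seq (forLoop 21 (nv 4) (.setReal 6 (ix (.lit 0) (nv 21)) (.cell 3 (ix (nv 11) (nv 21)))))
    (forLoop 22 (nv 4) (forLoop 21 (nv 4) exchanges))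

def traceStep : Prog :=
  .seq (.setNat 14 (.lit 0) (.cell 9 (ix (.sub (nv 4) (nv 22)) (nv 13))))
    (.branch (.natLe (.add (nv 14) (.lit 1)) (nv 11))
      (.seq (.setNat 15 (.lit 0) (.cell 8 (nv 14)))
        (.seq (.setNat 8 (nv 14) (nv 13)) (.setNat 13 (.lit 0) (nv 15))))
      .nop)

/-- Exchanges along an optimal alternating walk to the target `12`. -/
def trace : Prog :=
  .seq (.setNat 13 (.lit 0) (nv 12))
    (.seq (forLoop 22 (nv 4) traceStep) (.setNat 8 (nv 11) (nv 13)))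

def augment : Prog := .seq walkTable trace

def readBit : Prog :=
  .branch (.natLe (.lit 1) (.cell 7 (nv 20)))
    (.branch (.and (.natLe (.add (nv 11) (.lit 1)) (nv 3)) (.natLe (.add (nv 12) (.lit 1)) (nv 4)))
      (.seq augment (.setNat 11 (.lit 0) (.add (nv 11) (.lit 1)))) .nop)
    (.setNat 12 (.lit 0) (.add (nv 12) (.lit 1)))

/-- Computes a strategy of Max of maximal weight with the in-degrees given by the bit string. -/
def findStrategy : Prog :=
  .seq (.setNat 11 (.lit 0) (.lit 0))
    (.seq (.setNat 12 (.lit 0) (.lit 0)) (forLoop 20 (nv 0) readBit))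

/-- The cost of a walk from `21` that starts with the reply `23`. -/
def stepExp : RExp :=
  .add (.add (.cell 4 (ix (nv 21) (nv 23)))
      (.mul (rv 0) (.cell 3 (ix (nv 23) (.cell 8 (nv 23))))))
    (.mul (.mul (rv 0) (rv 0)) (.cell 9 (ix (nv 22) (.cell 8 (nv 23)))))

def reply : Prog :=
  .branch (.realLe (.cell 9 nextEntry) stepExp) .nop (.setReal 9 nextEntry stepExp)

def replies : Prog :=
  .seq (.setReal 9 nextEntry (.add (rv 5) (rv 5))) (forLoop 23 (nv 3) reply)

def powers : Prog :=
  .setReal 10 (.add (nv 22) (.lit 1)) (.mul (.mul (rv 0) (rv 0)) (.cell 10 (nv 22)))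

/-- Computes the costs of walks to `20`. -/
def walks : Prog :=
  .seq (forLoop 21 (nv 4) (.setReal 9 (ix (.lit 0) (nv 21)) (.add (rv 5) (rv 5))))
    (.seq (.setReal 9 (ix (.lit 0) (nv 20)) (.lit 0))
      (.seq (.setReal 10 (.lit 0) (.lit 1))
        (forLoop 22 (nv 4) (.seq powers (forLoop 21 (nv 4) replies)))))

def cycleExp : RExp :=
  .div (.cell 9 (ix (.add (nv 22) (.lit 1)) (nv 20)))
    (.sub (.lit 1) (.cell 10 (.add (nv 22) (.lit 1))))

/-- Computes the cost of repeating the best closed walk through `20`. -/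
def cycles : Prog :=
  .seq (.setReal 11 (.lit 0) (rv 5))
    (forLoop 22 (nv 4) (.branch (.realLe (rv 11) cycleExp) .nop (.setReal 11 (.lit 0) cycleExp)))

def lassoExp : RExp :=
  .add (.cell 9 (ix (nv 22) (nv 21))) (.mul (.cell 10 (nv 22)) (rv 11))

def lasso : Prog :=
  .branch (.realLe (.cell 8 (nv 21)) lassoExp) .nop (.setReal 8 (nv 21) lassoExp)

/-- Computes the values of Min's nodes against the current strategy of Max. -/
def evaluate : Prog :=
  .seq (forLoop 21 (nv 4) (.setReal 8 (nv 21) (rv 5)))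
    (forLoop 20 (nv 4) (.seq walks (.seq cycles (forLoop 22 (nv 4) (forLoop 21 (nv 4) lasso)))))

def keepBest : Prog :=
  forLoop 21 (nv 4) (.branch (.realLe (.cell 8 (nv 21)) (.cell 7 (nv 21))) .nop
    (.setReal 7 (nv 21) (.cell 8 (nv 21))))

def addCarry : Prog :=
  .seq (.setNat 14 (.lit 0) (.mul (.cell 7 (nv 20)) (nv 10)))
    (.seq (.setNat 7 (nv 20) (.sub (.add (.cell 7 (nv 20)) (nv 10)) (.mul (.lit 2) (nv 14))))
      (.setNat 10 (.lit 0) (nv 14)))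

/-- Increments the bit string. -/
def increment : Prog :=
  .seq (.setNat 10 (.lit 0) (.lit 1)) (forLoop 20 (nv 0) addCarry)

def round : Prog := .seq findStrategy (.seq evaluate (.seq keepBest increment))

def listNode : Prog :=
  .branch (.natLe (.lit 1) (.cell 1 (nv 20)))
    (.seq (.setNat 5 (nv 3) (nv 20)) (.setNat 3 (.lit 0) (.add (nv 3) (.lit 1))))
    (.seq (.setNat 6 (nv 4) (nv 20)) (.setNat 4 (.lit 0) (.add (nv 4) (.lit 1))))

def listNodes : Prog := forLoop 20 (nv 0) listNode

def weightExp : RExp := .cell 1 (ix (nv 20) (nv 21))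

def addWeight : Prog :=
  .branch (.realLe (.lit 0) weightExp) (.setReal 12 (.lit 0) (.add (rv 12) weightExp))
    (.setReal 12 (.lit 0) (.sub (rv 12) weightExp))

/-- Computes the weight for missing edges. -/
def bound : Prog :=
  .seq (.setReal 12 (.lit 0) (.lit 0))
    (.seq (forLoop 20 (nv 0) (forLoop 21 (nv 0) addWeight))
      (.setReal 5 (.lit 0) (.div (.mul (.lit 2) (rv 12)) (.sub (.lit 1) (rv 0)))))

def entries : Prog :=
  .seq
    (.branch (.natLe (.lit 1) (.cell 2 (ix (.cell 5 (nv 20)) (.cell 6 (nv 21)))))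
      (.setReal 3 (ix (nv 20) (nv 21)) (.cell 1 (ix (.cell 5 (nv 20)) (.cell 6 (nv 21)))))
      (.setReal 3 (ix (nv 20) (nv 21)) (.sub (.lit 0) (rv 5))))
    (.branch (.natLe (.lit 1) (.cell 2 (ix (.cell 6 (nv 21)) (.cell 5 (nv 20)))))
      (.setReal 4 (ix (nv 21) (nv 20)) (.cell 1 (ix (.cell 6 (nv 21)) (.cell 5 (nv 20)))))
      (.setReal 4 (ix (nv 21) (nv 20)) (rv 5)))

def matrices : Prog := forLoop 20 (nv 3) (forLoop 21 (nv 4) entries)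

def startBest : Prog := forLoop 21 (nv 4) (.setReal 7 (nv 21) (.sub (.lit 0) (rv 5)))

def prepare : Prog := .seq listNodes (.seq bound (.seq matrices startBest))

def optionExp : RExp :=
  .add (.cell 3 (ix (nv 20) (nv 21))) (.mul (rv 0) (.cell 7 (nv 21)))

def writeMax : Prog :=
  .seq (.setReal 2 (.cell 5 (nv 20)) (.sub (.lit 0) (rv 5)))
    (forLoop 21 (nv 4) (.branch (.realLe optionExp (.cell 2 (.cell 5 (nv 20)))) .nop
      (.setReal 2 (.cell 5 (nv 20)) optionExp)))

def write : Prog :=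
  .seq (forLoop 20 (nv 3) writeMax)
    (forLoop 21 (nv 4) (.setReal 2 (.cell 6 (nv 21)) (.cell 7 (nv 21))))

/-- Computes the values of a bipartite discounted game. -/
def solve : Prog :=
  .seq prepare (.seq (.loop (.natLe (nv 10) (.lit 0)) round) write)

/-! ### Verification of the search for a strategy -/

/-- The numbers of nodes, the matrices of weights and their sizes fit the resources. -/
structure Setting (ρ : Res) (n k m : ℕ) (A B : ℕ → ℕ → ℝ) (lam M : ℝ) (c : ℕ) : Prop where
  add_eq : k + m = n
  rounds : ρ.rounds = n
  space : n * n + 2 * n + 2 ≤ ρ.space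
  bits : 8 * ((2 * c + 5) * (n + 1)) ≤ ρ.bits
  szA : ∀ i < k, ∀ j < m, ρ.sz c (A i j)
  szB : ∀ i < k, ∀ j < m, ρ.sz c (B j i)
  szlam : ρ.sz 1 lam
  szM : ρ.sz c M

/-- The memory contains the data of a game. -/
structure Holds (n k m : ℕ) (A B : ℕ → ℕ → ℝ) (lam M : ℝ) (s : Mem) : Prop where
  n_eq : s.nat 0 0 = n
  k_eq : s.nat 3 0 = k
  m_eq : s.nat 4 0 = m
  lam_eq : s.real 0 0 = lam
  M_eq : s.real 5 0 = M
  A_eq : ∀ i < k, ∀ j < m, s.real 3 (i * n + j) = A i j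
  B_eq : ∀ i < k, ∀ j < m, s.real 4 (j * n + i) = B j i

theorem Holds.of_same {n k m : ℕ} {A B : ℕ → ℕ → ℝ} {lam M : ℝ} {s s' : Mem} {p : Prog}
    (h : Holds n k m A B lam M s) (hs : Same p s s')
    (hn : ∀ a ∈ [0, 3, 4], a ∉ p.nmods) (hr : ∀ a ∈ [0, 3, 4, 5], a ∉ p.rmods) :
    Holds n k m A B lam M s' := by
  have n0 := hs.nat 0 (hn 0 (by simp))
  have n3 := hs.nat 3 (hn 3 (by simp))
  have n4 := hs.nat 4 (hn 4 (by simp))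
  have r0 := hs.real 0 (hr 0 (by simp))
  have r3 := hs.real 3 (hr 3 (by simp))
  have r4 := hs.real 4 (hr 4 (by simp))
  have r5 := hs.real 5 (hr 5 (by simp))
  exact ⟨n0 ▸ h.n_eq, n3 ▸ h.k_eq, n4 ▸ h.m_eq, r0 ▸ h.lam_eq, r5 ▸ h.M_eq, r3 ▸ h.A_eq,
    r4 ▸ h.B_eq⟩

theorem mul_add_inj {n l b l' b' : ℕ} (hb : b < n) (hb' : b' < n) (h : l * n + b = l' * n + b') :
    l = l' ∧ b = b' := by
  have h1 : (l * n + b) % n = (l' * n + b') % n := by rw [h]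
  have h2 : (l * n + b) / n = (l' * n + b') / n := by rw [h]
  rw [mul_comm l, mul_comm l', Nat.mul_add_mod, Nat.mul_add_mod, Nat.mod_eq_of_lt hb,
    Nat.mod_eq_of_lt hb'] at h1
  rw [mul_comm l, mul_comm l', Nat.mul_add_div (by omega), Nat.mul_add_div (by omega),
    Nat.div_eq_of_lt hb, Nat.div_eq_of_lt hb'] at h2
  exact ⟨by omega, h1⟩

section

variable {ρ : Res} {n k m : ℕ} {A B : ℕ → ℕ → ℝ} {lam M : ℝ} {c : ℕ}

theorem Setting.entry_lt (h : Setting ρ n k m A B lam M c) {l b : ℕ} (hl : l ≤ n) (hb : b < n) :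
    l * n + b < ρ.space := by
  have := Nat.mul_le_mul_right n hl
  have := h.space
  omega

theorem Setting.sz_of_le (h : Setting ρ n k m A B lam M c) {l q : ℕ} {x : ℝ} (hx : ρ.sz q x)
    (hq : q ≤ 8 * ((2 * c + 5) * (l + 1))) (hl : l ≤ n) : ρ.sz ρ.bits x := by
  refine ρ.sz_mono hx (hq.trans (le_trans ?_ h.bits))
  gcongr

/-- The entry `d` in row `l + 1` and column `b` of the table of weights of alternating walks, and
the corresponding last exchange `q`, when the first `t` sources have been considered; `D` contains
row `l` of the table. -/
structure WalkEntry (n j : ℕ) (A : ℕ → ℕ → ℝ) (σ : ℕ → ℕ) (l b t : ℕ) (D : ℕ → ℝ) (d : ℝ) (q : ℕ) :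
    Prop where
  relax : ∀ a < t, D (l * n + σ a) + A a b - A a (σ a) ≤ d
  pred : (q = j ∧ d = D (l * n + b)) ∨ (q < j ∧ D (l * n + b) < d ∧
    d = D (l * n + σ q) + A q b - A q (σ q))

/-- The entry starts as a copy of row `l`, marked by `j`, and is overwritten only by strict
improvements; this yields the strict inequality in `WalkTable.pred`. Rows `l` and `l + 1` are
disjoint, so the old row can be read meanwhile. -/
theorem exchanges_runs (hS : Setting ρ n k m A B lam M c) {s : Mem} (hok : ρ.Ok s)
    (hH : Holds n k m A B lam M s) {j l b : ℕ} (h11 : s.nat 11 0 = j) (h22 : s.nat 22 0 = l)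
    (h21 : s.nat 21 0 = b) (hj : j < k) (hl : l < m) (hb : b < m)
    (hσ : ∀ a < j, s.nat 8 a < m)
    (hsz : ∀ b < m, ρ.sz ((2 * c + 2) * (l + 1)) (s.real 6 (l * n + b))) :
    Runs ρ exchanges s fun s' =>
      (∀ i, i ≠ (l + 1) * n + b → s'.real 6 i = s.real 6 i ∧ s'.nat 9 i = s.nat 9 i) ∧
      ρ.sz ((2 * c + 2) * (l + 2)) (s'.real 6 ((l + 1) * n + b)) ∧
      WalkEntry n j A (s.nat 8) l b j (s.real 6) (s'.real 6 ((l + 1) * n + b))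
        (s'.nat 9 ((l + 1) * n + b)) := by
  have hkm := hS.add_eq
  have hrounds := hS.rounds
  have hspace := hS.space
  have hne : ∀ b' < m, l * n + b' ≠ (l + 1) * n + b := fun b' hb' h => by
    have := (mul_add_inj (by omega) (by omega) h).1
    omega
  have hidx : (l + 1) * n + b < ρ.space := hS.entry_lt (by omega) (by omega)
  have hszle : (2 * c + 2) * (l + 1) ≤ (2 * c + 2) * (l + 2) := by gcongr; omega
  have hszb : ∀ x, ρ.sz ((2 * c + 2) * (l + 2)) x → ρ.sz ρ.bits x := fun x hx =>
    hS.sz_of_le (l := l + 1) hx (by nlinarith) (by omega)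
  set t := (l + 1) * n + b with ht
  have et : nextEntry.eval s = t := by rw [nextEntry_eval, hH.n_eq, h22, h21]
  refine Runs.seq (Runs.setReal hok (by rw [et]; exact hidx) ?_ fun hok1 hs1 => ?_)
  · simp only [RExp.eval, ix_eval, NExp.eval, hH.n_eq, h22, h21]
    exact hszb _ (ρ.sz_mono (hsz b hb) hszle)
  rw [et] at hok1 hs1 ⊢
  simp only [RExp.eval, ix_eval, NExp.eval, hH.n_eq, h22, h21] at hok1 hs1 ⊢
  set s1 := s.setReal 6 t (s.real 6 (l * n + b)) with hs1def
  have et1 : nextEntry.eval s1 = t := et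
  have e11 : (nv 11).eval s1 = j := h11
  refine Runs.seq (Runs.setNat hok1 (by rw [et1]; exact hidx) (by rw [e11]; omega)
    fun hok2 hs2 => ?_)
  rw [et1, e11] at hok2 hs2 ⊢
  set s2 := s1.setNat 9 t j with hs2def
  refine Runs.forLoop j (fun a s' =>
      (∀ i, i ≠ t → s'.real 6 i = s.real 6 i ∧ s'.nat 9 i = s.nat 9 i) ∧
      ρ.sz ((2 * c + 2) * (l + 2)) (s'.real 6 t) ∧
      WalkEntry n j A (s.nat 8) l b a (s.real 6) (s'.real 6 t) (s'.nat 9 t))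
    hok2 (by decide) (by omega) (fun s' hs' => ?_) (fun _ _ _ h => h) ?_ ?_
    (fun s' _ _ h => h)
  · simp only [NExp.eval]
    rw [hs'.nat 11 (by decide)]
    exact h11
  · refine ⟨fun i hi => by simp [hs2def, hs1def, hi], ?_, ?_, ?_⟩
    · simpa [hs2def, hs1def] using ρ.sz_mono (hsz b hb) hszle
    · intro a ha; omega
    · left; simp [hs2def, hs1def]
  · intro a ha s' hok' hs' h23 ⟨hfr, hz, hE⟩
    have g8 : s'.nat 8 = s.nat 8 := hs'.nat 8 (by decide)
    have g0 : s'.nat 0 0 = n := (congrFun (hs'.nat 0 (by decide)) 0).trans hH.n_eq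
    have g22 : s'.nat 22 0 = l := (congrFun (hs'.nat 22 (by decide)) 0).trans h22
    have g21 : s'.nat 21 0 = b := (congrFun (hs'.nat 21 (by decide)) 0).trans h21
    have g3 : s'.real 3 = s.real 3 := hs'.real 3 (by decide)
    have ent : nextEntry.eval s' = t := by rw [nextEntry_eval, g0, g22, g21]
    have ecand : exchangeExp.eval s' =
        s.real 6 (l * n + s.nat 8 a) + A a b - A a (s.nat 8 a) := by
      simp only [exchangeExp, RExp.eval, NExp.eval, ix_eval, g8, g0, g22, g21, g3, h23,
        (hfr _ (hne _ (hσ a ha))).1, hH.A_eq a (by omega) b hb,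
        hH.A_eq a (by omega) _ (hσ a ha)]
    have ecell : RExp.eval s' (.cell 6 nextEntry) = s'.real 6 t := by rw [RExp.eval, ent]
    refine Runs.branch (fun hle => ?_) (fun hlt => ?_)
    · simp only [Test.holds] at hle
      rw [ecand, ecell] at hle
      refine Runs.nop hok' ⟨hfr, hz, fun a' ha' => ?_, hE.pred⟩
      rcases Nat.lt_succ_iff_lt_or_eq.1 ha' with h | rfl
      · exact hE.relax a' h
      · exact hle
    · simp only [Test.holds] at hlt
      rw [ecand, ecell, not_le] at hlt
      have hnz : ρ.sz ((2 * c + 2) * (l + 2)) (exchangeExp.eval s') := by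
        rw [ecand]
        -- One weight is added and one subtracted, each of size `c` plus one for the operation.
        -- Hence every row costs `2 * c + 2`.
        refine ρ.sz_mono (ρ.sz_sub (ρ.sz_add (hsz _ (hσ a ha)) (hS.szA a (by omega) b hb))
          (hS.szA a (by omega) _ (hσ a ha))) ?_
        nlinarith
      refine Runs.seq (Runs.setReal hok' (by rw [ent]; exact hidx) (hszb _ hnz)
        fun hok3 _ => ?_)
      have ent3 : nextEntry.eval (s'.setReal 6 (nextEntry.eval s') (exchangeExp.eval s')) = t := ent
      have e23 : (nv 23).eval (s'.setReal 6 (nextEntry.eval s') (exchangeExp.eval s')) = a := h23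
      refine Runs.setNat hok3 (by rw [ent3]; exact hidx) (by rw [e23]; omega) ?_
      rw [ent3, e23, ent]
      refine ⟨fun i hi => ?_, ?_, fun a' ha' => ?_, .inr ?_⟩
      · simpa [hi] using hfr i hi
      · simpa using hnz
      · simp only [Mem.setNat_real, Mem.setReal_real, Function.update_self]
        rw [ecand]
        rcases Nat.lt_succ_iff_lt_or_eq.1 ha' with h | rfl
        · exact (hE.relax a' h).trans hlt.le
        · exact le_rfl
      · simp only [Mem.setNat_real, Mem.setReal_real, Mem.setNat_nat, Mem.setReal_nat,
          Function.update_self]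
        refine ⟨ha, ?_, ecand⟩
        rw [ecand]
        refine lt_of_le_of_lt ?_ hlt
        rcases hE.pred with h | h
        · exact h.2.ge
        · exact h.2.1.le

theorem WalkEntry.congr {j l b t q m : ℕ} {σ : ℕ → ℕ} {D D' : ℕ → ℝ} {d : ℝ}
    (h : WalkEntry n j A σ l b t D d q) (hb : b < m) (ht : t ≤ j) (hσ : ∀ a < j, σ a < m)
    (hD : ∀ b < m, D' (l * n + b) = D (l * n + b)) : WalkEntry n j A σ l b t D' d q := by
  refine ⟨fun a ha => ?_, ?_⟩
  · rw [hD _ (hσ a (by omega))]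
    exact h.relax a ha
  · rcases h.pred with h1 | h1
    · exact .inl ⟨h1.1, by rw [hD b hb]; exact h1.2⟩
    · refine .inr ⟨h1.1, ?_⟩
      rw [hD b hb, hD _ (hσ _ h1.1)]
      exact h1.2

theorem walkTable_runs (hS : Setting ρ n k m A B lam M c) {s : Mem} (hok : ρ.Ok s)
    (hH : Holds n k m A B lam M s) {j : ℕ} (h11 : s.nat 11 0 = j) (hj : j < k)
    (hσ : ∀ a < j, s.nat 8 a < m) :
    Runs ρ walkTable s fun s' => WalkTable A m j (s.nat 8) (fun l b => s'.real 6 (l * n + b))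
      (fun l b => s'.nat 9 (l * n + b)) := by
  have hkm := hS.add_eq
  have hrounds := hS.rounds
  have hszb : ∀ l ≤ n, ∀ x, ρ.sz ((2 * c + 2) * (l + 1)) x → ρ.sz ρ.bits x := fun l hl x hx =>
    hS.sz_of_le (l := l) hx (by nlinarith) hl
  refine Runs.seq ?_
  refine Runs.forLoop m (fun b s' => ∀ b' < b, s'.real 6 (0 * n + b') = A j b')
    hok (by decide) (by omega) (fun s' hs' => ?_) (fun _ _ _ h => h) (by simp) ?_ ?_
  · simp only [NExp.eval]
    rw [hs'.nat 4 (by decide)]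
    exact hH.m_eq
  · intro b hb s' hok' hs' h21 hI
    have g0 : s'.nat 0 0 = n := (congrFun (hs'.nat 0 (by decide)) 0).trans hH.n_eq
    have g11 : s'.nat 11 0 = j := (congrFun (hs'.nat 11 (by decide)) 0).trans h11
    have g3 : s'.real 3 = s.real 3 := hs'.real 3 (by decide)
    have hev : RExp.eval s' (.cell 3 (ix (nv 11) (nv 21))) = A j b := by
      simp only [RExp.eval, ix_eval, NExp.eval, g0, g11, h21, g3, hH.A_eq j hj b hb]
    have hix : (ix (.lit 0) (nv 21)).eval s' = 0 * n + b := by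
      simp only [ix_eval, NExp.eval, g0, h21]
    refine Runs.setReal hok' ?_ ?_ ?_
    · rw [hix]; exact hS.entry_lt (by omega) (by omega)
    · rw [hev]; exact hszb 0 (by omega) _ (ρ.sz_mono (hS.szA j hj b hb) (by omega))
    · rw [hix, hev]
      intro b' hb'
      simp only [Mem.setReal_real, Function.update_self, Function.update_apply]
      split_ifs with h
      · rw [(mul_add_inj (by omega) (by omega) h).2]
      · exact hI b' (by omega)
  intro s1 _ hs1 hI1 hok1 _
  have hH1 : Holds n k m A B lam M s1 := hH.of_same hs1 (by decide) (by decide)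
  have h11' : s1.nat 11 0 = j := (congrFun (hs1.nat 11 (by decide)) 0).trans h11
  rw [← hs1.nat 8 (by decide)] at hσ ⊢
  refine Runs.forLoop m (fun l s' => (∀ b < m, s'.real 6 (0 * n + b) = A j b) ∧
      (∀ l' ≤ l, ∀ b < m, ρ.sz ((2 * c + 2) * (l' + 1)) (s'.real 6 (l' * n + b))) ∧
      ∀ l' < l, ∀ b < m, WalkEntry n j A (s1.nat 8) l' b j (s'.real 6)
        (s'.real 6 ((l' + 1) * n + b)) (s'.nat 9 ((l' + 1) * n + b)))
    hok1 (by decide) (by omega) (fun s' hs' => ?_) (fun _ _ _ h => h) ?_ ?_ ?_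
  · simp only [NExp.eval]
    rw [hs'.nat 4 (by decide)]
    exact hH1.m_eq
  · refine ⟨hI1, fun l' hl' b hb => ?_, fun l' hl' => by omega⟩
    obtain rfl : l' = 0 := by omega
    rw [hI1 b hb]
    exact ρ.sz_mono (hS.szA j hj b hb) (by omega)
  · intro l hl s2 hok2 hs2 h22 ⟨hz, hsz, hE⟩
    have hH2 : Holds n k m A B lam M s2 := hH1.of_same hs2 (by decide) (by decide)
    have h11'' : s2.nat 11 0 = j := (congrFun (hs2.nat 11 (by decide)) 0).trans h11'
    rw [← hs2.nat 8 (by decide)] at hσ hE ⊢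
    refine Runs.forLoop m (fun b s' =>
        (∀ l' ≤ l, ∀ b < m, s'.real 6 (l' * n + b) = s2.real 6 (l' * n + b) ∧
          s'.nat 9 (l' * n + b) = s2.nat 9 (l' * n + b)) ∧
        ∀ b' < b, ρ.sz ((2 * c + 2) * (l + 2)) (s'.real 6 ((l + 1) * n + b')) ∧
          WalkEntry n j A (s2.nat 8) l b' j (s2.real 6)
            (s'.real 6 ((l + 1) * n + b')) (s'.nat 9 ((l + 1) * n + b')))
      hok2 (by decide) (by omega) (fun s' hs' => ?_) (fun _ _ _ h => h)
      ⟨fun _ _ _ _ => ⟨rfl, rfl⟩, by simp⟩ ?_ ?_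
    · simp only [NExp.eval]
      rw [hs'.nat 4 (by decide)]
      exact hH2.m_eq
    · intro b hb s3 hok3 hs3 h21 ⟨hfr, hN⟩
      have g8 : s3.nat 8 = s2.nat 8 := hs3.nat 8 (by decide)
      refine (exchanges_runs hS hok3 (hH2.of_same hs3 (by decide) (by decide))
        ((congrFun (hs3.nat 11 (by decide)) 0).trans h11'')
        ((congrFun (hs3.nat 22 (by decide)) 0).trans h22) h21 hj hl hb (by rwa [g8])
        fun b' hb' => ?_).imp ?_
      · rw [(hfr l le_rfl b' hb').1]
        exact hsz l le_rfl b' hb'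
      · rintro s4 _ _ ⟨hf4, hz4, hE4⟩
        refine ⟨fun l' hl' b' hb' => ?_, fun b' hb' => ?_⟩
        · have hne : l' * n + b' ≠ (l + 1) * n + b := fun h => by
            have := (mul_add_inj (by omega) (by omega) h).1
            omega
          rw [(hf4 _ hne).1, (hf4 _ hne).2]
          exact hfr l' hl' b' hb'
        · rcases Nat.lt_succ_iff_lt_or_eq.1 hb' with h | rfl
          · have hne : (l + 1) * n + b' ≠ (l + 1) * n + b := by omega
            rw [(hf4 _ hne).1, (hf4 _ hne).2]
            exact hN b' h
          · rw [g8] at hE4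
            exact ⟨hz4, hE4.congr hb le_rfl hσ fun b'' hb'' => (hfr l le_rfl b'' hb'').1.symm⟩
    · rintro s3 _ _ ⟨hfr, hN⟩
      refine ⟨fun b hb => ?_, fun l' hl' b hb => ?_, fun l' hl' b hb => ?_⟩
      · rw [(hfr 0 (by omega) b hb).1]
        exact hz b hb
      · rcases Nat.le_succ_iff.1 hl' with h | rfl
        · rw [(hfr l' h b hb).1]
          exact hsz l' h b hb
        · exact (hN b hb).1
      · rcases Nat.lt_succ_iff_lt_or_eq.1 hl' with h | rfl
        · rw [(hfr (l' + 1) h b hb).1, (hfr (l' + 1) h b hb).2]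
          exact (hE l' h b hb).congr hb le_rfl hσ fun b' hb' => (hfr l' h.le b' hb').1
        · exact (hN b hb).2.congr hb le_rfl hσ fun b' hb' => (hfr l' le_rfl b' hb').1
  · rintro s2 _ _ ⟨hz, -, hE⟩
    exact ⟨hz, fun l hl b hb a ha => (hE l hl b hb).relax a ha, fun l hl b hb => (hE l hl b hb).pred⟩

theorem augment_runs (hS : Setting ρ n k m A B lam M c) {s : Mem} (hok : ρ.Ok s)
    (hH : Holds n k m A B lam M s) {j d : ℕ} (h11 : s.nat 11 0 = j) (hj : j < k)
    (h12 : s.nat 12 0 = d) (hd : d < m) (hσ : ∀ a < k, s.nat 8 a < m) {p : ℕ → ℝ}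
    (hg : Greedy A m j (s.nat 8) p) :
    Runs ρ augment s fun s' => (∀ a < k, s'.nat 8 a < m) ∧ (∃ p', Greedy A m (j + 1) (s'.nat 8) p') ∧
      ∀ f : ℕ → ℝ, ∑ a ∈ Finset.range (j + 1), f (s'.nat 8 a) =
        ∑ a ∈ Finset.range j, f (s.nat 8 a) + f d := by
  have hkm := hS.add_eq
  have hrounds := hS.rounds
  have hspace := hS.space
  have hσj : ∀ a < j, s.nat 8 a < m := fun a ha => hσ a (by omega)
  refine Runs.seq ((walkTable_runs hS hok hH h11 hj hσj).imp fun s1 hok1 hs1 hW _ _ => ?_)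
  have hH1 : Holds n k m A B lam M s1 := hH.of_same hs1 (by decide) (by decide)
  have g8 : s1.nat 8 = s.nat 8 := hs1.nat 8 (by decide)
  have g11 : s1.nat 11 0 = j := (congrFun (hs1.nat 11 (by decide)) 0).trans h11
  have g12 : (nv 12).eval s1 = d := (congrFun (hs1.nat 12 (by decide)) 0).trans h12
  refine Runs.seq (Runs.setNat hok1 ρ.space_pos (by rw [g12]; omega) fun hok2 _ => ?_)
  rw [g12] at hok2 ⊢
  -- The counter goes up while the number of exchanges still allowed, `m - i`, goes down to zero.
  -- Legality of the targets is kept for all sources below `k`, including those not yet assigned.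
  refine Runs.seq (Runs.forLoop m (fun i s' => (∀ a < k, s'.nat 8 a < m) ∧
      WalkTable.Tracing A m j d (s.nat 8) (fun l b => s1.real 6 (l * n + b)) (m - i)
        (s'.nat 8) (s'.nat 13 0))
    hok2 (by decide) (by omega) (fun s' hs' => ?_) (fun _ _ _ h => h) ?_ ?_ ?_)
  · simp only [NExp.eval]
    rw [hs'.nat 4 (by decide)]
    exact hH1.m_eq
  · refine ⟨fun a ha => ?_, ?_⟩
    · change s1.nat 8 a < m
      rw [g8]
      exact hσ a ha
    · have : (s1.setNat 13 ((NExp.lit 0).eval s1) d).nat 13 0 = d := by simp [NExp.eval]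
      rw [this]
      change WalkTable.Tracing A m j d (s.nat 8) _ m (s1.nat 8) d
      rw [g8]
      exact .start hσj hd
  · intro i hi s3 hok3 hs3 h22 ⟨hlt, hT⟩
    have g0 : s3.nat 0 0 = n := (congrFun (hs3.nat 0 (by decide)) 0).trans hH1.n_eq
    have g4 : s3.nat 4 0 = m := (congrFun (hs3.nat 4 (by decide)) 0).trans hH1.m_eq
    have g11 : s3.nat 11 0 = j := (congrFun (hs3.nat 11 (by decide)) 0).trans g11
    have g9 : s3.nat 9 = s1.nat 9 := hs3.nat 9 (by decide)
    obtain ⟨l, hl⟩ : ∃ l, m - i = l + 1 := ⟨m - i - 1, by omega⟩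
    have hl' : m - (i + 1) = l := by omega
    rw [hl'] at *
    rw [hl] at hT
    set cur := s3.nat 13 0 with hcur
    set q := s1.nat 9 ((l + 1) * n + cur) with hq
    have hqj : q ≤ j := by
      rcases hW.pred l (by omega) cur hT.cur_lt with h | h
      · exact h.1.le
      · exact h.1.le
    have hev : NExp.eval s3 (.cell 9 (ix (.sub (nv 4) (nv 22)) (nv 13))) = q := by
      simp only [NExp.eval, ix_eval, g0, g4, h22, g9, hl, hq, hcur]
    refine Runs.seq (Runs.setNat hok3 ρ.space_pos (by rw [hev]; omega) fun hok4 _ => ?_)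
    rw [hev] at hok4 ⊢
    change ρ.Ok (s3.setNat 14 0 q) at hok4
    change Runs ρ _ (s3.setNat 14 0 q) _
    refine Runs.branch (fun hlt' => ?_) (fun hge => ?_)
    · replace hlt' : q + 1 ≤ j := by simpa [Test.holds, NExp.eval, g11] using hlt'
      have hmove := hT.move hW hσj hg (by omega) (Nat.lt_of_succ_le hlt')
      have hcl := hT.cur_lt
      have h8q : s3.nat 8 q < m := hT.lt q (by omega)
      have e8 : NExp.eval (s3.setNat 14 0 q) (.cell 8 (nv 14)) = s3.nat 8 q := by
        simp [NExp.eval]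
      refine Runs.seq (Runs.setNat hok4 ρ.space_pos (by rw [e8]; omega) fun hok5 _ => ?_)
      rw [e8] at hok5 ⊢
      change ρ.Ok ((s3.setNat 14 0 q).setNat 15 0 (s3.nat 8 q)) at hok5
      change Runs ρ _ ((s3.setNat 14 0 q).setNat 15 0 (s3.nat 8 q)) _
      have e14 : NExp.eval ((s3.setNat 14 0 q).setNat 15 0 (s3.nat 8 q)) (nv 14) = q := by
        simp [NExp.eval]
      have e13 : NExp.eval ((s3.setNat 14 0 q).setNat 15 0 (s3.nat 8 q)) (nv 13) = cur := rfl
      refine Runs.seq (Runs.setNat hok5 (by rw [e14]; omega) (by rw [e13]; omega) fun hok6 _ => ?_)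
      rw [e14, e13] at hok6 ⊢
      have e15 : NExp.eval (((s3.setNat 14 0 q).setNat 15 0 (s3.nat 8 q)).setNat 8 q cur) (nv 15) =
          s3.nat 8 q := by
        simp [NExp.eval]
      refine Runs.setNat hok6 ρ.space_pos (by rw [e15]; omega) ?_
      rw [e15]
      set s6 := ((s3.setNat 14 0 q).setNat 15 0 (s3.nat 8 q)).setNat 8 q cur with hs6
      have r8 : (s6.setNat 13 0 (s3.nat 8 q)).nat 8 = Function.update (s3.nat 8) q cur := by
        simp [hs6]
      have r13 : (s6.setNat 13 0 (s3.nat 8 q)).nat 13 0 = s3.nat 8 q := by simp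
      change (∀ a < k, (s6.setNat 13 0 (s3.nat 8 q)).nat 8 a < m) ∧
        WalkTable.Tracing A m j d (s.nat 8) _ l ((s6.setNat 13 0 (s3.nat 8 q)).nat 8)
          ((s6.setNat 13 0 (s3.nat 8 q)).nat 13 0)
      rw [r8, r13]
      refine ⟨fun a ha => ?_, hmove⟩
      rw [Function.update_apply]
      split_ifs
      · exact hcl
      · exact hlt a ha
    · replace hge : ¬ q + 1 ≤ j := by simpa [Test.holds, NExp.eval, g11] using hge
      exact Runs.nop hok4 ⟨hlt, hT.stay hW hσj (by omega) fun h => hge h⟩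
  · rintro s3 _ hs3 ⟨hlt, hT⟩ hok3 _
    have g11 : (nv 11).eval s3 = j := (congrFun (hs3.nat 11 (by decide)) 0).trans g11
    have hcl := hT.cur_lt
    have e13 : (nv 13).eval s3 = s3.nat 13 0 := rfl
    refine Runs.setNat hok3 (by rw [g11]; omega) (by rw [e13]; omega) ?_
    rw [g11, e13]
    have r8 : (s3.setNat 8 j (s3.nat 13 0)).nat 8 = Function.update (s3.nat 8) j (s3.nat 13 0) := by
      simp
    rw [r8]
    rw [Nat.sub_self] at hT
    obtain ⟨hg', hs'⟩ := hT.finish hW hσj hg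
    refine ⟨fun a ha => ?_, ⟨_, hg'⟩, hs'⟩
    rw [Function.update_apply]
    split_ifs
    · exact hcl
    · exact hlt a ha

/-- For arbitrary strings the result is still a legal strategy, greedy on the sources assigned so
far. Only the claim about in-degrees needs `Describes`: then cells `11` and `12` hold the numbers of
ones and zeros read, and the partial assignment matches `tally`. -/
theorem findStrategy_runs (hS : Setting ρ n k m A B lam M c) {s : Mem} (hok : ρ.Ok s)
    (hH : Holds n k m A B lam M s) (hβ : ∀ i < n, s.nat 7 i < 2) (hσ : ∀ a < k, s.nat 8 a < m) :
    Runs ρ findStrategy s fun s' => (∀ a < k, s'.nat 8 a < m) ∧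
      ∀ σ, Describes k m σ (s.nat 7) → (∃ p, Greedy A m k (s'.nat 8) p) ∧
        ∀ f : ℕ → ℝ, ∑ a ∈ Finset.range k, f (s'.nat 8 a) = ∑ a ∈ Finset.range k, f (σ a) := by
  have hkm := hS.add_eq
  have hrounds := hS.rounds
  have hspace := hS.space
  set β := s.nat 7 with hβdef
  have hsucc : ∀ i, ones β (i + 1) = ones β i + if β i = 1 then 1 else 0 := fun i =>
    Nat.count_succ _ _
  have hle : ∀ i, ones β i ≤ i := fun i => Nat.count_le _
  have htally : ∀ f i, tally β f (i + 1) = tally β f i +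
      if β i = 1 then f (i - ones β i) else 0 := fun f i => Finset.sum_range_succ _ _
  refine Runs.seq (Runs.setNat hok ρ.space_pos (by simp [NExp.eval]) fun hok1 hs1 => ?_)
  refine Runs.seq (Runs.setNat hok1 ρ.space_pos (by simp [NExp.eval]) fun hok2 hs2 => ?_)
  refine Runs.forLoop n (fun i s' => (∀ a < k, s'.nat 8 a < m) ∧ s'.nat 11 0 ≤ k ∧
      s'.nat 12 0 ≤ i ∧ (∃ p, Greedy A m (s'.nat 11 0) (s'.nat 8) p) ∧
      ∀ σ, Describes k m σ β → s'.nat 11 0 = ones β i ∧ s'.nat 12 0 = i - ones β i ∧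
        ∀ f : ℕ → ℝ, ∑ a ∈ Finset.range (s'.nat 11 0), f (s'.nat 8 a) = tally β f i)
    hok2 (by decide) (by omega) (fun s' hs' => ?_) (fun _ _ _ h => h) ?_ ?_ ?_
  · simp only [NExp.eval]
    rw [hs'.nat 0 (by decide)]
    exact hH.n_eq
  · refine ⟨fun a ha => hσ a ha, ?_, ?_, ⟨0, ?_⟩, fun σ _ => ⟨?_, ?_, fun f => ?_⟩⟩
    · simp [NExp.eval]
    · simp [NExp.eval]
    · intro a ha
      simp [NExp.eval] at ha
    · simp [NExp.eval, ones]
    · simp [NExp.eval]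
    · simp [NExp.eval, tally]
  · rintro i hi s3 hok3 hs3 h20 ⟨hlt, ha, hb, ⟨p, hg⟩, hD⟩
    have hH3 : Holds n k m A B lam M s3 :=
      Holds.of_same (s := (s.setNat 11 _ _).setNat 12 _ _)
        ⟨hH.n_eq, hH.k_eq, hH.m_eq, hH.lam_eq, hH.M_eq, hH.A_eq, hH.B_eq⟩ hs3
        (by decide) (by decide)
    have g7 : s3.nat 7 = β := hs3.nat 7 (by decide)
    have hβi := hβ i hi
    refine Runs.branch (fun h1 => ?_) (fun h1 => ?_)
    · have h1 : β i = 1 := by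
        simp only [Test.holds, NExp.eval, h20, g7] at h1
        omega
      refine Runs.branch (fun h2 => ?_) (fun h2 => ?_)
      · simp only [Test.holds, NExp.eval, hH3.k_eq, hH3.m_eq] at h2
        refine Runs.seq ((augment_runs hS hok3 hH3 rfl (by omega) rfl (by omega) hlt hg).imp ?_)
        rintro s4 hok4 hs4 ⟨hlt4, hg4, hsum4⟩ _ _
        have g11 : s4.nat 11 0 = s3.nat 11 0 := congrFun (hs4.nat 11 (by decide)) 0
        have g12 : s4.nat 12 0 = s3.nat 12 0 := congrFun (hs4.nat 12 (by decide)) 0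
        have e11 : NExp.eval s4 (.add (nv 11) (.lit 1)) = s3.nat 11 0 + 1 := by
          simp only [NExp.eval, g11]
        refine Runs.setNat hok4 ρ.space_pos (by rw [e11]; omega) ?_
        rw [e11]
        have r11 : (s4.setNat 11 ((NExp.lit 0).eval s4) (s3.nat 11 0 + 1)).nat 11 0 =
            s3.nat 11 0 + 1 := by simp [NExp.eval]
        have r12 : (s4.setNat 11 ((NExp.lit 0).eval s4) (s3.nat 11 0 + 1)).nat 12 0 =
            s3.nat 12 0 := g12
        rw [r11, r12]
        refine ⟨hlt4, by omega, by omega, hg4, fun σ hdes => ?_⟩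
        obtain ⟨d1, d2, d3⟩ := hD σ hdes
        rw [hsucc, if_pos h1]
        refine ⟨by omega, by omega, fun f => ?_⟩
        rw [htally, if_pos h1, ← d3 f, ← d2]
        exact hsum4 f
      · refine Runs.nop hok3 ⟨hlt, ha, by omega, ⟨p, hg⟩, fun σ hdes => ?_⟩
        -- The guard cannot fail for a string that describes in-degrees: fewer than `k` ones precede
        -- this one, and its target is below `m`.
        exfalso
        obtain ⟨d1, d2, d3⟩ := hD σ hdes
        simp only [Test.holds, NExp.eval, hH3.k_eq, hH3.m_eq] at h2
        have h3 := hdes.lt i (by omega) h1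
        have h4 := ones_mono β (show i + 1 ≤ k + m by omega)
        rw [hdes.ones, hsucc, if_pos h1] at h4
        omega
    · have h1 : β i ≠ 1 := by
        simp only [Test.holds, NExp.eval, h20, g7] at h1
        omega
      have e12 : NExp.eval s3 (.add (nv 12) (.lit 1)) = s3.nat 12 0 + 1 := rfl
      refine Runs.setNat hok3 ρ.space_pos (by rw [e12]; omega) ?_
      rw [e12]
      have r12 : (s3.setNat 12 ((NExp.lit 0).eval s3) (s3.nat 12 0 + 1)).nat 12 0 =
          s3.nat 12 0 + 1 := by simp [NExp.eval]
      have r11 : (s3.setNat 12 ((NExp.lit 0).eval s3) (s3.nat 12 0 + 1)).nat 11 0 =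
          s3.nat 11 0 := rfl
      rw [r11, r12]
      refine ⟨hlt, ha, by omega, ⟨p, hg⟩, fun σ hdes => ?_⟩
      obtain ⟨d1, d2, d3⟩ := hD σ hdes
      rw [hsucc, if_neg h1]
      refine ⟨by omega, ?_, fun f => ?_⟩
      · have := hle i
        omega
      · rw [htally, if_neg h1, add_zero]
        exact d3 f
  · rintro s3 _ _ ⟨hlt, -, -, hg, hD⟩
    refine ⟨hlt, fun σ hdes => ?_⟩
    obtain ⟨d1, d2, d3⟩ := hD σ hdes
    rw [← hkm, hdes.ones] at d1
    rw [d1] at hg d3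
    refine ⟨hg, fun f => ?_⟩
    rw [d3 f, ← hdes.sum f, hkm]

end

end RealRAM

/-! ### Verification of the evaluation of a strategy -/

namespace RealRAM

section

variable {ρ : Res} {n k m : ℕ} {A B : ℕ → ℕ → ℝ} {lam M : ℝ} {c : ℕ} {xs ys : ℕ → ℝ}

/-- The number `z` bounds the costs of walks with `l` steps from `u` to `v`: it is at most the cost
of following `nx`, and it is consistent with the values `ys` if `O` holds. -/
structure WalkBound (ρ : Res) (c : ℕ) (μ : ℝ) (ys cost : ℕ → ℝ) (nx : ℕ → ℕ) (O : Prop)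
    (l u v : ℕ) (z : ℝ) : Prop where
  size : ρ.sz ((2 * c + 5) * (l + 1)) z
  lower : O → ys u ≤ z + μ ^ l * ys v
  upper : nx^[l] u = v → z ≤ walkCost μ cost nx l u

theorem _root_.MatrixGame.mul_pos (hG : MatrixGame k m A B lam M xs ys) : 0 < lam * lam :=
  _root_.mul_pos hG.pos hG.pos

theorem _root_.MatrixGame.mul_lt_one (hG : MatrixGame k m A B lam M xs ys) : lam * lam < 1 := by
  nlinarith [hG.pos, hG.lt_one]

/-- Shows that `M + M` is a safe substitute for infinity in the table of walk costs. -/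
theorem _root_.MatrixGame.le_add_pow_mul (hG : MatrixGame k m A B lam M xs ys) {u v : ℕ}
    (hu : u < m) (hv : v < m) (l : ℕ) : ys u ≤ M + M + (lam * lam) ^ l * ys v := by
  have h1 := abs_le.1 (hG.abs_min u hu)
  have h2 : |(lam * lam) ^ l * ys v| ≤ M := by
    rw [abs_mul, abs_of_pos (pow_pos hG.mul_pos l)]
    have h3 := pow_le_one₀ (n := l) hG.mul_pos.le hG.mul_lt_one.le
    nlinarith [hG.abs_min v hv, abs_nonneg (ys v), pow_pos hG.mul_pos l]
  have h4 := abs_le.1 h2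
  linarith

theorem Setting.sz_pow (hS : Setting ρ n k m A B lam M c) (l : ℕ) :
    ρ.sz (2 * l + 1) ((lam * lam) ^ l) := by
  induction l with
  | zero => simpa using ρ.sz_lit 1 (by omega)
  | succ l ih =>
    rw [pow_succ]
    exact ρ.sz_mono (ρ.sz_mul ih (ρ.sz_mul hS.szlam hS.szlam)) (by omega)

/-- Minimising over all replies gives a cost at most that of the particular reply `τ u`, while
optimality of the strategy bounds every reply from below. So both halves of `WalkBound` pass from
row `l` to row `l + 1`. -/
theorem replies_runs (hS : Setting ρ n k m A B lam M c) (hG : MatrixGame k m A B lam M xs ys)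
    {s : Mem} (hok : ρ.Ok s) (hH : Holds n k m A B lam M s) (hσ : ∀ a < k, s.nat 8 a < m)
    {τ : ℕ → ℕ} (hτ : ∀ u < m, τ u < k) {l u v : ℕ} (h22 : s.nat 22 0 = l) (h21 : s.nat 21 0 = u)
    (hl : l < m) (hu : u < m) (hv : v < m)
    (hrow : ∀ u < m, WalkBound ρ c (lam * lam) ys
      (fun x => B x (τ x) + lam * A (τ x) (s.nat 8 (τ x))) (fun x => s.nat 8 (τ x))
      (MatrixGame.Optimal k m A B lam ys (s.nat 8)) l u v (s.real 9 (l * n + u))) :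
    Runs ρ replies s fun s' => (∀ i, i ≠ (l + 1) * n + u → s'.real 9 i = s.real 9 i) ∧
      WalkBound ρ c (lam * lam) ys
        (fun x => B x (τ x) + lam * A (τ x) (s.nat 8 (τ x))) (fun x => s.nat 8 (τ x))
        (MatrixGame.Optimal k m A B lam ys (s.nat 8)) (l + 1) u v
        (s'.real 9 ((l + 1) * n + u)) := by
  have hkm := hS.add_eq
  have hrounds := hS.rounds
  have hμ := hG.mul_pos
  have hne : ∀ u' < m, l * n + u' ≠ (l + 1) * n + u := fun u' hu' h => by
    have := (mul_add_inj (by omega) (by omega) h).1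
    omega
  have hidx : (l + 1) * n + u < ρ.space := hS.entry_lt (by omega) (by omega)
  have hszb : ∀ x, ρ.sz ((2 * c + 5) * (l + 1 + 1)) x → ρ.sz ρ.bits x := fun x hx =>
    hS.sz_of_le (l := l + 1) hx (by nlinarith) (by omega)
  set t := (l + 1) * n + u with ht
  have et : nextEntry.eval s = t := by rw [nextEntry_eval, hH.n_eq, h22, h21]
  have eM : RExp.eval s (.add (rv 5) (rv 5)) = M + M := by
    simp only [RExp.eval, NExp.eval, hH.M_eq]
  have hszM : ρ.sz ((2 * c + 5) * (l + 1 + 1)) (M + M) :=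
    ρ.sz_mono (ρ.sz_add hS.szM hS.szM) (by nlinarith)
  refine Runs.seq (Runs.setReal hok (by rw [et]; exact hidx) (by rw [eM]; exact hszb _ hszM)
    fun hok1 _ => ?_)
  rw [et, eM] at hok1 ⊢
  set s1 := s.setReal 9 t (M + M) with hs1
  set step : ℕ → ℝ := fun a => B u a + lam * A a (s.nat 8 a) +
    lam * lam * s.real 9 (l * n + s.nat 8 a) with hstep
  refine Runs.forLoop k (fun a s' => (∀ i, i ≠ t → s'.real 9 i = s.real 9 i) ∧
      ρ.sz ((2 * c + 5) * (l + 1 + 1)) (s'.real 9 t) ∧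
      (MatrixGame.Optimal k m A B lam ys (s.nat 8) →
        ys u ≤ s'.real 9 t + (lam * lam) ^ (l + 1) * ys v) ∧
      ∀ a' < a, s'.real 9 t ≤ step a')
    hok1 (by decide) (by omega) (fun s' hs' => ?_) (fun _ _ _ h => h) ?_ ?_ ?_
  · simp only [NExp.eval]
    rw [hs'.nat 3 (by decide)]
    exact hH.k_eq
  · refine ⟨fun i hi => by simp [hs1, hi], ?_, fun _ => ?_, by simp⟩
    · simpa [hs1] using hszM
    · simpa [hs1] using hG.le_add_pow_mul hu hv (l + 1)
  · rintro a ha s' hok' hs' h23 ⟨hfr, hz, hlow, hup⟩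
    have g8 : s'.nat 8 = s.nat 8 := hs'.nat 8 (by decide)
    have g0 : s'.nat 0 0 = n := (congrFun (hs'.nat 0 (by decide)) 0).trans hH.n_eq
    have g22 : s'.nat 22 0 = l := (congrFun (hs'.nat 22 (by decide)) 0).trans h22
    have g21 : s'.nat 21 0 = u := (congrFun (hs'.nat 21 (by decide)) 0).trans h21
    have g3 : s'.real 3 = s.real 3 := hs'.real 3 (by decide)
    have g4 : s'.real 4 = s.real 4 := hs'.real 4 (by decide)
    have gl : s'.real 0 0 = lam := (congrFun (hs'.real 0 (by decide)) 0).trans hH.lam_eq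
    have ent : nextEntry.eval s' = t := by rw [nextEntry_eval, g0, g22, g21]
    have ecand : stepExp.eval s' = step a := by
      simp only [stepExp, RExp.eval, NExp.eval, ix_eval, g8, g0, g22, g21, g3, g4, gl, h23,
        hfr _ (hne _ (hσ a ha)), hH.B_eq a ha u hu, hH.A_eq a ha _ (hσ a ha), hstep]
    have ecell : RExp.eval s' (.cell 9 nextEntry) = s'.real 9 t := by rw [RExp.eval, ent]
    refine Runs.branch (fun hle => ?_) (fun hlt => ?_)
    · simp only [Test.holds] at hle
      rw [ecand, ecell] at hle
      refine Runs.nop hok' ⟨hfr, hz, hlow, fun a' ha' => ?_⟩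
      rcases Nat.lt_succ_iff_lt_or_eq.1 ha' with h | rfl
      · exact hup a' h
      · exact hle
    · simp only [Test.holds] at hlt
      rw [ecand, ecell, not_le] at hlt
      have hnz : ρ.sz ((2 * c + 5) * (l + 1 + 1)) (step a) := by
        -- The cost of a step has size `2 * c + 2`, the factor `lam * lam` adds two and the sum one:
        -- `2 * c + 5` per row.
        refine ρ.sz_mono (ρ.sz_add (ρ.sz_add (hS.szB a ha u hu)
          (ρ.sz_mul hS.szlam (hS.szA a ha _ (hσ a ha))))
          (ρ.sz_mul (ρ.sz_mul hS.szlam hS.szlam) (hrow _ (hσ a ha)).size)) ?_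
        nlinarith
      refine Runs.setReal hok' (by rw [ent]; exact hidx) (by rw [ecand]; exact hszb _ hnz) ?_
      rw [ent, ecand]
      simp only [Mem.setReal_real, Function.update_self]
      refine ⟨fun i hi => by rw [Function.update_of_ne hi]; exact hfr i hi, hnz, fun hO => ?_,
        fun a' ha' => ?_⟩
      · have h1 := hO u hu a ha
        have h2 := mul_le_mul_of_nonneg_left ((hrow _ (hσ a ha)).lower hO) hμ.le
        simp only [hstep]
        rw [pow_succ]
        linarith
      · rcases Nat.lt_succ_iff_lt_or_eq.1 ha' with h | rfl
        · exact hlt.le.trans (hup a' h)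
        · exact le_rfl
  · rintro s' _ _ ⟨hfr, hz, hlow, hup⟩
    refine ⟨hfr, hz, hlow, fun hit => ?_⟩
    rw [Function.iterate_succ_apply] at hit
    have h1 := hup (τ u) (hτ u hu)
    have h2 := (hrow _ (hσ _ (hτ u hu))).upper hit
    have h3 := mul_le_mul_of_nonneg_left h2 hμ.le
    simp only [hstep] at h1
    rw [walkCost]
    linarith

theorem walks_runs (hS : Setting ρ n k m A B lam M c) (hG : MatrixGame k m A B lam M xs ys)
    {s : Mem} (hok : ρ.Ok s) (hH : Holds n k m A B lam M s) (hσ : ∀ a < k, s.nat 8 a < m)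
    {τ : ℕ → ℕ} (hτ : ∀ u < m, τ u < k) {v : ℕ} (h20 : s.nat 20 0 = v) (hv : v < m) :
    Runs ρ walks s fun s' => (∀ l ≤ m, s'.real 10 l = (lam * lam) ^ l) ∧
      ∀ l ≤ m, ∀ u < m, WalkBound ρ c (lam * lam) ys
        (fun x => B x (τ x) + lam * A (τ x) (s.nat 8 (τ x))) (fun x => s.nat 8 (τ x))
        (MatrixGame.Optimal k m A B lam ys (s.nat 8)) l u v (s'.real 9 (l * n + u)) := by
  have hkm := hS.add_eq
  have hrounds := hS.rounds
  have hspace := hS.space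
  have hszM : ρ.sz ((2 * c + 5) * (0 + 1)) (M + M) :=
    ρ.sz_mono (ρ.sz_add hS.szM hS.szM) (by omega)
  have hszb : ∀ l ≤ n, ∀ x, ρ.sz ((2 * c + 5) * (l + 1)) x → ρ.sz ρ.bits x := fun l hl x hx =>
    hS.sz_of_le (l := l) hx (by nlinarith) hl
  refine Runs.seq (Runs.forLoop m (fun u s' => ∀ u' < u, s'.real 9 (0 * n + u') = M + M)
    hok (by decide) (by omega) (fun s' hs' => ?_) (fun _ _ _ h => h) (by simp) ?_ ?_)
  · simp only [NExp.eval]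
    rw [hs'.nat 4 (by decide)]
    exact hH.m_eq
  · intro u hu s' hok' hs' h21 hI
    have g0 : s'.nat 0 0 = n := (congrFun (hs'.nat 0 (by decide)) 0).trans hH.n_eq
    have g5 : s'.real 5 0 = M := (congrFun (hs'.real 5 (by decide)) 0).trans hH.M_eq
    have hev : RExp.eval s' (.add (rv 5) (rv 5)) = M + M := by
      simp only [RExp.eval, NExp.eval, g5]
    have hix : (ix (.lit 0) (nv 21)).eval s' = 0 * n + u := by
      simp only [ix_eval, NExp.eval, g0, h21]
    refine Runs.setReal hok' ?_ ?_ ?_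
    · rw [hix]; exact hS.entry_lt (by omega) (by omega)
    · rw [hev]; exact hszb 0 (by omega) _ hszM
    · rw [hix, hev]
      intro u' hu'
      simp only [Mem.setReal_real, Function.update_self, Function.update_apply]
      split_ifs with h
      · rfl
      · exact hI u' (by omega)
  intro s1 _ hs1 hI1 hok1 _
  have hH1 : Holds n k m A B lam M s1 := hH.of_same hs1 (by decide) (by decide)
  have g20 : s1.nat 20 0 = v := (congrFun (hs1.nat 20 (by decide)) 0).trans h20
  have hix : (ix (.lit 0) (nv 20)).eval s1 = 0 * n + v := by
    simp only [ix_eval, NExp.eval, hH1.n_eq, g20]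
  have e0 : RExp.eval s1 (.lit 0) = 0 := by simp [RExp.eval]
  have sz0 : ∀ l, ρ.sz ((2 * c + 5) * (l + 1)) 0 := fun l => by
    have := ρ.sz_lit 0 (by omega)
    rw [Nat.cast_zero] at this
    exact ρ.sz_mono this (by nlinarith)
  refine Runs.seq (Runs.setReal hok1 (by rw [hix]; exact hS.entry_lt (by omega) (by omega))
    (by rw [e0]; exact hszb 0 (by omega) _ (sz0 0)) fun hok2 hs2 => ?_)
  rw [hix, e0] at hok2 hs2 ⊢
  set s2 := s1.setReal 9 (0 * n + v) 0 with hs2def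
  have hH2 : Holds n k m A B lam M s2 := hH1.of_same hs2 (by decide) (by decide)
  have e1 : RExp.eval s2 (.lit 1) = 1 := by simp [RExp.eval]
  refine Runs.seq (Runs.setReal hok2 ρ.space_pos ?_ fun hok3 hs3 => ?_)
  · rw [e1]
    exact hszb 0 (by omega) _ (ρ.sz_mono (by simpa using ρ.sz_lit 1 (by omega)) (by omega))
  rw [e1] at hok3 hs3 ⊢
  change ρ.Ok (s2.setReal 10 0 1) at hok3
  change Runs ρ _ (s2.setReal 10 0 1) _
  change Same _ _ (s2.setReal 10 0 1) at hs3
  set s3 := s2.setReal 10 0 1 with hs3def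
  have hH3 : Holds n k m A B lam M s3 := hH2.of_same hs3 (by decide) (by decide)
  have g8 : s3.nat 8 = s.nat 8 := hs1.nat 8 (by decide)
  have g20' : s3.nat 20 0 = v := g20
  rw [← g8] at hσ ⊢
  refine Runs.forLoop m (fun i s' => (∀ l ≤ i, s'.real 10 l = (lam * lam) ^ l) ∧
      ∀ l ≤ i, ∀ u < m, WalkBound ρ c (lam * lam) ys
        (fun x => B x (τ x) + lam * A (τ x) (s3.nat 8 (τ x))) (fun x => s3.nat 8 (τ x))
        (MatrixGame.Optimal k m A B lam ys (s3.nat 8)) l u v (s'.real 9 (l * n + u)))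
    hok3 (by decide) (by omega) (fun s' hs' => ?_) (fun _ _ _ h => h) ?_ ?_ (fun _ _ _ h => h)
  · simp only [NExp.eval]
    rw [hs'.nat 4 (by decide)]
    exact hH3.m_eq
  · refine ⟨fun l hl => ?_, fun l hl u hu => ?_⟩
    · obtain rfl : l = 0 := by omega
      simp [hs3def]
    · obtain rfl : l = 0 := by omega
      -- Row `l` is about walks of exactly `l` steps. In row `0` only `v` reaches itself, so
      -- elsewhere `upper` is vacuous.
      have hval : s3.real 9 (0 * n + u) = if u = v then 0 else M + M := by
        simp only [hs3def, hs2def, Mem.setReal_real]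
        rw [Function.update_of_ne (by omega), Function.update_self, Function.update_apply]
        split_ifs <;> first | rfl | omega | exact hI1 u hu
      rw [hval]
      split_ifs with h
      · refine ⟨sz0 0, fun _ => by simp [h], fun _ => by simp [walkCost]⟩
      · exact ⟨hszM, fun _ => hG.le_add_pow_mul hu hv 0, fun h' => absurd h' h⟩
  · rintro i hi s4 hok4 hs4 h22 ⟨hp, hW⟩
    have hH4 : Holds n k m A B lam M s4 := hH3.of_same hs4 (by decide) (by decide)
    have g8' : s4.nat 8 = s3.nat 8 := hs4.nat 8 (by decide)
    have e22 : NExp.eval s4 (.add (nv 22) (.lit 1)) = i + 1 := by simp only [NExp.eval, h22]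
    have epow : RExp.eval s4 (.mul (.mul (rv 0) (rv 0)) (.cell 10 (nv 22))) =
        (lam * lam) ^ (i + 1) := by
      simp only [RExp.eval, NExp.eval, hH4.lam_eq, h22, hp i le_rfl]
      ring
    refine Runs.seq (Runs.setReal hok4 (by rw [e22]; omega) ?_ fun hok5 hs5 => ?_)
    · rw [epow]
      exact hS.sz_of_le (l := i + 1) (hS.sz_pow (i + 1)) (by nlinarith) (by omega)
    rw [e22, epow] at hok5 hs5 ⊢
    set s5 := s4.setReal 10 (i + 1) ((lam * lam) ^ (i + 1)) with hs5def
    have hH5 : Holds n k m A B lam M s5 := hH4.of_same hs5 (by decide) (by decide)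
    have g8'' : s5.nat 8 = s3.nat 8 := g8'
    have hp5 : ∀ l ≤ i + 1, s5.real 10 l = (lam * lam) ^ l := by
      intro l hl
      simp only [hs5def, Mem.setReal_real, Function.update_self, Function.update_apply]
      split_ifs with h
      · rw [h]
      · exact hp l (by omega)
    have hW5 : ∀ l ≤ i, ∀ u < m, WalkBound ρ c (lam * lam) ys
        (fun x => B x (τ x) + lam * A (τ x) (s3.nat 8 (τ x))) (fun x => s3.nat 8 (τ x))
        (MatrixGame.Optimal k m A B lam ys (s3.nat 8)) l u v (s5.real 9 (l * n + u)) := hW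
    refine Runs.forLoop m (fun u s' => (∀ l ≤ i, ∀ u < m, s'.real 9 (l * n + u) =
          s5.real 9 (l * n + u)) ∧
        ∀ u' < u, WalkBound ρ c (lam * lam) ys
          (fun x => B x (τ x) + lam * A (τ x) (s3.nat 8 (τ x))) (fun x => s3.nat 8 (τ x))
          (MatrixGame.Optimal k m A B lam ys (s3.nat 8)) (i + 1) u' v
          (s'.real 9 ((i + 1) * n + u')))
      hok5 (by decide) (by omega) (fun s' hs' => ?_) (fun _ _ _ h => h)
      ⟨fun _ _ _ _ => rfl, by simp⟩ ?_ ?_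
    · simp only [NExp.eval]
      rw [hs'.nat 4 (by decide)]
      exact hH5.m_eq
    · rintro u hu s6 hok6 hs6 h21 ⟨hfr, hN⟩
      have g8 : s6.nat 8 = s3.nat 8 := (hs6.nat 8 (by decide)).trans g8''
      have hr := replies_runs hS hG hok6 (hH5.of_same hs6 (by decide) (by decide))
        (by rwa [g8]) hτ (l := i) (u := u) (v := v)
        ((congrFun (hs6.nat 22 (by decide)) 0).trans h22) h21 hi hu hv
        (fun u' hu' => by rw [g8, hfr i le_rfl u' hu']; exact hW5 i le_rfl u' hu')
      rw [g8] at hr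
      refine hr.imp ?_
      rintro s7 _ _ ⟨hf7, hW7⟩
      refine ⟨fun l hl u' hu' => ?_, fun u' hu' => ?_⟩
      · have hne : l * n + u' ≠ (i + 1) * n + u := fun h => by
          have := (mul_add_inj (by omega) (by omega) h).1
          omega
        rw [hf7 _ hne]
        exact hfr l hl u' hu'
      · rcases Nat.lt_succ_iff_lt_or_eq.1 hu' with h | rfl
        · rw [hf7 _ (by omega)]
          exact hN u' h
        · exact hW7
    · rintro s6 _ hs6 ⟨hfr, hN⟩
      refine ⟨?_, fun l hl u hu => ?_⟩
      · rw [hs6.real 10 (by decide)]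
        exact hp5
      · rcases Nat.le_succ_iff.1 hl with h | rfl
        · rw [hfr l h u hu]
          exact hW5 l h u hu
        · exact hN u hu

variable {xs ys : ℕ → ℝ}

/-- Repeating a closed walk of cost `z` and length `q + 1` forever sums a geometric series to `z /
(1 - (lam * lam) ^ (q + 1))`. The lower bound follows by solving `ys v ≤ z + (lam * lam) ^ (q + 1) *
ys v`. -/
theorem cycles_runs (hS : Setting ρ n k m A B lam M c) (hG : MatrixGame k m A B lam M xs ys)
    {s : Mem} (hok : ρ.Ok s) (hH : Holds n k m A B lam M s) {v : ℕ} (h20 : s.nat 20 0 = v)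
    (hv : v < m) {cost : ℕ → ℝ} {nx : ℕ → ℕ} {O : Prop}
    (hp : ∀ l ≤ m, s.real 10 l = (lam * lam) ^ l)
    (hW : ∀ l ≤ m, ∀ u < m, WalkBound ρ c (lam * lam) ys cost nx O l u v (s.real 9 (l * n + u))) :
    Runs ρ cycles s fun s' => ρ.sz (2 * ((2 * c + 5) * (m + 1))) (s'.real 11 0) ∧
      (O → ys v ≤ s'.real 11 0) ∧
      ∀ q < m, nx^[q + 1] v = v →
        s'.real 11 0 ≤ walkCost (lam * lam) cost nx (q + 1) v / (1 - (lam * lam) ^ (q + 1)) := by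
  have hkm := hS.add_eq
  have hrounds := hS.rounds
  have hspace := hS.space
  have hszb : ∀ x, ρ.sz (2 * ((2 * c + 5) * (m + 1))) x → ρ.sz ρ.bits x := fun x hx =>
    hS.sz_of_le (l := m) hx (by omega) (by omega)
  have hszM : ρ.sz (2 * ((2 * c + 5) * (m + 1))) M := ρ.sz_mono hS.szM (by nlinarith)
  have eM : RExp.eval s (rv 5) = M := hH.M_eq
  have hden : ∀ q, 0 < 1 - (lam * lam) ^ (q + 1) := fun q => by
    have := pow_lt_one₀ hG.mul_pos.le hG.mul_lt_one (show q + 1 ≠ 0 by omega)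
    linarith
  refine Runs.seq (Runs.setReal hok ρ.space_pos (by rw [eM]; exact hszb _ hszM) fun hok1 _ => ?_)
  rw [eM] at hok1 ⊢
  change ρ.Ok (s.setReal 11 0 M) at hok1
  change Runs ρ _ (s.setReal 11 0 M) _
  set s1 := s.setReal 11 0 M with hs1
  refine Runs.forLoop m (fun i s' => ρ.sz (2 * ((2 * c + 5) * (m + 1))) (s'.real 11 0) ∧
      (O → ys v ≤ s'.real 11 0) ∧
      ∀ q < i, nx^[q + 1] v = v →
        s'.real 11 0 ≤ walkCost (lam * lam) cost nx (q + 1) v / (1 - (lam * lam) ^ (q + 1)))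
    hok1 (by decide) (by omega) (fun s' hs' => ?_) (fun _ _ _ h => h) ?_ ?_ (fun _ _ _ h => h)
  · simp only [NExp.eval]
    rw [hs'.nat 4 (by decide)]
    exact hH.m_eq
  · have : s1.real 11 0 = M := by simp [hs1]
    rw [this]
    exact ⟨hszM, fun _ => (abs_le.1 (hG.abs_min v hv)).2, by simp⟩
  · rintro q hq s' hok' hs' h22 ⟨hz, hlow, hup⟩
    have g0 : s'.nat 0 0 = n := (congrFun (hs'.nat 0 (by decide)) 0).trans hH.n_eq
    have g20 : s'.nat 20 0 = v := (congrFun (hs'.nat 20 (by decide)) 0).trans h20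
    have g9 : s'.real 9 = s.real 9 := hs'.real 9 (by decide)
    have g10 : s'.real 10 = s.real 10 := hs'.real 10 (by decide)
    have hWq := hW (q + 1) hq v hv
    have ecand : cycleExp.eval s' =
        s.real 9 ((q + 1) * n + v) / (1 - (lam * lam) ^ (q + 1)) := by
      simp only [cycleExp, RExp.eval, NExp.eval, ix_eval, g0, g20, h22, g9, g10, hp (q + 1) hq,
        Nat.cast_one]
    have ecell : RExp.eval s' (rv 11) = s'.real 11 0 := rfl
    have hcup : nx^[q + 1] v = v → cycleExp.eval s' ≤
        walkCost (lam * lam) cost nx (q + 1) v / (1 - (lam * lam) ^ (q + 1)) := fun h => by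
      rw [ecand]
      exact div_le_div_of_nonneg_right (hWq.upper h) (hden q).le
    refine Runs.branch (fun hle => ?_) (fun hlt => ?_)
    · simp only [Test.holds] at hle
      rw [ecell] at hle
      refine Runs.nop hok' ⟨hz, hlow, fun q' hq' hit => ?_⟩
      rcases Nat.lt_succ_iff_lt_or_eq.1 hq' with h | rfl
      · exact hup q' h hit
      · exact hle.trans (hcup hit)
    · simp only [Test.holds] at hlt
      rw [ecell, not_le] at hlt
      have hnz : ρ.sz (2 * ((2 * c + 5) * (m + 1))) (cycleExp.eval s') := by
        rw [ecand]
        have h1 : ρ.sz 1 (1 : ℝ) := by simpa using ρ.sz_lit 1 (by omega)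
        refine ρ.sz_mono (ρ.sz_div hWq.size (ρ.sz_sub h1 (hS.sz_pow (q + 1)))) ?_
        nlinarith
      refine Runs.setReal hok' ρ.space_pos (hszb _ hnz) ?_
      have r11 : (s'.setReal 11 ((NExp.lit 0).eval s') (cycleExp.eval s')).real 11 0 =
          cycleExp.eval s' := by simp [NExp.eval]
      rw [r11]
      refine ⟨hnz, fun hO => ?_, fun q' hq' hit => ?_⟩
      · rw [ecand, le_div_iff₀ (hden q)]
        linarith [hWq.lower hO]
      · rcases Nat.lt_succ_iff_lt_or_eq.1 hq' with h | rfl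
        · exact hlt.le.trans (hup q' h hit)
        · exact hcup hit

/-- Candidates combine a walk to `v` of length below `m` with the best closed walk there. The stored
values never increase, so bounds obtained for earlier `v` survive. -/
theorem lassos_runs (hS : Setting ρ n k m A B lam M c) (hG : MatrixGame k m A B lam M xs ys)
    {s : Mem} (hok : ρ.Ok s) (hH : Holds n k m A B lam M s) {v : ℕ} {cost : ℕ → ℝ} {nx : ℕ → ℕ}
    {O : Prop} (hp : ∀ l ≤ m, s.real 10 l = (lam * lam) ^ l)
    (hW : ∀ l ≤ m, ∀ u < m, WalkBound ρ c (lam * lam) ys cost nx O l u v (s.real 9 (l * n + u)))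
    (hz : ρ.sz (2 * ((2 * c + 5) * (m + 1))) (s.real 11 0)) (hO : O → ys v ≤ s.real 11 0)
    (hy : ∀ u < m, ρ.sz (4 * ((2 * c + 5) * (m + 1))) (s.real 8 u) ∧ (O → ys u ≤ s.real 8 u)) :
    Runs ρ (forLoop 22 (nv 4) (forLoop 21 (nv 4) lasso)) s fun s' => ∀ u < m,
      ρ.sz (4 * ((2 * c + 5) * (m + 1))) (s'.real 8 u) ∧ (O → ys u ≤ s'.real 8 u) ∧
      s'.real 8 u ≤ s.real 8 u ∧
      ∀ l < m, s'.real 8 u ≤ s.real 9 (l * n + u) + (lam * lam) ^ l * s.real 11 0 := by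
  have hkm := hS.add_eq
  have hrounds := hS.rounds
  have hspace := hS.space
  have hszb : ∀ x, ρ.sz (4 * ((2 * c + 5) * (m + 1))) x → ρ.sz ρ.bits x := fun x hx =>
    hS.sz_of_le (l := m) hx (by omega) (by omega)
  refine Runs.forLoop m (fun i s' => ∀ u < m,
      ρ.sz (4 * ((2 * c + 5) * (m + 1))) (s'.real 8 u) ∧ (O → ys u ≤ s'.real 8 u) ∧
      s'.real 8 u ≤ s.real 8 u ∧
      ∀ l < i, s'.real 8 u ≤ s.real 9 (l * n + u) + (lam * lam) ^ l * s.real 11 0)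
    hok (by decide) (by omega) (fun s' hs' => ?_) (fun _ _ _ h => h) ?_ ?_ (fun _ _ _ h => h)
  · simp only [NExp.eval]
    rw [hs'.nat 4 (by decide)]
    exact hH.m_eq
  · exact fun u hu => ⟨(hy u hu).1, (hy u hu).2, le_rfl, by simp⟩
  intro l hl s1 hok1 hs1 h22 hI
  have hH1 : Holds n k m A B lam M s1 := hH.of_same hs1 (by decide) (by decide)
  refine Runs.forLoop m (fun u s' => (∀ u < m,
      ρ.sz (4 * ((2 * c + 5) * (m + 1))) (s'.real 8 u) ∧ (O → ys u ≤ s'.real 8 u) ∧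
      s'.real 8 u ≤ s.real 8 u ∧
      ∀ l' < l, s'.real 8 u ≤ s.real 9 (l' * n + u) + (lam * lam) ^ l' * s.real 11 0) ∧
      ∀ u' < u, s'.real 8 u' ≤ s.real 9 (l * n + u') + (lam * lam) ^ l * s.real 11 0)
    hok1 (by decide) (by omega) (fun s' hs' => ?_) (fun _ _ _ h => h) ⟨hI, by simp⟩ ?_ ?_
  · simp only [NExp.eval]
    rw [hs'.nat 4 (by decide)]
    exact hH1.m_eq
  · rintro u hu s2 hok2 hs2 h21 ⟨hJ, hN⟩
    have g0 : s2.nat 0 0 = n := (congrFun (hs2.nat 0 (by decide)) 0).trans hH1.n_eq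
    have g22 : s2.nat 22 0 = l := (congrFun (hs2.nat 22 (by decide)) 0).trans h22
    have g9 : s2.real 9 = s.real 9 := (hs2.real 9 (by decide)).trans (hs1.real 9 (by decide))
    have g10 : s2.real 10 = s.real 10 := (hs2.real 10 (by decide)).trans (hs1.real 10 (by decide))
    have g11 : s2.real 11 = s.real 11 := (hs2.real 11 (by decide)).trans (hs1.real 11 (by decide))
    have ecand : lassoExp.eval s2 = s.real 9 (l * n + u) + (lam * lam) ^ l * s.real 11 0 := by
      simp only [lassoExp, RExp.eval, NExp.eval, ix_eval, g0, h21, g22, g9, g10, g11, hp l hl.le]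
    have ecell : RExp.eval s2 (.cell 8 (nv 21)) = s2.real 8 u := by
      simp only [RExp.eval, NExp.eval, h21]
    have e21 : (nv 21).eval s2 = u := h21
    refine Runs.branch (fun hle => ?_) (fun hlt => ?_)
    · simp only [Test.holds] at hle
      rw [ecand, ecell] at hle
      refine Runs.nop hok2 ⟨hJ, fun u' hu' => ?_⟩
      rcases Nat.lt_succ_iff_lt_or_eq.1 hu' with h | rfl
      · exact hN u' h
      · exact hle
    · simp only [Test.holds] at hlt
      rw [ecand, ecell, not_le] at hlt
      have hnz : ρ.sz (4 * ((2 * c + 5) * (m + 1)))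
          (s.real 9 (l * n + u) + (lam * lam) ^ l * s.real 11 0) := by
        refine ρ.sz_mono (ρ.sz_add (hW l hl.le u hu).size (ρ.sz_mul (hS.sz_pow l) hz)) ?_
        nlinarith
      refine Runs.setReal hok2 (by rw [e21]; omega) (by rw [ecand]; exact hszb _ hnz) ?_
      rw [e21, ecand]
      simp only [Mem.setReal_real, Function.update_self]
      refine ⟨fun u' hu' => ?_, fun u' hu' => ?_⟩
      · obtain ⟨j1, j2, j3, j4⟩ := hJ u' hu'
        rw [Function.update_apply]
        split_ifs with h
        · subst h
          refine ⟨hnz, fun hO' => ?_, hlt.le.trans j3, fun l' hl' => hlt.le.trans (j4 l' hl')⟩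
          refine ((hW l hl.le u' hu').lower hO').trans ?_
          have := mul_le_mul_of_nonneg_left (hO hO') (pow_pos hG.mul_pos l).le
          linarith
        · exact ⟨j1, j2, j3, j4⟩
      · rw [Function.update_apply]
        split_ifs with h
        · rw [h]
        · exact hN u' (by omega)
  · rintro s2 _ _ ⟨hJ, hN⟩ u hu
    obtain ⟨j1, j2, j3, j4⟩ := hJ u hu
    refine ⟨j1, j2, j3, fun l' hl' => ?_⟩
    rcases Nat.lt_succ_iff_lt_or_eq.1 hl' with h | rfl
    · exact j4 l' h
    · exact hN u hu

/-- The reply `τ` occurs only in the proof. As every `v`, every tail and every period is tried, the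
lasso traced by `τ` is matched by some candidate, and `MatrixGame.le_value` bounds the minimum by
`ys`. -/
theorem evaluate_runs (hS : Setting ρ n k m A B lam M c) (hG : MatrixGame k m A B lam M xs ys)
    {s : Mem} (hok : ρ.Ok s) (hH : Holds n k m A B lam M s) (hσ : ∀ a < k, s.nat 8 a < m) :
    Runs ρ evaluate s fun s' => ∀ u < m, ρ.sz (4 * ((2 * c + 5) * (m + 1))) (s'.real 8 u) ∧
      (MatrixGame.Optimal k m A B lam ys (s.nat 8) → ys u ≤ s'.real 8 u) ∧ s'.real 8 u ≤ ys u := by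
  have hkm := hS.add_eq
  have hrounds := hS.rounds
  have hspace := hS.space
  have hszM : ρ.sz (4 * ((2 * c + 5) * (m + 1))) M := ρ.sz_mono hS.szM (by nlinarith)
  obtain ⟨τ, hτ, hτσ⟩ := hG.exists_reply hσ
  set O := MatrixGame.Optimal k m A B lam ys (s.nat 8) with hOdef
  set cost : ℕ → ℝ := fun x => B x (τ x) + lam * A (τ x) (s.nat 8 (τ x)) with hcost
  set nx : ℕ → ℕ := fun x => s.nat 8 (τ x) with hnx
  refine Runs.seq (Runs.forLoop m (fun u s' => ∀ u' < u, s'.real 8 u' = M)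
    hok (by decide) (by omega) (fun s' hs' => ?_) (fun _ _ _ h => h) (by simp) ?_ ?_)
  · simp only [NExp.eval]
    rw [hs'.nat 4 (by decide)]
    exact hH.m_eq
  · intro u hu s' hok' hs' h21 hI
    have g5 : RExp.eval s' (rv 5) = M := (congrFun (hs'.real 5 (by decide)) 0).trans hH.M_eq
    have e21 : (nv 21).eval s' = u := h21
    refine Runs.setReal hok' (by rw [e21]; omega) ?_ ?_
    · rw [g5]; exact hS.sz_of_le (l := m) hszM (by omega) (by omega)
    · rw [e21, g5]
      intro u' hu'
      simp only [Mem.setReal_real, Function.update_self, Function.update_apply]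
      split_ifs with h
      · rfl
      · exact hI u' (by omega)
  intro s1 _ hs1 hI1 hok1 _
  have hH1 : Holds n k m A B lam M s1 := hH.of_same hs1 (by decide) (by decide)
  have g8 : s1.nat 8 = s.nat 8 := hs1.nat 8 (by decide)
  refine Runs.forLoop m (fun i s' => ∀ u < m, (ρ.sz (4 * ((2 * c + 5) * (m + 1))) (s'.real 8 u) ∧
      (O → ys u ≤ s'.real 8 u)) ∧ ∀ v < i, ∀ l < m, nx^[l] u = v → ∀ q < m, nx^[q + 1] v = v →
      s'.real 8 u ≤ walkCost (lam * lam) cost nx l u + (lam * lam) ^ l *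
        (walkCost (lam * lam) cost nx (q + 1) v / (1 - (lam * lam) ^ (q + 1))))
    hok1 (by decide) (by omega) (fun s' hs' => ?_) (fun _ _ _ h => h) ?_ ?_ ?_
  · simp only [NExp.eval]
    rw [hs'.nat 4 (by decide)]
    exact hH1.m_eq
  · intro u hu
    rw [hI1 u hu]
    exact ⟨⟨hszM, fun _ => (abs_le.1 (hG.abs_min u hu)).2⟩, by simp⟩
  · intro v hv s2 hok2 hs2 h20 hI
    have hH2 : Holds n k m A B lam M s2 := hH1.of_same hs2 (by decide) (by decide)
    have g8' : s2.nat 8 = s.nat 8 := (hs2.nat 8 (by decide)).trans g8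
    have hw := walks_runs hS hG hok2 hH2 (by rwa [g8']) hτ h20 hv
    rw [g8'] at hw
    refine Runs.seq (hw.imp ?_)
    rintro s3 hok3 hs3 ⟨hp3, hW3⟩ - -
    have hH3 : Holds n k m A B lam M s3 := hH2.of_same hs3 (by decide) (by decide)
    refine Runs.seq ((cycles_runs hS hG hok3 hH3
      ((congrFun (hs3.nat 20 (by decide)) 0).trans h20) hv hp3 hW3).imp ?_)
    rintro s4 hok4 hs4 ⟨hz4, hO4, hup4⟩ - -
    have hH4 : Holds n k m A B lam M s4 := hH3.of_same hs4 (by decide) (by decide)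
    have g9 : s4.real 9 = s3.real 9 := hs4.real 9 (by decide)
    have g10 : s4.real 10 = s3.real 10 := hs4.real 10 (by decide)
    have gy : s4.real 8 = s2.real 8 := (hs4.real 8 (by decide)).trans (hs3.real 8 (by decide))
    refine (lassos_runs hS hG hok4 hH4 (by rwa [g10]) (by rwa [g9]) hz4 hO4
      (fun u hu => by rw [gy]; exact (hI u hu).1)).imp ?_
    intro s5 _ _ h5 u hu
    obtain ⟨y1, y2, y3, y4⟩ := h5 u hu
    refine ⟨⟨y1, y2⟩, fun v' hv' l hl hit q hq hcyc => ?_⟩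
    rcases Nat.lt_succ_iff_lt_or_eq.1 hv' with h | rfl
    · rw [gy] at y3
      exact y3.trans ((hI u hu).2 v' h l hl hit q hq hcyc)
    · refine (y4 l hl).trans ?_
      have h1 := mul_le_mul_of_nonneg_left (hup4 q hq hcyc) (pow_pos hG.mul_pos l).le
      have h2 := (hW3 l hl.le u hu).upper hit
      rw [g9]
      exact add_le_add h2 h1
  · intro s2 _ _ hI u hu
    exact ⟨(hI u hu).1.1, (hI u hu).1.2, hG.le_value hσ hτ hτσ hu (hI u hu).2⟩

/-! ### Verification of the search through all in-degrees -/

theorem keepBest_runs (hS : Setting ρ n k m A B lam M c) {s : Mem} (hok : ρ.Ok s)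
    (hH : Holds n k m A B lam M s)
    (hsz : ∀ u < m, ρ.sz (4 * ((2 * c + 5) * (m + 1))) (s.real 8 u)) :
    Runs ρ keepBest s fun s' => ∀ u < m, s'.real 7 u = max (s.real 7 u) (s.real 8 u) := by
  have hkm := hS.add_eq
  have hrounds := hS.rounds
  have hspace := hS.space
  refine Runs.forLoop m (fun i s' => (∀ u < i, s'.real 7 u = max (s.real 7 u) (s.real 8 u)) ∧
      ∀ u, i ≤ u → s'.real 7 u = s.real 7 u)
    hok (by decide) (by omega) (fun s' hs' => ?_) (fun _ _ _ h => h) ⟨by simp, fun _ _ => rfl⟩ ?_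
    (fun _ _ _ h => h.1)
  · simp only [NExp.eval]
    rw [hs'.nat 4 (by decide)]
    exact hH.m_eq
  · rintro u hu s' hok' hs' h21 ⟨hI, hJ⟩
    have g8 : s'.real 8 = s.real 8 := hs'.real 8 (by decide)
    have e8 : RExp.eval s' (.cell 8 (nv 21)) = s.real 8 u := by
      simp only [RExp.eval, NExp.eval, h21, g8]
    have e7 : RExp.eval s' (.cell 7 (nv 21)) = s.real 7 u := by
      simp only [RExp.eval, NExp.eval, h21, hJ u le_rfl]
    have e21 : (nv 21).eval s' = u := h21
    refine Runs.branch (fun hle => ?_) (fun hlt => ?_)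
    · simp only [Test.holds] at hle
      rw [e7, e8] at hle
      refine Runs.nop hok' ⟨fun u' hu' => ?_, fun u' hu' => hJ u' (by omega)⟩
      rcases Nat.lt_succ_iff_lt_or_eq.1 hu' with h | rfl
      · exact hI u' h
      · rw [hJ u' le_rfl, max_eq_left hle]
    · simp only [Test.holds] at hlt
      rw [e7, e8, not_le] at hlt
      refine Runs.setReal hok' (by rw [e21]; omega) ?_ ?_
      · rw [e8]
        exact hS.sz_of_le (l := m) (hsz u hu) (by omega) (by omega)
      · rw [e21, e8]
        simp only [Mem.setReal_real, Function.update_self]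
        refine ⟨fun u' hu' => ?_, fun u' hu' => ?_⟩
        · rw [Function.update_apply]
          split_ifs with h
          · rw [h, max_eq_right hlt.le]
          · exact hI u' (by omega)
        · rw [Function.update_of_ne (by omega)]
          exact hJ u' (by omega)

theorem bit_lt (b i : ℕ) : bit b i < 2 := Nat.mod_lt _ (by omega)

/-- Adding the carry `(b + 1) / 2 ^ i - b / 2 ^ i` to a bit. -/
theorem bit_add_carry (b i : ℕ) :
    (b + 1) / 2 ^ i - b / 2 ^ i ≤ 1 ∧
    bit b i * ((b + 1) / 2 ^ i - b / 2 ^ i) = (b + 1) / 2 ^ (i + 1) - b / 2 ^ (i + 1) ∧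
    bit b i + ((b + 1) / 2 ^ i - b / 2 ^ i) -
      2 * ((b + 1) / 2 ^ (i + 1) - b / 2 ^ (i + 1)) = bit (b + 1) i := by
  have h1 : b / 2 ^ i ≤ (b + 1) / 2 ^ i := Nat.div_le_div_right (Nat.le_succ b)
  have h2 : (b + 1) / 2 ^ i ≤ b / 2 ^ i + 1 := by
    rw [Nat.succ_div]
    split_ifs <;> omega
  rw [pow_succ, ← Nat.div_div_eq_div_mul, ← Nat.div_div_eq_div_mul, bit, bit]
  obtain h | h : (b + 1) / 2 ^ i = b / 2 ^ i ∨ (b + 1) / 2 ^ i = b / 2 ^ i + 1 := by omega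
  · rw [h]
    simp
  · rw [h]
    rcases Nat.mod_two_eq_zero_or_one (b / 2 ^ i) with h0 | h0 <;> rw [h0] <;> omega

/-- The carry into place `i` is `(b + 1) / 2 ^ i - b / 2 ^ i`. The one leaving the top place is
nonzero exactly when all strings have been tried, so it serves as the exit flag of the outer loop.
-/
theorem increment_runs (hS : Setting ρ n k m A B lam M c) {s : Mem} (hok : ρ.Ok s)
    (hH : Holds n k m A B lam M s) {b : ℕ} (hb : b < 2 ^ n) (h7 : ∀ i < n, s.nat 7 i = bit b i) :
    Runs ρ increment s fun s' => (∀ i < n, s'.nat 7 i = bit (b + 1) i) ∧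
      (s'.nat 10 0 ≤ 0 ↔ b + 1 < 2 ^ n) := by
  have hkm := hS.add_eq
  have hrounds := hS.rounds
  have hspace := hS.space
  refine Runs.seq (Runs.setNat hok ρ.space_pos (by simp only [NExp.eval]; omega) fun hok1 _ => ?_)
  change ρ.Ok (s.setNat 10 0 1) at hok1
  change Runs ρ _ (s.setNat 10 0 1) _
  refine Runs.forLoop n (fun i s' => (∀ r < i, s'.nat 7 r = bit (b + 1) r) ∧
      (∀ r, i ≤ r → r < n → s'.nat 7 r = bit b r) ∧
      s'.nat 10 0 = (b + 1) / 2 ^ i - b / 2 ^ i)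
    hok1 (by decide) (by omega) (fun s' hs' => ?_) (fun _ _ _ h => h)
    ⟨by simp, fun r _ hr => h7 r hr, by simp⟩ ?_ ?_
  · simp only [NExp.eval]
    rw [hs'.nat 0 (by decide)]
    exact hH.n_eq
  · rintro i hi s' hok' hs' h20 ⟨hI, hJ, h10⟩
    obtain ⟨c1, c2, c3⟩ := bit_add_carry b i
    have hbl := bit_lt b i
    have hbl' := bit_lt (b + 1) i
    have h7i := hJ i le_rfl hi
    set cy := (b + 1) / 2 ^ (i + 1) - b / 2 ^ (i + 1)
    have hcy : cy ≤ 1 := (bit_add_carry b (i + 1)).1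
    have e1 : NExp.eval s' (.mul (.cell 7 (nv 20)) (nv 10)) = cy := by
      simp only [NExp.eval, h20, h7i, h10, c2]
    refine Runs.seq (Runs.setNat hok' ρ.space_pos (by rw [e1]; omega) fun hok2 _ => ?_)
    rw [e1] at hok2 ⊢
    change ρ.Ok (s'.setNat 14 0 cy) at hok2
    change Runs ρ _ (s'.setNat 14 0 cy) _
    set s2 := s'.setNat 14 0 cy with hs2
    have e20 : (nv 20).eval s2 = i := h20
    have e2 : NExp.eval s2 (.sub (.add (.cell 7 (nv 20)) (nv 10)) (.mul (.lit 2) (nv 14))) =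
        bit (b + 1) i := by
      have g20 : s2.nat 20 0 = i := h20
      have g7 : s2.nat 7 i = bit b i := h7i
      have g10 : s2.nat 10 0 = (b + 1) / 2 ^ i - b / 2 ^ i := h10
      have g14 : s2.nat 14 0 = cy := by simp [hs2]
      simp only [NExp.eval, g20, g7, g10, g14, c3]
    refine Runs.seq (Runs.setNat hok2 (by rw [e20]; omega) (by rw [e2]; omega) fun hok3 _ => ?_)
    rw [e20, e2] at hok3 ⊢
    have e3 : NExp.eval (s2.setNat 7 i (bit (b + 1) i)) (nv 14) = cy := by
      simp [NExp.eval, hs2]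
    refine Runs.setNat hok3 ρ.space_pos (by rw [e3]; omega) ?_
    rw [e3]
    have r7 : ((s2.setNat 7 i (bit (b + 1) i)).setNat 10 0 cy).nat 7 =
        Function.update (s'.nat 7) i (bit (b + 1) i) := by simp [hs2]
    have r10 : ((s2.setNat 7 i (bit (b + 1) i)).setNat 10 0 cy).nat 10 0 = cy := by simp
    change (∀ r < i + 1, ((s2.setNat 7 i (bit (b + 1) i)).setNat 10 0 cy).nat 7 r = _) ∧
      (∀ r, i + 1 ≤ r → r < n → ((s2.setNat 7 i (bit (b + 1) i)).setNat 10 0 cy).nat 7 r = _) ∧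
      ((s2.setNat 7 i (bit (b + 1) i)).setNat 10 0 cy).nat 10 0 = _
    rw [r7, r10]
    refine ⟨fun r hr => ?_, fun r hr hrn => ?_, rfl⟩
    · rw [Function.update_apply]
      split_ifs with h
      · rw [h]
      · exact hI r (by omega)
    · rw [Function.update_of_ne (by omega)]
      exact hJ r (by omega) hrn
  · rintro s' _ _ ⟨hI, -, h10⟩
    refine ⟨hI, ?_⟩
    rw [h10, Nat.div_eq_of_lt hb]
    constructor
    · intro h
      by_contra hge
      rw [show b + 1 = 2 ^ n by omega, Nat.div_self (by positivity)] at h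
      omega
    · intro h
      rw [Nat.div_eq_of_lt h]

/-- Every round keeps the stored values at most `ys`. In a round whose string describes the
in-degrees of a greedy optimal `σ`, the strategy found is optimal although it may differ from `σ`,
and the values reach `ys`. -/
theorem round_runs (hS : Setting ρ n k m A B lam M c) (hG : MatrixGame k m A B lam M xs ys)
    {s : Mem} (hok : ρ.Ok s) (hH : Holds n k m A B lam M s) (hσ : ∀ a < k, s.nat 8 a < m) {b : ℕ}
    (hb : b < 2 ^ n) (h7 : ∀ i < n, s.nat 7 i = bit b i) (hY : ∀ u < m, s.real 7 u ≤ ys u)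
    (hsz : ∀ u < m, ρ.sz (4 * ((2 * c + 5) * (m + 1))) (s.real 7 u)) :
    Runs ρ round s fun s' => Holds n k m A B lam M s' ∧ (∀ a < k, s'.nat 8 a < m) ∧
      (∀ i < n, s'.nat 7 i = bit (b + 1) i) ∧ (s'.nat 10 0 ≤ 0 ↔ b + 1 < 2 ^ n) ∧
      ∀ u < m, s.real 7 u ≤ s'.real 7 u ∧
        ρ.sz (4 * ((2 * c + 5) * (m + 1))) (s'.real 7 u) ∧ s'.real 7 u ≤ ys u ∧
        ∀ σ, (∀ a < k, σ a < m) → (∀ a < k, xs a = A a (σ a) + lam * ys (σ a)) →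
          Greedy A m k σ (fun j => lam * ys j) → Describes k m σ (bit b) → ys u ≤ s'.real 7 u := by
  refine Runs.seq ((findStrategy_runs hS hok hH (fun i hi => by rw [h7 i hi]; exact bit_lt b i)
    hσ).imp ?_)
  rintro s1 hok1 hs1 ⟨hσ1, hD1⟩ - -
  have hH1 : Holds n k m A B lam M s1 := hH.of_same hs1 (by decide) (by decide)
  refine Runs.seq ((evaluate_runs hS hG hok1 hH1 hσ1).imp ?_)
  rintro s2 hok2 hs2 hy - -
  have hH2 : Holds n k m A B lam M s2 := hH1.of_same hs2 (by decide) (by decide)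
  refine Runs.seq ((keepBest_runs hS hok2 hH2 fun u hu => (hy u hu).1).imp ?_)
  rintro s3 hok3 hs3 hY3 - -
  have hH3 : Holds n k m A B lam M s3 := hH2.of_same hs3 (by decide) (by decide)
  have g7 : s3.nat 7 = s.nat 7 := (hs3.nat 7 (by decide)).trans
    ((hs2.nat 7 (by decide)).trans (hs1.nat 7 (by decide)))
  have gY : s2.real 7 = s.real 7 := (hs2.real 7 (by decide)).trans (hs1.real 7 (by decide))
  refine (increment_runs hS hok3 hH3 hb (by rwa [g7])).imp ?_
  rintro s4 _ hs4 ⟨h7', h10⟩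
  refine ⟨hH3.of_same hs4 (by decide) (by decide), ?_, h7', h10, fun u hu => ?_⟩
  · rw [hs4.nat 8 (by decide), hs3.nat 8 (by decide), hs2.nat 8 (by decide)]
    exact hσ1
  · rw [hs4.real 7 (by decide), hY3 u hu, gY]
    refine ⟨le_max_left _ _, ?_, max_le (hY u hu) (hy u hu).2.2, fun σ hσ' hxs hgr hdes => ?_⟩
    · rcases max_choice (s.real 7 u) (s2.real 8 u) with h | h <;> rw [h]
      · exact hsz u hu
      · exact (hy u hu).1
    obtain ⟨⟨p, hp⟩, hsum⟩ := hD1 σ (hdes.congr fun i hi => h7 i (by rw [← hS.add_eq]; exact hi))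
    exact ((hy u hu).2.1 (hG.optimal_of_sum_eq hp hσ1 hσ' hxs hgr hsum)).trans (le_max_right _ _)

/-- The main loop finds the values of Min's nodes after at most `2 ^ n` rounds. -/
theorem exists_exec_rounds (hS : Setting ρ n k m A B lam M c)
    (hG : MatrixGame k m A B lam M xs ys) {s : Mem} (hok : ρ.Ok s) (hH : Holds n k m A B lam M s)
    (hσ : ∀ a < k, s.nat 8 a < m) (h7 : ∀ i < n, s.nat 7 i = 0) (h10 : s.nat 10 0 = 0)
    (hY : ∀ u < m, s.real 7 u ≤ ys u)
    (hsz : ∀ u < m, ρ.sz (4 * ((2 * c + 5) * (m + 1))) (s.real 7 u)) :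
    ∃ t s', Exec ρ.Ok (.loop (.natLe (nv 10) (.lit 0)) round) s t s' ∧
      t ≤ 2 ^ n * ((Test.natLe (nv 10) (.lit 0)).cost + round.time ρ.rounds) +
        (Test.natLe (nv 10) (.lit 0)).cost ∧
      Same round s s' ∧ ∀ u < m, s'.real 7 u = ys u ∧
        ρ.sz (4 * ((2 * c + 5) * (m + 1))) (ys u) := by
  obtain ⟨t, s', he, ht, -, -, -, -, hI⟩ := exists_exec_loop (ρ := ρ)
    (b := .natLe (nv 10) (.lit 0)) (p := round)
    (fun b s' => Holds n k m A B lam M s' ∧ (∀ a < k, s'.nat 8 a < m) ∧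
      (∀ i < n, s'.nat 7 i = bit b i) ∧ (s'.nat 10 0 ≤ 0 ↔ b < 2 ^ n) ∧
      ∀ u < m, (ρ.sz (4 * ((2 * c + 5) * (m + 1))) (s'.real 7 u) ∧ s'.real 7 u ≤ ys u) ∧
        ∀ b' < b, ∀ σ, (∀ a < k, σ a < m) → (∀ a < k, xs a = A a (σ a) + lam * ys (σ a)) →
          Greedy A m k σ (fun j => lam * ys j) → Describes k m σ (bit b') → ys u ≤ s'.real 7 u)
    (2 ^ n) (fun b s' h => h.2.2.2.1)
    (by
      rintro b hb s' hok' ⟨i1, i2, i3, -, i5⟩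
      refine (round_runs hS hG hok' i1 i2 hb i3 (fun u hu => (i5 u hu).1.2)
        fun u hu => (i5 u hu).1.1).imp ?_
      rintro s'' _ _ ⟨j1, j2, j3, j4, j5⟩
      refine ⟨j1, j2, j3, j4, fun u hu =>
        ⟨⟨(j5 u hu).2.1, (j5 u hu).2.2.1⟩, fun b' hb' σ h1 h2 h3 h4 => ?_⟩⟩
      rcases Nat.lt_succ_iff_lt_or_eq.1 hb' with h | rfl
      · exact ((i5 u hu).2 b' h σ h1 h2 h3 h4).trans (j5 u hu).1
      · exact (j5 u hu).2.2.2 σ h1 h2 h3 h4)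
    hok ⟨hH, hσ, fun i hi => by rw [h7 i hi]; simp [bit], by simp [h10],
      fun u hu => ⟨⟨hsz u hu, hY u hu⟩, by simp⟩⟩
  -- Some optimal strategy is greedy, its in-degrees have a bit string, and that string is the
  -- binary expansion of a counter value already visited.
  have heq : ∀ u < m, s'.real 7 u = ys u := by
    intro u hu
    refine le_antisymm (hI u hu).1.2 ?_
    obtain ⟨σ, h1, h2, h3⟩ := hG.exists_greedy
    obtain ⟨β, hβ, hdes⟩ := exists_describes h1
    obtain ⟨b, hb, hbit⟩ := exists_bit_eq n β hβ
    exact (hI u hu).2 b hb σ h1 h2 h3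
      (hdes.congr fun i hi => hbit i (by rw [← hS.add_eq]; exact hi))
  exact ⟨t, s', he, ht, ⟨he.same.nat, he.same.real⟩,
    fun u hu => ⟨heq u hu, heq u hu ▸ (hI u hu).1.1⟩⟩

/-! ### Output of the values. -/

/-- The values of Max's nodes are recovered from `ys` by one maximisation. The labelling `X` makes
writes to the same node consistent, so injectivity of the lists is never required. -/
theorem write_runs (hS : Setting ρ n k m A B lam M c) (hG : MatrixGame k m A B lam M xs ys)
    {s : Mem} (hok : ρ.Ok s) (hH : Holds n k m A B lam M s) (hY : ∀ u < m, s.real 7 u = ys u)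
    (hszY : ∀ u < m, ρ.sz (4 * ((2 * c + 5) * (m + 1))) (ys u)) {X : ℕ → ℝ}
    (hX : ∀ i < k, X (s.nat 5 i) = xs i) (hX' : ∀ j < m, X (s.nat 6 j) = ys j)
    (h5 : ∀ i < k, s.nat 5 i < n) (h6 : ∀ j < m, s.nat 6 j < n) :
    Runs ρ write s fun s' => (∀ i < k, s'.real 2 (s.nat 5 i) = xs i) ∧
      ∀ j < m, s'.real 2 (s.nat 6 j) = ys j := by
  have hkm := hS.add_eq
  have hrounds := hS.rounds
  have hspace := hS.space
  refine Runs.seq (Runs.forLoop k (fun i s' => ∀ i' < i, s'.real 2 (s.nat 5 i') = xs i')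
    hok (by decide) (by omega) (fun s' hs' => ?_) (fun _ _ _ h => h) (by simp) ?_ ?_)
  · simp only [NExp.eval]
    rw [hs'.nat 3 (by decide)]
    exact hH.k_eq
  · intro i hi s1 hok1 hs1 h20 hI
    have hH1 : Holds n k m A B lam M s1 := hH.of_same hs1 (by decide) (by decide)
    have hi5 := h5 i hi
    have g5 : s1.nat 5 = s.nat 5 := hs1.nat 5 (by decide)
    have e5 : NExp.eval s1 (.cell 5 (nv 20)) = s.nat 5 i := by simp only [NExp.eval, h20, g5]
    have eM : RExp.eval s1 (.sub (.lit 0) (rv 5)) = -M := by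
      simp [RExp.eval, NExp.eval, hH1.M_eq]
    have hszM : ρ.sz ρ.bits (-M) := by
      have := ρ.sz_sub (ρ.sz_lit 0 (by omega)) hS.szM
      rw [Nat.cast_zero, zero_sub] at this
      exact hS.sz_of_le (l := 0) this (by omega) (by omega)
    refine Runs.seq (Runs.setReal hok1 (by rw [e5]; omega) (by rw [eM]; exact hszM)
      fun hok2 hs2 => ?_)
    rw [e5, eM] at hok2 hs2 ⊢
    set t := s.nat 5 i with ht
    set s2 := s1.setReal 2 t (-M) with hs2def
    have hH2 : Holds n k m A B lam M s2 := hH1.of_same hs2 (by decide) (by decide)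
    refine Runs.forLoop m (fun j s' => (∀ r, r ≠ t → s'.real 2 r = s1.real 2 r) ∧
        s'.real 2 t ≤ xs i ∧ ∀ j' < j, A i j' + lam * ys j' ≤ s'.real 2 t)
      hok2 (by decide) (by omega) (fun s' hs' => ?_) (fun _ _ _ h => h) ?_ ?_ ?_
    · simp only [NExp.eval]
      rw [hs'.nat 4 (by decide)]
      exact hH2.m_eq
    · refine ⟨fun r hr => by simp [hs2def, hr], ?_, by simp⟩
      have : s2.real 2 t = -M := by simp [hs2def]
      rw [this]
      exact (abs_le.1 (hG.abs_max i hi)).1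
    · rintro j hj s3 hok3 hs3 h21 ⟨hfr, hle, hup⟩
      have g0 : s3.nat 0 0 = n := (congrFun (hs3.nat 0 (by decide)) 0).trans hH2.n_eq
      have g20 : s3.nat 20 0 = i := (congrFun (hs3.nat 20 (by decide)) 0).trans h20
      have g5' : s3.nat 5 = s.nat 5 := (hs3.nat 5 (by decide)).trans g5
      have g3 : s3.real 3 = s2.real 3 := hs3.real 3 (by decide)
      have gl : s3.real 0 0 = lam := (congrFun (hs3.real 0 (by decide)) 0).trans hH2.lam_eq
      have g7 : s3.real 7 j = ys j := by
        rw [hs3.real 7 (by decide), ← hY j hj]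
        exact congrFun (hs1.real 7 (by decide)) j
      have ecand : optionExp.eval s3 = A i j + lam * ys j := by
        simp only [optionExp, RExp.eval, NExp.eval, ix_eval, g0, g20, h21, gl, g3, g7,
          hH2.A_eq i hi j hj]
      have e5' : NExp.eval s3 (.cell 5 (nv 20)) = t := by simp only [NExp.eval, g20, g5', ht]
      have ecell : RExp.eval s3 (.cell 2 (.cell 5 (nv 20))) = s3.real 2 t := by
        rw [RExp.eval, e5']
      refine Runs.branch (fun hb => ?_) (fun hb => ?_)
      · simp only [Test.holds] at hb
        rw [ecand, ecell] at hb
        refine Runs.nop hok3 ⟨hfr, hle, fun j' hj' => ?_⟩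
        rcases Nat.lt_succ_iff_lt_or_eq.1 hj' with h | rfl
        · exact hup j' h
        · exact hb
      · simp only [Test.holds] at hb
        rw [ecand, ecell, not_le] at hb
        refine Runs.setReal hok3 (by rw [e5']; omega) ?_ ?_
        · rw [ecand]
          refine hS.sz_of_le (l := m) (ρ.sz_add (hS.szA i hi j hj)
            (ρ.sz_mul hS.szlam (hszY j hj))) ?_ (by omega)
          nlinarith
        · rw [e5', ecand]
          simp only [Mem.setReal_real, Function.update_self]
          refine ⟨fun r hr => by rw [Function.update_of_ne hr]; exact hfr r hr,
            hG.max_le i hi j hj, fun j' hj' => ?_⟩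
          rcases Nat.lt_succ_iff_lt_or_eq.1 hj' with h | rfl
          · exact (hup j' h).trans hb.le
          · exact le_rfl
    · rintro s3 _ _ ⟨hfr, hle, hup⟩ i' hi'
      obtain ⟨j, hj, he⟩ := hG.max_eq i hi
      have hval : s3.real 2 t = xs i := le_antisymm hle (he ▸ hup j hj)
      by_cases h : s.nat 5 i' = t
      · rw [h, hval, ← hX i hi, ← ht, ← h, hX i' (by omega)]
      · rw [hfr _ h]
        refine hI i' (lt_of_le_of_ne (Nat.lt_succ_iff.1 hi') ?_)
        rintro rfl
        exact h rfl
  intro s1 _ hs1 hI1 hok1 _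
  have hH1 : Holds n k m A B lam M s1 := hH.of_same hs1 (by decide) (by decide)
  refine Runs.forLoop m (fun j s' => (∀ i < k, s'.real 2 (s.nat 5 i) = xs i) ∧
      ∀ j' < j, s'.real 2 (s.nat 6 j') = ys j')
    hok1 (by decide) (by omega) (fun s' hs' => ?_) (fun _ _ _ h => h) ⟨hI1, by simp⟩ ?_
    (fun _ _ _ h => h)
  · simp only [NExp.eval]
    rw [hs'.nat 4 (by decide)]
    exact hH1.m_eq
  · rintro j hj s2 hok2 hs2 h21 ⟨hI, hJ⟩
    have hj6 := h6 j hj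
    have g6 : s2.nat 6 = s.nat 6 := (hs2.nat 6 (by decide)).trans (hs1.nat 6 (by decide))
    have g7 : s2.real 7 = s.real 7 := (hs2.real 7 (by decide)).trans (hs1.real 7 (by decide))
    have e6 : NExp.eval s2 (.cell 6 (nv 21)) = s.nat 6 j := by simp only [NExp.eval, h21, g6]
    have e7 : RExp.eval s2 (.cell 7 (nv 21)) = ys j := by
      simp only [RExp.eval, NExp.eval, h21, g7, hY j hj]
    refine Runs.setReal hok2 (by rw [e6]; omega) ?_ ?_
    · rw [e7]
      exact hS.sz_of_le (l := m) (hszY j hj) (by omega) (by omega)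
    · rw [e6, e7]
      simp only [Mem.setReal_real, Function.update_self]
      refine ⟨fun i hi => ?_, fun j' hj' => ?_⟩
      · rw [Function.update_apply]
        split_ifs with h
        · rw [← hX i hi, h, hX' j hj]
        · exact hI i hi
      · rw [Function.update_apply]
        split_ifs with h
        · rw [← hX' j' (by omega), h, hX' j hj]
        · refine hJ j' (lt_of_le_of_ne (Nat.lt_succ_iff.1 hj') ?_)
          rintro rfl
          exact h rfl

end

end RealRAM

/-! ### Verification of the preparations -/

namespace RealRAM

section

variable {ρ : Res} {n : ℕ} {G : DiscountedGame n}

theorem listNodes_runs (hok : ρ.Ok G.input) (hr : ρ.rounds = n)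
    (hspace : n * n + 2 * n + 2 ≤ ρ.space) :
    Runs ρ listNodes G.input fun s' =>
      G.Listing (s'.nat 3 0) (s'.nat 4 0) (s'.nat 5) (s'.nat 6) := by
  refine Runs.forLoop n (fun v s' => s'.nat 3 0 + s'.nat 4 0 = v ∧
      (∀ i < s'.nat 3 0, ∃ a : Fin n, a ∈ G.VMax ∧ s'.nat 5 i = a) ∧
      (∀ j < s'.nat 4 0, ∃ a : Fin n, a ∉ G.VMax ∧ s'.nat 6 j = a) ∧
      (∀ a ∈ G.VMax, a.1 < v → ∃ i < s'.nat 3 0, s'.nat 5 i = a) ∧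
      (∀ a ∉ G.VMax, a.1 < v → ∃ j < s'.nat 4 0, s'.nat 6 j = a))
    hok (by decide) (by omega) (fun s' hs' => ?_) (fun _ _ _ h => h) ?_ ?_ ?_
  · simp only [NExp.eval]
    rw [hs'.nat 0 (by decide)]
    simp [DiscountedGame.input]
  · simp [DiscountedGame.input]
  · rintro v hv s hok' hs h20 ⟨h1, h2, h3, h4, h5⟩
    have g1 : s.nat 1 v = if (⟨v, hv⟩ : Fin n) ∈ G.VMax then 1 else 0 := by
      rw [hs.nat 1 (by decide)]
      simp [DiscountedGame.input, hv]
    have e20 : (nv 20).eval s = v := h20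
    refine Runs.branch (fun hb => ?_) (fun hb => ?_)
    · have hmem : (⟨v, hv⟩ : Fin n) ∈ G.VMax := by
        by_contra hmem
        rw [if_neg hmem] at g1
        simp only [Test.holds, NExp.eval, h20, g1] at hb
        omega
      have e3 : (nv 3).eval s = s.nat 3 0 := rfl
      refine Runs.seq (Runs.setNat hok' (by rw [e3]; omega) (by rw [e20]; omega) fun hok1 _ => ?_)
      rw [e3, e20] at hok1 ⊢
      have e3' : NExp.eval (s.setNat 5 (s.nat 3 0) v) (.add (nv 3) (.lit 1)) = s.nat 3 0 + 1 := rfl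
      refine Runs.setNat hok1 ρ.space_pos (by rw [e3']; omega) ?_
      rw [e3']
      have r3 : ((s.setNat 5 (s.nat 3 0) v).setNat 3 0 (s.nat 3 0 + 1)).nat 3 0 =
          s.nat 3 0 + 1 := by simp
      have r4 : ((s.setNat 5 (s.nat 3 0) v).setNat 3 0 (s.nat 3 0 + 1)).nat 4 = s.nat 4 := rfl
      have r6 : ((s.setNat 5 (s.nat 3 0) v).setNat 3 0 (s.nat 3 0 + 1)).nat 6 = s.nat 6 := rfl
      have r5 : ((s.setNat 5 (s.nat 3 0) v).setNat 3 0 (s.nat 3 0 + 1)).nat 5 =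
          Function.update (s.nat 5) (s.nat 3 0) v := by simp
      simp only [NExp.eval]
      rw [r3, r4, r5, r6]
      refine ⟨by omega, fun i hi => ?_, h3, fun a ha hav => ?_, fun a ha hav => ?_⟩
      · rw [Function.update_apply]
        split_ifs with h
        · exact ⟨_, hmem, rfl⟩
        · exact h2 i (by omega)
      · rcases Nat.lt_succ_iff_lt_or_eq.1 hav with h | h
        · obtain ⟨i, hi, he⟩ := h4 a ha h
          exact ⟨i, by omega, by rw [Function.update_of_ne hi.ne]; exact he⟩
        · exact ⟨s.nat 3 0, by omega, by rw [Function.update_self]; exact h.symm⟩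
      · rcases Nat.lt_succ_iff_lt_or_eq.1 hav with h | h
        · exact h5 a ha h
        · exact absurd (by convert hmem) ha
    · have hmem : (⟨v, hv⟩ : Fin n) ∉ G.VMax := by
        intro hmem
        rw [if_pos hmem] at g1
        simp only [Test.holds, NExp.eval, h20, g1] at hb
        omega
      have e4 : (nv 4).eval s = s.nat 4 0 := rfl
      refine Runs.seq (Runs.setNat hok' (by rw [e4]; omega) (by rw [e20]; omega) fun hok1 _ => ?_)
      rw [e4, e20] at hok1 ⊢
      have e4' : NExp.eval (s.setNat 6 (s.nat 4 0) v) (.add (nv 4) (.lit 1)) = s.nat 4 0 + 1 := rfl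
      refine Runs.setNat hok1 ρ.space_pos (by rw [e4']; omega) ?_
      rw [e4']
      have r4 : ((s.setNat 6 (s.nat 4 0) v).setNat 4 0 (s.nat 4 0 + 1)).nat 4 0 =
          s.nat 4 0 + 1 := by simp
      have r3 : ((s.setNat 6 (s.nat 4 0) v).setNat 4 0 (s.nat 4 0 + 1)).nat 3 = s.nat 3 := rfl
      have r5 : ((s.setNat 6 (s.nat 4 0) v).setNat 4 0 (s.nat 4 0 + 1)).nat 5 = s.nat 5 := rfl
      have r6 : ((s.setNat 6 (s.nat 4 0) v).setNat 4 0 (s.nat 4 0 + 1)).nat 6 =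
          Function.update (s.nat 6) (s.nat 4 0) v := by simp
      simp only [NExp.eval]
      rw [r3, r4, r5, r6]
      refine ⟨by omega, h2, fun i hi => ?_, fun a ha hav => ?_, fun a ha hav => ?_⟩
      · rw [Function.update_apply]
        split_ifs with h
        · exact ⟨_, hmem, rfl⟩
        · exact h3 i (by omega)
      · rcases Nat.lt_succ_iff_lt_or_eq.1 hav with h | h
        · exact h4 a ha h
        · exact absurd ha (by convert hmem)
      · rcases Nat.lt_succ_iff_lt_or_eq.1 hav with h | h
        · obtain ⟨i, hi, he⟩ := h5 a ha h
          exact ⟨i, by omega, by rw [Function.update_of_ne hi.ne]; exact he⟩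
        · exact ⟨s.nat 4 0, by omega, by rw [Function.update_self]; exact h.symm⟩
  · rintro s _ _ ⟨h1, h2, h3, h4, h5⟩
    exact ⟨h1, h2, h3, fun a ha => h4 a ha a.2, fun a ha => h5 a ha a.2⟩

/-- Here `R` is the sum of the absolute values of all matrix entries, obtained from sign tests. Each
of the `n * n` additions raises the size by two. -/
theorem bound_runs {s : Mem} (hok : ρ.Ok s) (hr : ρ.rounds = n) (hn : s.nat 0 0 = n)
    (hbits : 2 * (n * n) + 5 ≤ ρ.bits) (hw : ∀ i, ρ.sz 1 (s.real 1 i)) (hl : ρ.sz 1 (s.real 0 0)) :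
    Runs ρ bound s fun s' => ∃ R : ℝ, 0 ≤ R ∧ (∀ u < n, ∀ v < n, |s.real 1 (u * n + v)| ≤ R) ∧
      s'.real 5 0 = 2 * R / (1 - s.real 0 0) ∧ ρ.sz (2 * (n * n) + 5) (s'.real 5 0) := by
  have h0 : ρ.sz 1 (0 : ℝ) := by simpa using ρ.sz_lit 0 (by omega)
  have e0 : RExp.eval s (.lit 0) = 0 := by simp [RExp.eval]
  refine Runs.seq (Runs.setReal hok ρ.space_pos (by rw [e0]; exact ρ.sz_mono h0 (by omega))
    fun hok1 _ => ?_)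
  rw [e0] at hok1 ⊢
  change ρ.Ok (s.setReal 12 0 0) at hok1
  change Runs ρ _ (s.setReal 12 0 0) _
  refine Runs.seq (Runs.forLoop n (fun i s' => 0 ≤ s'.real 12 0 ∧
      ρ.sz (2 * (i * n) + 1) (s'.real 12 0) ∧
      ∀ u < i, ∀ v < n, |s.real 1 (u * n + v)| ≤ s'.real 12 0)
    hok1 (by decide) (by omega) (fun s' hs' => ?_) (fun _ _ _ h => h) ?_ ?_ ?_)
  · simp only [NExp.eval]
    rw [hs'.nat 0 (by decide)]
    exact hn
  · have : (s.setReal 12 0 0).real 12 0 = 0 := by simp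
    rw [this]
    exact ⟨le_rfl, ρ.sz_mono h0 (by omega), by simp⟩
  · rintro i hi s2 hok2 hs2 h20 ⟨i1, i2, i3⟩
    have g0 : s2.nat 0 0 = n := (congrFun (hs2.nat 0 (by decide)) 0).trans hn
    have g1 : s2.real 1 = s.real 1 := hs2.real 1 (by decide)
    refine Runs.forLoop n (fun j s' => 0 ≤ s'.real 12 0 ∧
        ρ.sz (2 * (i * n + j) + 1) (s'.real 12 0) ∧
        (∀ u < i, ∀ v < n, |s.real 1 (u * n + v)| ≤ s'.real 12 0) ∧
        ∀ v < j, |s.real 1 (i * n + v)| ≤ s'.real 12 0)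
      hok2 (by decide) (by omega) (fun s' hs' => ?_) (fun _ _ _ h => h) ⟨i1, i2, i3, by simp⟩ ?_ ?_
    · simp only [NExp.eval]
      rw [hs'.nat 0 (by decide)]
      exact g0
    · rintro j hj s3 hok3 hs3 h21 ⟨j1, j2, j3, j4⟩
      have ew : weightExp.eval s3 = s.real 1 (i * n + j) := by
        have g0' : s3.nat 0 0 = n := (congrFun (hs3.nat 0 (by decide)) 0).trans g0
        have g20 : s3.nat 20 0 = i := (congrFun (hs3.nat 20 (by decide)) 0).trans h20
        have g1' : s3.real 1 = s.real 1 := (hs3.real 1 (by decide)).trans g1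
        simp only [weightExp, RExp.eval, NExp.eval, ix_eval, g0', g20, h21, g1']
      have hij : i * n + j + 1 ≤ n * n := by nlinarith
      have key : ∀ z, z = s3.real 12 0 + |s.real 1 (i * n + j)| →
          ρ.sz (2 * (i * n + (j + 1)) + 1) z →
          ρ.sz ρ.bits z ∧ (0 ≤ (s3.setReal 12 0 z).real 12 0 ∧
          ρ.sz (2 * (i * n + (j + 1)) + 1) ((s3.setReal 12 0 z).real 12 0) ∧
          (∀ u < i, ∀ v < n, |s.real 1 (u * n + v)| ≤ (s3.setReal 12 0 z).real 12 0) ∧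
          ∀ v < j + 1, |s.real 1 (i * n + v)| ≤ (s3.setReal 12 0 z).real 12 0) := by
        intro z hz hszz
        have rz : (s3.setReal 12 0 z).real 12 0 = z := by simp
        rw [rz]
        have ha := abs_nonneg (s.real 1 (i * n + j))
        refine ⟨ρ.sz_mono hszz (by omega), by linarith, hszz,
          fun u hu v hv => by linarith [j3 u hu v hv], fun v hv => ?_⟩
        rcases Nat.lt_succ_iff_lt_or_eq.1 hv with h | rfl
        · linarith [j4 v h]
        · linarith
      have e12 : RExp.eval s3 (rv 12) = s3.real 12 0 := rfl
      refine Runs.branch (fun hb => ?_) (fun hb => ?_)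
      · simp only [Test.holds] at hb
        rw [ew] at hb
        simp only [RExp.eval, Nat.cast_zero] at hb
        have ez : RExp.eval s3 (.add (rv 12) weightExp) =
            s3.real 12 0 + s.real 1 (i * n + j) := by rw [RExp.eval, ew, e12]
        have hk := key (s3.real 12 0 + s.real 1 (i * n + j)) (by rw [abs_of_nonneg hb])
          (ρ.sz_mono (ρ.sz_add j2 (hw _)) (by omega))
        refine Runs.setReal hok3 ρ.space_pos (by rw [ez]; exact hk.1) ?_
        rw [ez]
        exact hk.2
      · simp only [Test.holds] at hb
        rw [ew] at hb
        simp only [RExp.eval, Nat.cast_zero, not_le] at hb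
        have ez : RExp.eval s3 (.sub (rv 12) weightExp) =
            s3.real 12 0 - s.real 1 (i * n + j) := by rw [RExp.eval, ew, e12]
        have hk := key (s3.real 12 0 - s.real 1 (i * n + j))
          (by rw [abs_of_neg hb, sub_eq_add_neg])
          (ρ.sz_mono (ρ.sz_sub j2 (hw _)) (by omega))
        refine Runs.setReal hok3 ρ.space_pos (by rw [ez]; exact hk.1) ?_
        rw [ez]
        exact hk.2
    · rintro s3 _ _ ⟨j1, j2, j3, j4⟩
      refine ⟨j1, ρ.sz_mono j2 (by rw [Nat.succ_mul i n]), fun u hu v hv => ?_⟩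
      rcases Nat.lt_succ_iff_lt_or_eq.1 hu with h | rfl
      · exact j3 u h v hv
      · exact j4 v hv
  · rintro s2 _ hs2 ⟨i1, i2, i3⟩ hok2 _
    have g0 : s2.real 0 = s.real 0 := hs2.real 0 (by decide)
    have ev : RExp.eval s2 (.div (.mul (.lit 2) (rv 12)) (.sub (.lit 1) (rv 0))) =
        2 * s2.real 12 0 / (1 - s.real 0 0) := by
      simp [RExp.eval, NExp.eval, g0]
    have hsz : ρ.sz (2 * (n * n) + 5) (2 * s2.real 12 0 / (1 - s.real 0 0)) := by
      have h2 : ρ.sz 1 (2 : ℝ) := by simpa using ρ.sz_lit 2 (by omega)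
      have h1 : ρ.sz 1 (1 : ℝ) := by simpa using ρ.sz_lit 1 (by omega)
      -- The sum has size `2 * (n * n) + 1`, the factor two adds one and the denominator three.
      exact ρ.sz_mono (ρ.sz_div (ρ.sz_mul h2 i2) (ρ.sz_sub h1 hl)) (by omega)
    refine Runs.setReal hok2 ρ.space_pos (by rw [ev]; exact ρ.sz_mono hsz hbits) ?_
    rw [ev]
    have r5 : (s2.setReal 5 0 (2 * s2.real 12 0 / (1 - s.real 0 0))).real 5 0 =
        2 * s2.real 12 0 / (1 - s.real 0 0) := by simp
    exact ⟨s2.real 12 0, i1, i3, r5, r5 ▸ hsz⟩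

theorem matrices_runs {s : Mem} (hok : ρ.Ok s) (hr : ρ.rounds = n)
    (hspace : n * n + 2 * n + 2 ≤ ρ.space) (hn : s.nat 0 0 = n)
    {k m : ℕ} (hk : s.nat 3 0 = k) (hm : s.nat 4 0 = m) (hkm : k + m = n)
    (h2 : s.nat 2 = G.input.nat 2) (h1 : s.real 1 = G.input.real 1) {lam M : ℝ}
    (hl : s.real 0 0 = lam) (hM : s.real 5 0 = M) (hbits : 2 * (n * n) + 7 ≤ ρ.bits)
    (hw : ∀ i, ρ.sz 1 (G.input.real 1 i)) (hszM : ρ.sz (2 * (n * n) + 5) M) :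
    Runs ρ matrices s fun s' => Holds n k m
      (fun i j => G.weightOr (-M) (s.nat 5 i) (s.nat 6 j))
      (fun j i => G.weightOr M (s.nat 6 j) (s.nat 5 i)) lam M s' := by
  set A : ℕ → ℕ → ℝ := fun i j => G.weightOr (-M) (s.nat 5 i) (s.nat 6 j) with hA
  set B : ℕ → ℕ → ℝ := fun j i => G.weightOr M (s.nat 6 j) (s.nat 5 i) with hB
  have hidx : ∀ l < n, ∀ b < n, l * n + b < ρ.space := fun l hl b hb => by
    have := Nat.mul_le_mul_right n hl
    rw [Nat.succ_mul] at this
    omega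
  refine Runs.forLoop k (fun i s' => ∀ i' < i, ∀ j < m, s'.real 3 (i' * n + j) = A i' j ∧
      s'.real 4 (j * n + i') = B j i')
    hok (by decide) (by omega) (fun s' hs' => ?_) (fun _ _ _ h => h) (by simp) ?_ ?_
  · simp only [NExp.eval]
    rw [hs'.nat 3 (by decide)]
    exact hk
  · intro i hi s1 hok1 hs1 h20 hI
    refine Runs.forLoop m (fun j s' => (∀ i' < i, ∀ j < m, s'.real 3 (i' * n + j) = A i' j ∧
        s'.real 4 (j * n + i') = B j i') ∧ ∀ j' < j, s'.real 3 (i * n + j') = A i j' ∧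
        s'.real 4 (j' * n + i) = B j' i)
      hok1 (by decide) (by omega) (fun s' hs' => ?_) (fun _ _ _ h => h) ⟨hI, by simp⟩ ?_ ?_
    · simp only [NExp.eval]
      rw [hs'.nat 4 (by decide), hs1.nat 4 (by decide)]
      exact hm
    · rintro j hj s2 hok2 hs2 h21 ⟨hJ, hN⟩
      have g0 : s2.nat 0 0 = n := by rw [hs2.nat 0 (by decide), hs1.nat 0 (by decide), hn]
      have g20 : s2.nat 20 0 = i := (congrFun (hs2.nat 20 (by decide)) 0).trans h20
      have g2 : s2.nat 2 = G.input.nat 2 := by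
        rw [hs2.nat 2 (by decide), hs1.nat 2 (by decide), h2]
      have g5 : s2.nat 5 = s.nat 5 := by rw [hs2.nat 5 (by decide), hs1.nat 5 (by decide)]
      have g6 : s2.nat 6 = s.nat 6 := by rw [hs2.nat 6 (by decide), hs1.nat 6 (by decide)]
      have g1 : s2.real 1 = G.input.real 1 := by
        rw [hs2.real 1 (by decide), hs1.real 1 (by decide), h1]
      have gM : s2.real 5 0 = M := by
        rw [hs2.real 5 (by decide), hs1.real 5 (by decide), hM]
      have e3 : (ix (nv 20) (nv 21)).eval s2 = i * n + j := by
        simp only [ix_eval, NExp.eval, g0, g20, h21]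
      have hidx3 := hidx i (by omega) j (by omega)
      have hidx4 := hidx j (by omega) i (by omega)
      have hszA : ρ.sz ρ.bits (A i j) := by
        simp only [hA, DiscountedGame.weightOr]
        split_ifs
        · exact ρ.sz_mono (hw _) (by omega)
        · have := ρ.sz_sub (ρ.sz_lit 0 (by omega)) hszM
          rw [Nat.cast_zero, zero_sub] at this
          exact ρ.sz_mono this (by omega)
      have hszB : ρ.sz ρ.bits (B j i) := by
        simp only [hB, DiscountedGame.weightOr]
        split_ifs
        · exact ρ.sz_mono (hw _) (by omega)
        · exact ρ.sz_mono hszM (by omega)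
      -- Both branches store the same expression `A i j`, by the definition of `weightOr`, so the
      -- assignment can be treated as unconditional afterwards.
      refine Runs.seq ((Runs.branch (fun hb => ?_) (fun hb => ?_) :
        Runs ρ _ s2 fun s' => s' = s2.setReal 3 (i * n + j) (A i j)).imp ?_)
      · have hv : RExp.eval s2 (.cell 1 (ix (.cell 5 (nv 20)) (.cell 6 (nv 21)))) = A i j := by
          simp only [Test.holds, NExp.eval, ix_eval, g0, g20, h21, g2, g5, g6] at hb
          simp only [RExp.eval, NExp.eval, ix_eval, g0, g20, h21, g1, g5, g6, hA,
            DiscountedGame.weightOr, if_pos hb]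
        exact Runs.setReal hok2 (by rw [e3]; exact hidx3) (by rw [hv]; exact hszA)
          (by rw [e3, hv])
      · have hv : RExp.eval s2 (.sub (.lit 0) (rv 5)) = A i j := by
          simp only [Test.holds, NExp.eval, ix_eval, g0, g20, h21, g2, g5, g6] at hb
          simp only [RExp.eval, NExp.eval, gM, hA, DiscountedGame.weightOr, if_neg hb,
            Nat.cast_zero, zero_sub]
        exact Runs.setReal hok2 (by rw [e3]; exact hidx3) (by rw [hv]; exact hszA)
          (by rw [e3, hv])
      rintro _ hok3 - rfl - -
      set s3 := s2.setReal 3 (i * n + j) (A i j) with hs3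
      have e4 : (ix (nv 21) (nv 20)).eval s3 = j * n + i := by
        simp only [hs3, ix_eval, NExp.eval, Mem.setReal_nat, g0, g20, h21]
      refine (Runs.branch (fun hb => ?_) (fun hb => ?_) :
        Runs ρ _ s3 fun s' => s' = s3.setReal 4 (j * n + i) (B j i)).imp ?_
      · have hv : RExp.eval s3 (.cell 1 (ix (.cell 6 (nv 21)) (.cell 5 (nv 20)))) = B j i := by
          have g1' : s3.real 1 = G.input.real 1 := g1
          simp only [hs3, Test.holds, NExp.eval, ix_eval, Mem.setReal_nat, g0, g20, h21, g2, g5,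
            g6] at hb
          rw [RExp.eval, g1']
          simp only [hs3, NExp.eval, ix_eval, Mem.setReal_nat, g0, g20, h21, g5, g6, hB,
            DiscountedGame.weightOr, if_pos hb]
        exact Runs.setReal hok3 (by rw [e4]; exact hidx4) (by rw [hv]; exact hszB)
          (by rw [e4, hv])
      · have hv : RExp.eval s3 (rv 5) = B j i := by
          have gM' : RExp.eval s3 (rv 5) = M := gM
          simp only [hs3, Test.holds, NExp.eval, ix_eval, Mem.setReal_nat, g0, g20, h21, g2, g5,
            g6] at hb
          rw [gM']
          simp only [hB, DiscountedGame.weightOr, if_neg hb]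
        exact Runs.setReal hok3 (by rw [e4]; exact hidx4) (by rw [hv]; exact hszB)
          (by rw [e4, hv])
      rintro _ - - rfl
      have r3 : (s3.setReal 4 (j * n + i) (B j i)).real 3 =
          Function.update (s2.real 3) (i * n + j) (A i j) := by simp [hs3]
      have r4 : (s3.setReal 4 (j * n + i) (B j i)).real 4 =
          Function.update (s2.real 4) (j * n + i) (B j i) := by simp [hs3]
      rw [r3, r4]
      refine ⟨fun i' hi' j' hj' => ⟨?_, ?_⟩, fun j' hj' => ⟨?_, ?_⟩⟩
      · rw [Function.update_of_ne]
        · exact (hJ i' hi' j' hj').1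
        · intro h
          have := (mul_add_inj (by omega) (by omega) h).1
          omega
      · rw [Function.update_of_ne]
        · exact (hJ i' hi' j' hj').2
        · intro h
          have := (mul_add_inj (by omega) (by omega) h).2
          omega
      · rw [Function.update_apply]
        split_ifs with h
        · rw [(mul_add_inj (by omega) (by omega) h).2]
        · exact (hN j' (lt_of_le_of_ne (Nat.lt_succ_iff.1 hj') fun hjj => h (by rw [hjj]))).1
      · rw [Function.update_apply]
        split_ifs with h
        · rw [(mul_add_inj (by omega) (by omega) h).1]
        · exact (hN j' (lt_of_le_of_ne (Nat.lt_succ_iff.1 hj') fun hjj => h (by rw [hjj]))).2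
    · rintro s2 _ _ ⟨hJ, hN⟩ i' hi' j hj
      rcases Nat.lt_succ_iff_lt_or_eq.1 hi' with h | rfl
      · exact hJ i' h j hj
      · exact hN j hj
  · intro s' _ hs' hI
    refine ⟨?_, ?_, ?_, ?_, ?_, fun i hi j hj => (hI i hi j hj).1, fun i hi j hj => (hI i hi j hj).2⟩
    · rw [hs'.nat 0 (by decide), hn]
    · rw [hs'.nat 3 (by decide), hk]
    · rw [hs'.nat 4 (by decide), hm]
    · rw [hs'.real 0 (by decide), hl]
    · rw [hs'.real 5 (by decide), hM]

end

end RealRAM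

/-! ### Bit-lengths -/

/-- A quotient of integers of bit-length about `B`. -/
def FracBits (B : ℕ) (x : ℝ) : Prop :=
  ∃ (p : ℤ) (q : ℕ), 0 < q ∧ p.natAbs ≤ 2 ^ B ∧ q ≤ 2 ^ B ∧ x = p / q

namespace FracBits

variable {a b : ℕ} {x y : ℝ}

theorem mono (h : FracBits a x) (hab : a ≤ b) : FracBits b x := by
  obtain ⟨p, q, h1, h2, h3, h4⟩ := h
  have := Nat.pow_le_pow_right (n := 2) (by omega) hab
  exact ⟨p, q, h1, h2.trans this, h3.trans this, h4⟩

theorem natCast {c : ℕ} (hc : c ≤ 2 ^ a) : FracBits a c :=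
  ⟨c, 1, one_pos, by simpa using hc, Nat.one_le_two_pow, by simp⟩

theorem neg (hx : FracBits a x) : FracBits a (-x) := by
  obtain ⟨p, q, h1, h2, h3, rfl⟩ := hx
  exact ⟨-p, q, h1, by simpa using h2, h3, by push_cast; ring⟩

/-- Fractions are not reduced, so bit-lengths simply add; one more bit accommodates the sum of the
two cross products. -/
theorem add (hx : FracBits a x) (hy : FracBits b y) : FracBits (a + b + 1) (x + y) := by
  obtain ⟨p, q, h1, h2, h3, rfl⟩ := hx
  obtain ⟨p', q', h1', h2', h3', rfl⟩ := hy
  have hq : (q : ℝ) ≠ 0 := by positivity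
  have hq' : (q' : ℝ) ≠ 0 := by positivity
  refine ⟨p * q' + p' * q, q * q', Nat.mul_pos h1 h1', ?_, ?_, ?_⟩
  · refine (Int.natAbs_add_le _ _).trans ?_
    rw [Int.natAbs_mul, Int.natAbs_mul, Int.natAbs_natCast, Int.natAbs_natCast, pow_succ, pow_add]
    have e1 := Nat.mul_le_mul h2 h3'
    have e2 := Nat.mul_le_mul h2' h3
    rw [mul_comm (2 ^ b)] at e2
    omega
  · rw [pow_succ, pow_add]
    have := Nat.mul_le_mul h3 h3'
    omega
  · push_cast
    field_simp

theorem sub (hx : FracBits a x) (hy : FracBits b y) : FracBits (a + b + 1) (x - y) := by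
  rw [sub_eq_add_neg]
  exact hx.add hy.neg

theorem mul (hx : FracBits a x) (hy : FracBits b y) : FracBits (a + b) (x * y) := by
  obtain ⟨p, q, h1, h2, h3, rfl⟩ := hx
  obtain ⟨p', q', h1', h2', h3', rfl⟩ := hy
  refine ⟨p * p', q * q', Nat.mul_pos h1 h1', ?_, ?_, ?_⟩
  · rw [Int.natAbs_mul, pow_add]
    exact Nat.mul_le_mul h2 h2'
  · rw [pow_add]
    exact Nat.mul_le_mul h3 h3'
  · push_cast
    rw [div_mul_div_comm]

/-- The sign moves to the new numerator, and zero is its own inverse by convention. -/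
theorem inv (hx : FracBits a x) : FracBits a x⁻¹ := by
  obtain ⟨p, q, h1, h2, h3, rfl⟩ := hx
  rcases eq_or_ne p 0 with rfl | hp
  · exact ⟨0, 1, one_pos, by simp, Nat.one_le_two_pow, by simp⟩
  · refine ⟨p.sign * q, p.natAbs, Int.natAbs_pos.2 hp, ?_, h2, ?_⟩
    · rw [Int.natAbs_mul, Int.natAbs_natCast, Int.natAbs_sign_of_ne_zero hp, one_mul]
      exact h3
    · have hpr : (p : ℝ) = p.sign * p.natAbs := by
        rw [← Int.cast_natCast (R := ℝ) p.natAbs, ← Int.cast_mul, Int.sign_mul_natAbs]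
      have hs : (p.sign : ℝ) * p.sign = 1 := by
        have : p.sign * p.sign = 1 := by
          rcases lt_or_gt_of_ne hp with h | h
          · simp [Int.sign_eq_neg_one_of_neg h]
          · simp [Int.sign_eq_one_of_pos h]
        exact_mod_cast this
      have hn : (p.natAbs : ℝ) ≠ 0 := by
        have := Int.natAbs_pos.2 hp
        positivity
      have hq : (q : ℝ) ≠ 0 := by positivity
      have hs0 : (p.sign : ℝ) ≠ 0 := left_ne_zero_of_mul_eq_one hs
      rw [hpr, Int.cast_mul, Int.cast_natCast, inv_div, div_eq_div_iff (mul_ne_zero hs0 hn) hn]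
      linear_combination (-(q : ℝ) * p.natAbs) * hs

theorem div (hx : FracBits a x) (hy : FracBits b y) : FracBits (a + b) (x / y) := by
  rw [div_eq_mul_inv]
  exact hx.mul hy.inv

/-- Passing to lowest terms can only shrink both parts, and a number up to `2 ^ a` has at most `a +
1` bits. -/
theorem ratBits (hx : FracBits a x) : RatBits (2 * a + 2) x := by
  obtain ⟨p, q, h1, h2, h3, rfl⟩ := hx
  refine ⟨(p : ℚ) / q, by push_cast; rfl, ?_⟩
  have hlt : 2 ^ a < 2 ^ (a + 1) := by rw [pow_succ]; have := Nat.one_le_two_pow (n := a); omega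
  have hnum : ((p : ℚ) / q).num.natAbs ≤ 2 ^ a := by
    refine le_trans ?_ h2
    rcases eq_or_ne p 0 with rfl | hp
    · simp
    · have hd : ((p : ℚ) / (q : ℤ)).num ∣ p := by
        rw [← Rat.divInt_eq_div]
        exact Rat.num_dvd _ (by omega)
      exact Nat.le_of_dvd (Int.natAbs_pos.2 hp) (Int.natAbs_dvd_natAbs.2 (by exact_mod_cast hd))
  have hden : ((p : ℚ) / q).den ≤ 2 ^ a := by
    refine le_trans ?_ h3
    have hd : (((p : ℚ) / (q : ℤ)).den : ℤ) ∣ (q : ℤ) := by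
      rw [← Rat.divInt_eq_div]
      exact Rat.den_dvd _ _
    exact Nat.le_of_dvd h1 (by exact_mod_cast hd)
  have s1 := Nat.size_le.2 (hnum.trans_lt hlt)
  have s2 := Nat.size_le.2 (hden.trans_lt hlt)
  omega

end FracBits

theorem RatBits.fracBits {B : ℕ} {x : ℝ} (h : RatBits B x) : FracBits B x := by
  obtain ⟨r, rfl, hr⟩ := h
  refine ⟨r.num, r.den, r.pos, ?_, ?_, by exact_mod_cast (Rat.num_div_den r).symm⟩
  · exact (Nat.size_le.1 (show Nat.size r.num.natAbs ≤ B by omega)).le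
  · exact (Nat.size_le.1 (show Nat.size r.den ≤ B by omega)).le

namespace DiscountedGame

open RealRAM

variable {n : ℕ}

/-- If the data of the game are rationals of bit-length at most `L`, then `x` is a quotient of
integers of bit-length about `c * (L + 1)`. -/
def Size (G : DiscountedGame n) (c : ℕ) (x : ℝ) : Prop :=
  ∀ L, G.RationalData L → FracBits (c * (L + 1)) x

/-- The resources sufficient for solving the game. -/
def resources (G : DiscountedGame n) : Res where
  space := n * n + 2 * n + 2
  rounds := n
  -- Matrix entries have size `c = 2 * (n * n) + 7`, and a walk costs `2 * c + 5` per row for at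
  -- most `n + 1` rows. Lasso values take four times that; the factor eight leaves room for the
  -- final options of Max.
  bits := 8 * ((2 * (2 * (n * n) + 7) + 5) * (n + 1))
  sz := G.Size
  space_pos := by omega
  rounds_le := by omega
  sz_mono h hab := fun L hL => (h L hL).mono (Nat.mul_le_mul_right _ hab)
  sz_lit c hc := fun L _ => .natCast (hc.trans (by
    rw [one_mul, pow_succ]
    have := Nat.one_le_two_pow (n := L)
    omega))
  sz_add h h' := fun L hL => ((h L hL).add (h' L hL)).mono (by ring_nf; omega)
  sz_sub h h' := fun L hL => ((h L hL).sub (h' L hL)).mono (by ring_nf; omega)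
  sz_mul h h' := fun L hL => ((h L hL).mul (h' L hL)).mono (by rw [add_mul])
  sz_div h h' := fun L hL => ((h L hL).div (h' L hL)).mono (by rw [add_mul])

theorem size_zero (G : DiscountedGame n) : G.Size 1 0 := by
  have := G.resources.sz_lit 0 (by omega)
  rw [Nat.cast_zero] at this
  exact this

theorem size_disc (G : DiscountedGame n) : G.Size 1 G.disc :=
  fun _ hL => hL.1.fracBits.mono (by omega)

theorem size_input (G : DiscountedGame n) (i : ℕ) : G.Size 1 (G.input.real 1 i) := by
  simp only [input]
  norm_num [-finProdFinEquiv_symm_apply]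
  split_ifs with h h'
  · exact fun L hL => (hL.2 _ h').fracBits.mono (by omega)
  · exact G.size_zero
  · exact G.size_zero

theorem input_ok (G : DiscountedGame n) : G.resources.Ok G.input := by
  have hb : 1 ≤ G.resources.bits := by simp only [resources]; nlinarith
  have hs : G.resources.space = n * n + 2 * n + 2 := rfl
  refine ⟨⟨fun arr i => ?_, fun arr i hi => ⟨?_, ?_⟩⟩, fun arr i => ?_⟩
  · simp only [input]
    split_ifs <;> omega
  · simp only [input]
    split_ifs <;> omega
  · simp only [input]
    split_ifs <;> first | rfl | omega
  · refine G.resources.sz_mono (a := 1) ?_ hb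
    rcases eq_or_ne arr 1 with rfl | h1
    · exact G.size_input i
    · simp only [input, if_neg h1]
      split_ifs
      · exact G.size_disc
      · exact G.size_zero
      · exact G.size_zero

/-- The program solves bipartite discounted games. -/
theorem exists_exec_solve (G : DiscountedGame n) (hG : G.Bipartite) :
    ∃ t s, Exec G.resources.Ok solve G.input t s ∧
      t ≤ prepare.time n + (2 ^ n * (4 + round.time n) + 4 + write.time n) ∧
      G.IsValueVector (s.output n) := by
  set ρ := G.resources with hρ
  have hspace : n * n + 2 * n + 2 ≤ ρ.space := le_rfl
  have hr : ρ.rounds = n := rfl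
  have hbits : ρ.bits = 8 * ((2 * (2 * (n * n) + 7) + 5) * (n + 1)) := rfl
  have hb7 : 2 * (n * n) + 7 ≤ ρ.bits := by rw [hbits]; nlinarith
  have hprep : Runs ρ prepare G.input fun s => ∃ k m M R, G.Listing k m (s.nat 5) (s.nat 6) ∧
      0 ≤ R ∧ (∀ e ∈ G.E, |G.w e| ≤ R) ∧ M = 2 * R / (1 - G.disc) ∧ G.Size (2 * (n * n) + 5) M ∧
      Holds n k m (fun i j => G.weightOr (-M) (s.nat 5 i) (s.nat 6 j))
        (fun j i => G.weightOr M (s.nat 6 j) (s.nat 5 i)) G.disc M s ∧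
      ∀ u < m, s.real 7 u = -M := by
    refine Runs.seq ((listNodes_runs G.input_ok hr hspace).imp fun s1 hok1 hs1 hl _ _ => ?_)
    have a0 : s1.nat 0 0 = n := by
      rw [hs1.nat 0 (by decide)]
      simp [input]
    have a1 : s1.real 1 = G.input.real 1 := hs1.real 1 (by decide)
    have ad : s1.real 0 0 = G.disc := by
      rw [hs1.real 0 (by decide)]
      simp [input]
    refine Runs.seq ((bound_runs hok1 hr a0 (show 2 * (n * n) + 5 ≤ ρ.bits by omega)
      (fun i => by rw [a1]; exact G.size_input i) (by rw [ad]; exact G.size_disc)).imp ?_)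
    rintro s2 hok2 hs2 ⟨R, hR0, hR, hM, hszM⟩ - -
    rw [ad] at hM
    rw [a1] at hR
    have b5 : s2.nat 5 = s1.nat 5 := hs2.nat 5 (by decide)
    have b6 : s2.nat 6 = s1.nat 6 := hs2.nat 6 (by decide)
    have b3 : s2.nat 3 = s1.nat 3 := hs2.nat 3 (by decide)
    have b4 : s2.nat 4 = s1.nat 4 := hs2.nat 4 (by decide)
    rw [← b5, ← b6, ← b3, ← b4] at hl
    refine Runs.seq ((matrices_runs (G := G) hok2 hr hspace
      (by rw [hs2.nat 0 (by decide), a0]) rfl rfl hl.add_eq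
      ((hs2.nat 2 (by decide)).trans (hs1.nat 2 (by decide)))
      ((hs2.real 1 (by decide)).trans a1)
      (by rw [hs2.real 0 (by decide), ad]) rfl hb7 G.size_input hszM).imp ?_)
    rintro s3 hok3 hs3 hH - -
    have c5 : s3.nat 5 = s2.nat 5 := hs3.nat 5 (by decide)
    have c6 : s3.nat 6 = s2.nat 6 := hs3.nat 6 (by decide)
    set M := s2.real 5 0
    set m := s2.nat 4 0
    have hkm := hl.add_eq
    refine Runs.forLoop m (fun i s' => ∀ u < i, s'.real 7 u = -M) hok3 (by decide) (by omega)
      (fun s' hs' => ?_) (fun _ _ _ h => h) (by simp) ?_ ?_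
    · simp only [NExp.eval]
      rw [hs'.nat 4 (by decide), hH.m_eq]
    · intro i hi s4 hok4 hs4 h21 hI
      have e21 : (nv 21).eval s4 = i := h21
      have gM : s4.real 5 0 = M := by rw [hs4.real 5 (by decide), hH.M_eq]
      have eM : RExp.eval s4 (.sub (.lit 0) (rv 5)) = -M := by simp [RExp.eval, NExp.eval, gM]
      refine Runs.setReal hok4 (by rw [e21]; omega) ?_ ?_
      · rw [eM, ← zero_sub]
        exact ρ.sz_mono (ρ.sz_sub G.size_zero hszM) (by omega)
      · rw [e21, eM]
        intro u hu
        simp only [Mem.setReal_real, Function.update_self, Function.update_apply]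
        split_ifs with h
        · rfl
        · exact hI u (by omega)
    · intro s4 _ hs4 hI
      have d5 : s4.nat 5 = s2.nat 5 := (hs4.nat 5 (by decide)).trans c5
      have d6 : s4.nat 6 = s2.nat 6 := (hs4.nat 6 (by decide)).trans c6
      refine ⟨s2.nat 3 0, m, M, R, ?_, hR0, fun e he => ?_, hM, hszM, ?_, hI⟩
      · rw [d5, d6]
        exact hl
      · have h1 := hR e.1 e.1.2 e.2 e.2.2
        rwa [input_weight, if_pos he] at h1
      · rw [d5, d6]
        exact hH.of_same hs4 (by decide) (by decide)
  obtain ⟨t1, s1, he1, ht1, k, m, M, R, hl, hR0, hR, hM, hszM, hH, hY⟩ := hprep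
  obtain ⟨x, hx⟩ := G.exists_isValueVector
  set X : ℕ → ℝ := fun v => if h : v < n then x ⟨v, h⟩ else 0 with hXdef
  have hX : ∀ a : Fin n, X a = x a := fun a => by simp [hXdef]
  have hM' := hx.matrixGame hG hl hX hR0 hR hM
  set A : ℕ → ℕ → ℝ := fun i j => G.weightOr (-M) (s1.nat 5 i) (s1.nat 6 j) with hA
  set B : ℕ → ℕ → ℝ := fun j i => G.weightOr M (s1.nat 6 j) (s1.nat 5 i) with hB
  -- Negation is the subtraction `0 - M`, which adds two to the size of `M`.
  have hszMneg : G.Size (2 * (n * n) + 7) (-M) := by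
    rw [← zero_sub]
    exact ρ.sz_mono (ρ.sz_sub G.size_zero hszM) (by omega)
  have hszM7 : G.Size (2 * (n * n) + 7) M := ρ.sz_mono hszM (by omega)
  have hS : Setting ρ n k m A B G.disc M (2 * (n * n) + 7) := by
    refine ⟨hl.add_eq, hr, hspace, hbits.ge, fun i _ j _ => ?_, fun i _ j _ => ?_, G.size_disc,
      hszM7⟩
    · simp only [hA, weightOr]
      split_ifs
      · exact ρ.sz_mono (G.size_input _) (by omega)
      · exact hszMneg
    · simp only [hB, weightOr]
      split_ifs
      · exact ρ.sz_mono (G.size_input _) (by omega)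
      · exact hszM7
  -- Arrays untouched so far are zero: the first bit string is all zeros, the exit flag is off, and
  -- the initial strategy sends every source to target `0`. The latter exists as soon as Max has a
  -- node, by `max_eq`.
  have hzero : ∀ arr, 3 ≤ arr → arr ∉ prepare.nmods → ∀ i, s1.nat arr i = 0 := by
    intro arr harr hmem i
    rw [he1.same.nat arr hmem]
    simp only [input]
    rw [if_neg (by omega), if_neg (by omega), if_neg (by omega)]
  obtain ⟨t2, s2, he2, ht2, hs2, hY2⟩ := exists_exec_rounds hS hM' he1.final hH
    (fun a ha => by
      obtain ⟨j, hj, -⟩ := hM'.max_eq a ha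
      rw [hzero 8 (by omega) (by decide)]
      omega)
    (fun i _ => hzero 7 (by omega) (by decide) i) (hzero 10 (by omega) (by decide) 0)
    (fun u hu => by
      rw [hY u hu]
      exact (_root_.abs_le.1 (hM'.abs_min u hu)).1)
    (fun u hu => by
      rw [hY u hu]
      exact ρ.sz_mono hszMneg (by nlinarith))
  have hH2 : Holds n k m A B G.disc M s2 := hH.of_same hs2 (by decide) (by decide)
  have g5 : s2.nat 5 = s1.nat 5 := hs2.nat 5 (by decide)
  have g6 : s2.nat 6 = s1.nat 6 := hs2.nat 6 (by decide)
  obtain ⟨t3, s3, he3, ht3, hout, hout'⟩ := write_runs hS hM' he2.final hH2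
    (fun u hu => (hY2 u hu).1) (fun u hu => (hY2 u hu).2) (X := X)
    (fun i _ => by rw [g5]) (fun j _ => by rw [g6])
    (fun i hi => by
      obtain ⟨a, -, h⟩ := hl.mem_max i hi
      rw [g5, h]
      exact a.2)
    (fun j hj => by
      obtain ⟨a, -, h⟩ := hl.mem_min j hj
      rw [g6, h]
      exact a.2)
  refine ⟨_, s3, .seq he1 (.seq he2 he3), ?_, ?_⟩
  · rw [hr] at ht1 ht2 ht3
    -- The constant `4` in the time bound is the cost of the test of the outer loop.
    exact Nat.add_le_add ht1 (Nat.add_le_add ht2 ht3)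
  · have : s3.output n = x := by
      funext a
      change s3.real 2 a = x a
      by_cases ha : a ∈ G.VMax
      · obtain ⟨i, hi, hia⟩ := hl.exists_max a ha
        have := hout i hi
        rw [g5, hia] at this
        rw [this, hX]
      · obtain ⟨j, hj, hja⟩ := hl.exists_min a ha
        have := hout' j hj
        rw [g6, hja] at this
        rw [this, hX]
    rw [this]
    exact hx

end DiscountedGame

/-! ### Polynomial bounds. -/

theorem theorem2 :
    ∃ (p : RealRAM.Prog) (C k : ℕ), ∀ (n : ℕ) (G : DiscountedGame n), G.Bipartite →
      ∃ (t : ℕ) (s : RealRAM.Mem),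
        RealRAM.Exec
          (fun m => m.FitsIn (C * (n + 1) ^ k) ∧
            ∀ L : ℕ, G.RationalData L → m.RealBits (C * (n + L + 1) ^ k))
          p G.input t s ∧
        t ≤ C * (n + 1) ^ k * 2 ^ n ∧
        G.IsValueVector (s.output n) := by
  -- The outer loop is left out: its body is counted once here, and the factor `2 ^ n` enters at the
  -- end.
  obtain ⟨C, k, hC⟩ :=
    (RealRAM.Prog.seq RealRAM.prepare (.seq RealRAM.round RealRAM.write)).time_poly
  -- The bit bound has degree four, from `n * n`, one factor for the rows and one for `L`; its
  -- constant is `16 * 19 + 2`, which `400` covers along with the other additive constants.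
  refine ⟨RealRAM.solve, C + 400, k + 4, fun n G hG => ?_⟩
  obtain ⟨t, s, he, ht, hv⟩ := G.exists_exec_solve hG
  have hpow : ∀ x j : ℕ, j ≤ k + 4 → (x + 1) ^ j ≤ (x + 1) ^ (k + 4) := fun x j hj =>
    Nat.pow_le_pow_right (by omega) hj
  refine ⟨t, s, he.mono ?_, ht.trans ?_, hv⟩
  · rintro s' ⟨hfit, hsz⟩
    constructor
    · have hle : n * n + 2 * n + 2 ≤ (C + 400) * (n + 1) ^ (k + 4) := by
        have := hpow n 2 (by omega)
        calc n * n + 2 * n + 2 ≤ 400 * (n + 1) ^ 2 := by nlinarith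
          _ ≤ 400 * (n + 1) ^ (k + 4) := by omega
          _ ≤ _ := Nat.mul_le_mul_right _ (by omega)
      exact ⟨fun arr i => (hfit.1 arr i).trans hle, fun arr i hi => hfit.2 arr i (hle.trans hi)⟩
    · intro L hL arr i
      obtain ⟨q, hq, hq'⟩ := (hsz arr i L hL).ratBits
      refine ⟨q, hq, hq'.trans ?_⟩
      have := hpow (n + L) 4 (by omega)
      change 2 * (8 * ((2 * (2 * (n * n) + 7) + 5) * (n + 1)) * (L + 1)) + 2 ≤ _
      have h1 : n + 1 ≤ n + L + 1 := by omega
      have h2 : L + 1 ≤ n + L + 1 := by omega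
      have h3 : 2 * (2 * (n * n) + 7) + 5 ≤ 19 * (n + L + 1) ^ 2 := by nlinarith
      have h4 : (2 * (2 * (n * n) + 7) + 5) * (n + 1) * (L + 1) ≤
          19 * (n + L + 1) ^ 2 * (n + L + 1) * (n + L + 1) := by gcongr
      have h5 : 19 * (n + L + 1) ^ 2 * (n + L + 1) * (n + L + 1) = 19 * (n + L + 1) ^ 4 := by ring
      have h6 : 1 ≤ (n + L + 1) ^ 4 := Nat.one_le_pow _ _ (by omega)
      rw [h5] at h4
      calc 2 * (8 * ((2 * (2 * (n * n) + 7) + 5) * (n + 1)) * (L + 1)) + 2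
          = 16 * ((2 * (2 * (n * n) + 7) + 5) * (n + 1) * (L + 1)) + 2 := by ring
        _ ≤ 400 * (n + L + 1) ^ 4 := by linarith
        _ ≤ 400 * (n + L + 1) ^ (k + 4) := by omega
        _ ≤ _ := Nat.mul_le_mul_right _ (by omega)
  · have h1 := hC n
    simp only [RealRAM.Prog.time] at h1
    have h2 := hpow n k (by omega)
    have h3 : 1 ≤ (n + 1) ^ (k + 4) := Nat.one_le_pow _ _ (by omega)
    have h4 : 1 ≤ 2 ^ n := Nat.one_le_two_pow
    set a := RealRAM.prepare.time n
    set b := RealRAM.round.time n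
    set d := RealRAM.write.time n
    have h5 : a + (b + d) + 8 ≤ (C + 400) * (n + 1) ^ (k + 4) := by
      have := Nat.mul_le_mul_left C h2
      rw [add_mul]
      omega
    calc a + (2 ^ n * (4 + b) + 4 + d) ≤ (a + (b + d) + 8) * 2 ^ n := by nlinarith
      _ ≤ _ := Nat.mul_le_mul_right _ h5
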